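/- **Theorem 1.1.** Let $n,m\in\mathbb N$ and let $\mathcal Q$ be the family of all cubes $Q\subset\mathbb R^n$ with sides parallel to the axes; $\ell_Q$ and $|Q|$ denote the side length and the volume of $Q$. Let $p_1,\dots,p_m\in(1,\infty)$, $\vec P=(p_1,\dots,p_m)$, $1/p=1/p_1+\cdots+1/p_m$, and assume $$1<p\le p_0<\frac n\alpha,\qquad 0<\beta\le\alpha<mn .$$ Set $\theta=\frac{n-\beta p_0}{n-\alpha p_0}$, $q=\theta p$ and $q_0=\theta p_0$. A weight is a nonnegative locally integrable function $\mu$ on $\mathbb R^n$; for a cube $Q$ and $r\ge1$ write $\mu^r(Q)=\int_Q\mu^r\,dx$ and $\mu(Q)=\mu^1(Q)$. Write $[\mu]_{A_\infty}=\lim_{s\to\infty}[\mu]_{A_s}$, where $[\mu]_{A_s}=\sup_{Q\in\mathcal Q}\big(\frac1{|Q|}\int_Q\mu\,dx\big)\big(\frac1{|Q|}\int_Q\mu^{-1/(s-1)}\,dx\big)^{s-1}$ for $1<s<\infty$, with $0\cdot\infty=0$; $\mu\in A_\infty$ means $[\mu]_{A_\infty}<\infty$. For locally integrable real- or complex-valued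 functions $f_1,\dots,f_m$ on $\mathbb R^n$ and $\vec f=(f_1,\dots,f_m)$ put $$\mathfrak I_\alpha(\vec f)(x)=\int_{(\mathbb R^n)^m}\frac{\prod_{i=1}^m f_i(y_i)}{(|x-y_1|+\cdots+|x-y_m|)^{mn-\alpha}}\,dy_1\cdots dy_m,$$ $$\|\vec f\|_{\mathcal M^{\vec P,p_0}}=\sup_{Q\in\mathcal Q}|Q|^{1/p_0}\prod_{i=1}^m\Big(\frac1{|Q|}\int_Q|f_i|^{p_i}\,dy\Big)^{1/p_i},\qquad \|g\|_{\mathcal M^{q,q_0}_\mu}=\sup_{Q\in\mathcal Q}|Q|^{1/q_0-1/q}\Big(\int_Q|g|^q\,\mu\,dx\Big)^{1/q}.$$ Each of the following holds. (a) For every $K<\infty$ there is a constant $C<\infty$, depending only on $n,m,\vec P,p_0,\alpha,\beta$ and $K$, such that for every weight $\mu\in A_\infty$ with $[\mu]_{A_\infty}\le K$ and $$A_0:=\sup_{Q\in\mathcal Q}\ell_Q^{\beta}\Big(\frac{\mu(Q)}{|Q|}\Big)^{1/p}<\infty,$$ and for every $\vec f$ with $\|\vec f\|_{\mathcal M^{\vec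 P,p_0}}<\infty$, the integral defining $\mathfrak I_\alpha(\vec f)(x)$ converges absolutely for $\mu\,dx$-almost every $x$, $\mathfrak I_\alpha(\vec f)$ is $\mu\,dx$-measurable, and $$\|\mathfrak I_\alpha(\vec f)\|_{\mathcal M^{q,q_0}_\mu}\le C\,A_0^{1/\theta}\,\|\vec f\|_{\mathcal M^{\vec P,p_0}} .$$ (b) For every $r>1$ there is a constant $C<\infty$, depending only on $n,m,\vec P,p_0,\alpha,\beta$ and $r$, such that for every weight $\mu$ with $$A_0:=\sup_{Q\in\mathcal Q}\ell_Q^{\beta}\Big(\frac{\mu^r(Q)}{|Q|}\Big)^{\frac1{rp}}<\infty$$ and for every $\vec f$ with $\|\vec f\|_{\mathcal M^{\vec P,p_0}}<\infty$, the same conclusions hold with this $A_0$. -/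

import Mathlib

open MeasureTheory Filter Topology
open scoped ENNReal NNReal

noncomputable section

namespace MorreyTrace

/-- The Euclidean space of dimension `n`, with the Euclidean norm and Lebesgue measure. -/
abbrev Rn (n : ℕ) : Type := EuclideanSpace ℝ (Fin n)

/-- The axis-parallel cube with lower corner `a` and side length `ℓ` (used for `0 < ℓ`).
Faces are Lebesgue null, so it is immaterial which of them belong to the cube. -/
def cube {n : ℕ} (a : Rn n) (ℓ : ℝ) : Set (Rn n) :=
  {x | ∀ i, a i ≤ x i ∧ x i < a i + ℓ}

/-- A weight: a nonnegative locally integrable function. -/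
structure IsWeight {n : ℕ} (w : Rn n → ℝ) : Prop where
  nonneg : ∀ x, 0 ≤ w x
  locallyIntegrable : LocallyIntegrable w volume

/-- The measure `w dx`. -/
def weightMeasure {n : ℕ} (w : Rn n → ℝ) : Measure (Rn n) :=
  volume.withDensity fun x => ENNReal.ofReal (w x)

/-- The characteristic `[w]_{A_s}`, used for `1 < s`. -/
def apConst {n : ℕ} (w : Rn n → ℝ) (s : ℝ) : ℝ≥0∞ :=
  ⨆ (a : Rn n) (ℓ : ℝ) (_ : 0 < ℓ),
    ((∫⁻ x in cube a ℓ, ENNReal.ofReal (w x)) / volume (cube a ℓ)) *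
      ((∫⁻ x in cube a ℓ, ENNReal.ofReal (w x) ^ (-(1 / (s - 1)))) / volume (cube a ℓ)) ^ (s - 1)

/-- The characteristic `[w]_{A_∞}`, the limit of `[w]_{A_s}` as `s → ∞`. By Hölder's inequality
`[w]_{A_s}` is nonincreasing in `s`, so the limit exists in `[0, ∞]` and is the upper limit. -/
def aInftyConst {n : ℕ} (w : Rn n → ℝ) : ℝ≥0∞ :=
  limsup (fun s : ℝ => apConst w s) atTop

/-- The product Morrey norm of `f = (f₁, …, f_m)` with exponents `P = (p₁, …, p_m)` and `p₀`. -/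
def productMorreyNorm {𝕜 : Type*} [RCLike 𝕜] {n m : ℕ} (P : Fin m → ℝ) (p₀ : ℝ)
    (f : Fin m → Rn n → 𝕜) : ℝ≥0∞ :=
  ⨆ (a : Rn n) (ℓ : ℝ) (_ : 0 < ℓ),
    volume (cube a ℓ) ^ (1 / p₀) *
      ∏ i, ((∫⁻ y in cube a ℓ, ‖f i y‖ₑ ^ P i) / volume (cube a ℓ)) ^ (1 / P i)

/-- The Radon-Morrey norm with respect to `μ`. -/
def radonMorreyNorm {𝕜 : Type*} [RCLike 𝕜] {n : ℕ} (μ : Measure (Rn n)) (q q₀ : ℝ)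
    (g : Rn n → 𝕜) : ℝ≥0∞ :=
  ⨆ (a : Rn n) (ℓ : ℝ) (_ : 0 < ℓ),
    volume (cube a ℓ) ^ (1 / q₀ - 1 / q) * (∫⁻ x in cube a ℓ, ‖g x‖ₑ ^ q ∂μ) ^ (1 / q)

/-- The integrand, as a function of `y = (y₁, …, y_m)`, of the multilinear fractional integral
at the point `x`. -/
def fracIntegrand {𝕜 : Type*} [RCLike 𝕜] {n m : ℕ} (α : ℝ) (f : Fin m → Rn n → 𝕜)
    (x : Rn n) (y : Fin m → Rn n) : 𝕜 :=
  (∏ i, f i (y i)) / (((∑ i, ‖x - y i‖) ^ ((m : ℝ) * n - α) : ℝ) : 𝕜)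

/-- The `m`-linear fractional integral operator. -/
def fracIntegral {𝕜 : Type*} [RCLike 𝕜] {n m : ℕ} (α : ℝ) (f : Fin m → Rn n → 𝕜)
    (x : Rn n) : 𝕜 :=
  ∫ y : Fin m → Rn n, fracIntegrand α f x y

/-- `sup_Q ℓ_Q^β (w(Q) / |Q|)^{1/p}`. -/
def olsenConst {n : ℕ} (β p : ℝ) (w : Rn n → ℝ) : ℝ≥0∞ :=
  ⨆ (a : Rn n) (ℓ : ℝ) (_ : 0 < ℓ),
    ENNReal.ofReal ℓ ^ β * (weightMeasure w (cube a ℓ) / volume (cube a ℓ)) ^ (1 / p)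

/-- `sup_Q ℓ_Q^β (w^r(Q) / |Q|)^{1/(rp)}`. -/
def olsenPowerConst {n : ℕ} (r β p : ℝ) (w : Rn n → ℝ) : ℝ≥0∞ :=
  ⨆ (a : Rn n) (ℓ : ℝ) (_ : 0 < ℓ),
    ENNReal.ofReal ℓ ^ β *
      ((∫⁻ x in cube a ℓ, ENNReal.ofReal (w x) ^ r) / volume (cube a ℓ)) ^ (1 / (r * p))

end MorreyTrace

end

/-!
The proof separates the geometry of the potential, which is reduced to a trace inequality for a
dyadic operator, from the geometry of the weight.

*From the potential to dyadic averages.* Slicing the kernel into the shells where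
`∑ |x - y_i| ∼ h 2^k` dominates `∫ |integrand|` by `∑_k (h 2^k)^α ∏ avg_k |f_i|`, a sum of products
of averages over balls (`lintegral_enorm_fracIntegrand_le`). The Morrey norm `M` of `f` makes the
products of averages decay like `M (h 2^k)^(-n / p₀)` (`prod_ballMean_le`). Splitting the sum at the
scale where this decay balances the sum with exponent `β` gives Hedberg's inequality
`S_α ≤ C S_β^(1 / θ) M^(1 - 1 / θ)` (`exists_tsum_le_hedberg`). Since `q = θ p`, the `L^q` bound for
order `α` becomes an `L^p` bound for order `β`, and only that has to be proved.

*The estimate of order `β` on a cube of side `h`.* Scales above `h` are summed trivially with the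
decay. For scales below `h` only the values of `f` on the triple cube matter, and the one-third
trick puts every ball into a comparable cube of one of `2^n` dyadic grids
(`exists_closedBall_subset_gridCube`). What remains is the global dyadic trace inequality
`exists_lintegral_dyadic_rpow_le`.

*The dyadic trace inequality.* By duality it is enough to pair the sum with `g w^(1 / p)`, where
`g ∈ L^{p'}`. The pairing is written as an integral over the heights `t` of the level sets
`{∏ avg_k f_i > t}`. The maximal cubes of a level set partition it
(`measure_le_of_maximal_gridCubes`); on one of side `ℓ` the sum of `(h 2^k)^β` over the cubes inside
is at most a constant times `ℓ^β`. Hölder's inequality with exponents `σ = (r p)'` and `r p`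
separates `g` from `w`, and the hypothesis on the weight absorbs exactly
`ℓ^β (avg w^r)^(1 / (r p))`. The pairing is thereby bounded by
`∫ ∏ (maximal function of f_i) · (maximal function of g^σ)^(1 / σ)`, and the dyadic maximal theorem
finishes the proof, because `r > 1` means `σ < p'`. This proves part (b).

*Weights in `A_∞`.* Part (a) follows from part (b) by a reverse Hölder inequality
`avg w^r ≤ 2 (avg w)^r`, in which `r > 1` depends only on `n` and `K` (`exists_reverse_holder`).
A bound `[w]_{A_s} ≤ K + 1` for a single large `s` already implies
`avg w ≤ (K + 1) (avg w^(1 / 2))^2`, with a constant free of `s`. By a Paley–Zygmund argument `w` is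
then comparable to its average on a fixed proportion of every cube, the Calderón–Zygmund
decomposition turns this into the estimate `setLIntegral_level_le` between the level sets of `w`,
and integrating that estimate against a small power of the height yields the reverse Hölder
inequality.
-/

noncomputable section

namespace MorreyTrace

/-! ### Dyadic grids -/

/-- The integer vector labelling the cube that contains `x` in the grid with origin `a` and
mesh `h * 2 ^ k`. -/
def gridIndex {n : ℕ} (a : Rn n) (h : ℝ) (k : ℤ) (x : Rn n) : Fin n → ℤ :=
  fun i => ⌊(x i - a i) / (h * 2 ^ k)⌋

/-- The cube containing `x` of the grid with origin `a` and mesh `h * 2 ^ k`. For fixed `a` and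
`h` the grids with `k ∈ ℤ` are nested. -/
def gridCube {n : ℕ} (a : Rn n) (h : ℝ) (k : ℤ) (x : Rn n) : Set (Rn n) :=
  {y | gridIndex a h k y = gridIndex a h k x}

/-- The average of `f` over the cube of the `k`-th grid that contains `x`. -/
def gridAvg {n : ℕ} (a : Rn n) (h : ℝ) (k : ℤ) (f : Rn n → ℝ≥0∞) (x : Rn n) : ℝ≥0∞ :=
  (∫⁻ y in gridCube a h k x, f y) / volume (gridCube a h k x)

/-- The dyadic maximal function over cubes of side length at most `h * 2 ^ K`. -/
def gridMax {n : ℕ} (a : Rn n) (h : ℝ) (K : ℤ) (f : Rn n → ℝ≥0∞) (x : Rn n) : ℝ≥0∞ :=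
  ⨆ (k : ℤ) (_ : k ≤ K), gridAvg a h k f x

variable {n : ℕ}

theorem side_pos {h : ℝ} (hh : 0 < h) (k : ℤ) : 0 < h * (2 : ℝ) ^ k := by positivity

theorem measurableSet_cube (a : Rn n) (ℓ : ℝ) : MeasurableSet (cube a ℓ) := by
  have : cube a ℓ = ⋂ i, ({x : Rn n | a i ≤ x i} ∩ {x | x i < a i + ℓ}) := by
    ext x; simp [cube, forall_and]
  rw [this]
  refine MeasurableSet.iInter fun i => ?_
  have hm : Measurable fun x : Rn n => x i := by fun_prop
  exact (measurableSet_le measurable_const hm).inter (measurableSet_lt hm measurable_const)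

theorem volume_cube (a : Rn n) (ℓ : ℝ) : volume (cube a ℓ) = ENNReal.ofReal ℓ ^ n := by
  have h1 : cube a ℓ = (WithLp.ofLp : Rn n → (Fin n → ℝ)) ⁻¹'
      (Set.pi Set.univ fun i => Set.Ico (a i) (a i + ℓ)) := by
    ext x; simp [cube]
  have h2 : MeasurableSet (Set.pi Set.univ fun i : Fin n => Set.Ico (a i) (a i + ℓ)) :=
    MeasurableSet.univ_pi fun i => measurableSet_Ico
  rw [h1, (PiLp.volume_preserving_ofLp (Fin n)).measure_preimage h2.nullMeasurableSet,
    Real.volume_pi_Ico]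
  simp

theorem volume_cube_ne_zero (a : Rn n) {ℓ : ℝ} (hℓ : 0 < ℓ) : volume (cube a ℓ) ≠ 0 := by
  rw [volume_cube]; simp [hℓ]

theorem volume_cube_ne_top (a : Rn n) (ℓ : ℝ) : volume (cube a ℓ) ≠ ∞ := by
  rw [volume_cube]; exact ENNReal.pow_ne_top ENNReal.ofReal_ne_top

theorem gridCube_eq_cube (a : Rn n) {h : ℝ} (hh : 0 < h) (k : ℤ) (x : Rn n) :
    gridCube a h k x =
      cube (WithLp.toLp 2 fun i => a i + gridIndex a h k x i * (h * 2 ^ k)) (h * 2 ^ k) := by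
  have hs := side_pos hh k
  ext y
  simp only [gridCube, cube, Set.mem_ofPred_eq, funext_iff]
  refine forall_congr' fun i => ?_
  rw [show gridIndex a h k y i = ⌊(y i - a i) / (h * 2 ^ k)⌋ from rfl, Int.floor_eq_iff,
    le_div_iff₀ hs, div_lt_iff₀ hs]
  constructor <;> rintro ⟨h1, h2⟩ <;> constructor <;> linarith

theorem mem_gridCube_self (a : Rn n) (h : ℝ) (k : ℤ) (x : Rn n) : x ∈ gridCube a h k x := rfl

theorem measurable_gridIndex (a : Rn n) (h : ℝ) (k : ℤ) : Measurable (gridIndex a h k) := by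
  refine measurable_pi_lambda _ fun i => ?_
  unfold gridIndex
  refine Int.measurable_floor.comp ?_
  fun_prop

theorem measurableSet_gridCube (a : Rn n) (h : ℝ) (k : ℤ) (x : Rn n) :
    MeasurableSet (gridCube a h k x) :=
  measurable_gridIndex a h k (measurableSet_singleton (gridIndex a h k x))

theorem volume_gridCube (a : Rn n) {h : ℝ} (hh : 0 < h) (k : ℤ) (x : Rn n) :
    volume (gridCube a h k x) = ENNReal.ofReal (h * 2 ^ k) ^ n := by
  rw [gridCube_eq_cube a hh, volume_cube]

theorem volume_gridCube_ne_zero (a : Rn n) {h : ℝ} (hh : 0 < h) (k : ℤ) (x : Rn n) :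
    volume (gridCube a h k x) ≠ 0 := by
  rw [gridCube_eq_cube a hh]; exact volume_cube_ne_zero _ (side_pos hh k)

theorem volume_gridCube_ne_top (a : Rn n) {h : ℝ} (hh : 0 < h) (k : ℤ) (x : Rn n) :
    volume (gridCube a h k x) ≠ ∞ := by
  rw [gridCube_eq_cube a hh]; exact volume_cube_ne_top _ _

/-- The grids are nested. -/
theorem gridIndex_eq_of_le (a : Rn n) (h : ℝ) {k j : ℤ} (hkj : k ≤ j) {x y : Rn n}
    (hxy : gridIndex a h k y = gridIndex a h k x) : gridIndex a h j y = gridIndex a h j x := by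
  obtain ⟨N, rfl⟩ := Int.le.dest hkj
  have key : ∀ z : Rn n, ∀ i, gridIndex a h (k + N) z i = gridIndex a h k z i / ((2 ^ N : ℕ) : ℤ) := by
    intro z i
    unfold gridIndex
    rw [← Int.floor_div_natCast, zpow_add₀ (two_ne_zero), ← mul_assoc, ← div_div]
    simp
  funext i
  rw [key, key, hxy]

theorem gridCube_subset_of_le (a : Rn n) (h : ℝ) {k j : ℤ} (hkj : k ≤ j) (x : Rn n) :
    gridCube a h k x ⊆ gridCube a h j x := fun _ hy => gridIndex_eq_of_le a h hkj hy

theorem gridCube_congr {a : Rn n} {h : ℝ} {k j : ℤ} (hkj : k ≤ j) {x y : Rn n}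
    (hy : y ∈ gridCube a h k x) : gridCube a h j y = gridCube a h j x := by
  unfold gridCube
  rw [gridIndex_eq_of_le a h hkj hy]

theorem gridAvg_congr {a : Rn n} {h : ℝ} {k j : ℤ} (hkj : k ≤ j) (f : Rn n → ℝ≥0∞) {x y : Rn n}
    (hy : y ∈ gridCube a h k x) : gridAvg a h j f y = gridAvg a h j f x := by
  unfold gridAvg
  rw [gridCube_congr hkj hy]

/-- A set that is a union of cubes of one grid is measurable. -/
theorem measurableSet_of_gridCube_invariant (a : Rn n) (h : ℝ) (k : ℤ) {Q : Rn n → Prop}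
    (hQ : ∀ x y, y ∈ gridCube a h k x → Q x → Q y) : MeasurableSet {x | Q x} := by
  have : {x | Q x} = gridIndex a h k ⁻¹' (gridIndex a h k '' {x | Q x}) := by
    ext x
    constructor
    · exact fun hx => ⟨x, hx, rfl⟩
    · rintro ⟨y, hy, hyx⟩
      exact hQ y x hyx.symm hy
  rw [this]
  exact measurable_gridIndex a h k (Set.to_countable _).measurableSet

theorem measurable_gridAvg (a : Rn n) (h : ℝ) (k : ℤ) (f : Rn n → ℝ≥0∞) :
    Measurable (gridAvg a h k f) := by
  intro s _
  refine measurableSet_of_gridCube_invariant a h k (Q := fun x => gridAvg a h k f x ∈ s) ?_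
  intro x y hy hx
  rwa [gridAvg_congr le_rfl f hy]

theorem measurable_gridMax (a : Rn n) (h : ℝ) (K : ℤ) (f : Rn n → ℝ≥0∞) :
    Measurable (gridMax a h K f) := by
  refine Measurable.iSup fun k => Measurable.iSup fun _ => measurable_gridAvg a h k f

theorem gridAvg_le_gridMax (a : Rn n) (h : ℝ) {k K : ℤ} (hk : k ≤ K) (f : Rn n → ℝ≥0∞) (x : Rn n) :
    gridAvg a h k f x ≤ gridMax a h K f x :=
  le_iSup₂_of_le k hk le_rfl

theorem setLIntegral_gridCube (a : Rn n) {h : ℝ} (hh : 0 < h) (k : ℤ) (f : Rn n → ℝ≥0∞) (x : Rn n) :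
    ∫⁻ y in gridCube a h k x, f y = volume (gridCube a h k x) * gridAvg a h k f x := by
  unfold gridAvg
  rw [ENNReal.mul_div_cancel (volume_gridCube_ne_zero a hh k x) (volume_gridCube_ne_top a hh k x)]

/-- Comparison of two measures on a union of selected grid cubes: it is enough to compare them on
the maximal selected cubes, which partition the union. -/
theorem measure_le_of_maximal_gridCubes (a : Rn n) (h : ℝ) (K : ℤ) {Q : ℤ → Rn n → Prop}
    (hQ : ∀ k x y, y ∈ gridCube a h k x → Q k x → Q k y) (ν μ : Measure (Rn n))
    (H : ∀ k ≤ K, ∀ x, Q k x → (∀ j, k < j → j ≤ K → ¬ Q j x) →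
      ν (gridCube a h k x) ≤ μ (gridCube a h k x)) :
    ν {x | ∃ k ≤ K, Q k x} ≤ μ {x | ∃ k ≤ K, Q k x} := by
  let R : ℤ → Rn n → Prop := fun k x => k ≤ K ∧ Q k x ∧ ∀ j, k < j → j ≤ K → ¬ Q j x
  have hR : ∀ k x y, y ∈ gridCube a h k x → R k x → R k y := by
    rintro k x y hy ⟨h1, h2, h3⟩
    refine ⟨h1, hQ k x y hy h2, fun j hj hjK hj' => h3 j hj hjK (hQ j y x ?_ hj')⟩
    exact (gridIndex_eq_of_le a h hj.le hy).symm
  let S : ℤ × (Fin n → ℤ) → Set (Rn n) := fun z => {x | R z.1 x ∧ gridIndex a h z.1 x = z.2}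
  have hS : {x | ∃ k ≤ K, Q k x} = ⋃ z, S z := by
    ext x
    simp only [Set.mem_ofPred_eq, Set.mem_iUnion, S]
    constructor
    · rintro ⟨k, hk, hx⟩
      obtain ⟨m, ⟨hm1, hm2⟩, hm3⟩ := Int.exists_greatest_of_bdd
        (P := fun j => j ≤ K ∧ Q j x) ⟨K, fun z hz => hz.1⟩ ⟨k, hk, hx⟩
      exact ⟨(m, gridIndex a h m x), ⟨hm1, hm2, fun j hj hjK hq =>
        absurd (hm3 j ⟨hjK, hq⟩) (not_le.2 hj)⟩, rfl⟩
    · rintro ⟨z, hz, -⟩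
      exact ⟨z.1, hz.1, hz.2.1⟩
  have hSm : ∀ z, MeasurableSet (S z) := fun z =>
    (measurableSet_of_gridCube_invariant a h z.1 (hR z.1)).inter
      (measurable_gridIndex a h z.1 (measurableSet_singleton z.2))
  have hSd : Pairwise (Function.onFun Disjoint S) := by
    rintro ⟨k, u⟩ ⟨j, v⟩ hne
    refine Set.disjoint_left.2 ?_
    rintro x ⟨⟨h1, h2, h3⟩, h4⟩ ⟨⟨g1, g2, g3⟩, g4⟩
    have hkj : k = j := by
      rcases lt_trichotomy k j with hlt | heq | hlt
      · exact absurd g2 (h3 j hlt g1)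
      · exact heq
      · exact absurd h2 (g3 k hlt h1)
    subst hkj
    exact hne (Prod.ext rfl (h4.symm.trans g4))
  rw [hS, measure_iUnion hSd hSm, measure_iUnion hSd hSm]
  refine ENNReal.tsum_le_tsum fun z => ?_
  rcases (S z).eq_empty_or_nonempty with he | ⟨x, hx, hxz⟩
  · simp [he]
  · have : S z = gridCube a h z.1 x := by
      ext y
      constructor
      · rintro ⟨-, hy⟩
        exact hy.trans hxz.symm
      · intro hy
        exact ⟨hR _ _ _ hy hx, hy.trans hxz⟩
    rw [this]
    exact H z.1 hx.1 x hx.2.1 hx.2.2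

/-! ### Geometric sums over dyadic scales -/

theorem one_sub_two_rpow_neg_inv_ne_top {γ : ℝ} (hγ : 0 < γ) :
    (1 - (2 : ℝ≥0∞) ^ (-γ))⁻¹ ≠ ∞ := by
  have : (2 : ℝ≥0∞) ^ (-γ) < 1 :=
    ENNReal.rpow_lt_one_of_one_lt_of_neg (by norm_num) (by linarith)
  exact ENNReal.inv_ne_top.2 (tsub_pos_of_lt this).ne'

/-- Comparison with a geometric series indexed by the scales in the range of `e`. -/
theorem tsum_le_geometric {γ : ℝ} (e : ℕ → ℤ) (he : Function.Injective e) (B : ℝ≥0∞)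
    (u : ℤ → ℝ≥0∞) (hsupp : ∀ k, u k ≠ 0 → k ∈ Set.range e)
    (hu : ∀ N : ℕ, u (e N) ≤ B * ((2 : ℝ≥0∞) ^ (-γ)) ^ N) :
    ∑' k, u k ≤ (1 - (2 : ℝ≥0∞) ^ (-γ))⁻¹ * B := by
  have h1 : ∑' N, u (e N) = ∑' k, u k := he.tsum_eq fun k hk => hsupp k hk
  rw [← h1]
  calc ∑' N, u (e N) ≤ ∑' N : ℕ, B * ((2 : ℝ≥0∞) ^ (-γ)) ^ N := ENNReal.tsum_le_tsum hu
    _ = (1 - (2 : ℝ≥0∞) ^ (-γ))⁻¹ * B := by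
        rw [ENNReal.tsum_mul_left, ENNReal.tsum_geometric, mul_comm]

theorem two_rpow_neg_pow (γ : ℝ) (N : ℕ) :
    ((2 : ℝ≥0∞) ^ (-γ)) ^ N = ENNReal.ofReal ((2 : ℝ) ^ N) ^ (-γ) := by
  rw [ENNReal.ofReal_pow (by norm_num), ← ENNReal.rpow_natCast, ← ENNReal.rpow_natCast,
    ← ENNReal.rpow_mul, ← ENNReal.rpow_mul, mul_comm]
  simp

/-- The sum of a positive power of the dyadic scales up to `t` is comparable to its last term. -/
theorem tsum_side_rpow_le {γ : ℝ} (hγ : 0 < γ) {h t : ℝ} (hh : 0 < h) (ht : 0 < t) :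
    ∑' k : ℤ, (if h * 2 ^ k ≤ t then ENNReal.ofReal (h * 2 ^ k) ^ γ else 0) ≤
      (1 - (2 : ℝ≥0∞) ^ (-γ))⁻¹ * ENNReal.ofReal t ^ γ := by
  obtain ⟨k₀, h1, h2⟩ := exists_mem_Ico_zpow (div_pos ht hh) (one_lt_two (α := ℝ))
  rw [le_div_iff₀ hh, mul_comm] at h1
  rw [div_lt_iff₀ hh, mul_comm] at h2
  refine tsum_le_geometric (fun N : ℕ => k₀ - N) (fun a b hab => by simpa using hab) _ _ ?_ ?_
  · intro k hk
    have hk' : h * 2 ^ k ≤ t := by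
      by_contra hc
      exact hk (if_neg hc)
    have : (2 : ℝ) ^ k < 2 ^ (k₀ + 1) := lt_of_mul_lt_mul_left (hk'.trans_lt h2) hh.le
    have : k < k₀ + 1 := (zpow_lt_zpow_iff_right₀ one_lt_two).1 this
    exact ⟨(k₀ - k).toNat, by simp only; omega⟩
  · intro N
    have hs : h * 2 ^ (k₀ - (N : ℤ)) ≤ t * ((2 : ℝ) ^ N)⁻¹ := by
      rw [zpow_sub₀ two_ne_zero, zpow_natCast, div_eq_mul_inv, ← mul_assoc]
      gcongr
    split_ifs
    · rw [two_rpow_neg_pow, ENNReal.rpow_neg, ← ENNReal.inv_rpow,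
        ← ENNReal.ofReal_inv_of_pos (by positivity), ← ENNReal.mul_rpow_of_nonneg _ _ hγ.le,
        ← ENNReal.ofReal_mul ht.le]
      gcongr
    · exact zero_le

/-- The sum of a negative power of the dyadic scales from `t` on is comparable to its first
term. -/
theorem tsum_side_rpow_neg_le {γ : ℝ} (hγ : 0 < γ) {h t : ℝ} (hh : 0 < h) (ht : 0 < t) :
    ∑' k : ℤ, (if t ≤ h * 2 ^ k then ENNReal.ofReal (h * 2 ^ k) ^ (-γ) else 0) ≤
      (1 - (2 : ℝ≥0∞) ^ (-γ))⁻¹ * ENNReal.ofReal t ^ (-γ) := by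
  obtain ⟨k₀, h1, h2⟩ := exists_mem_Ioc_zpow (div_pos ht hh) (one_lt_two (α := ℝ))
  rw [lt_div_iff₀ hh, mul_comm] at h1
  rw [div_le_iff₀ hh, mul_comm] at h2
  refine tsum_le_geometric (fun N : ℕ => k₀ + 1 + N) (fun a b hab => by simpa using hab) _ _ ?_ ?_
  · intro k hk
    have hk' : t ≤ h * 2 ^ k := by
      by_contra hc
      exact hk (if_neg hc)
    have : (2 : ℝ) ^ k₀ < 2 ^ k := lt_of_mul_lt_mul_left (h1.trans_le hk') hh.le
    have : k₀ < k := (zpow_lt_zpow_iff_right₀ one_lt_two).1 this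
    exact ⟨(k - k₀ - 1).toNat, by simp only; omega⟩
  · intro N
    have hs : t * (2 : ℝ) ^ N ≤ h * 2 ^ (k₀ + 1 + (N : ℤ)) := by
      rw [zpow_add₀ two_ne_zero, zpow_natCast, ← mul_assoc]
      gcongr
    split_ifs
    · rw [two_rpow_neg_pow, ENNReal.rpow_neg, ENNReal.rpow_neg, ENNReal.rpow_neg,
        ← ENNReal.mul_inv (Or.inr (by simp)) (Or.inl (by simp [hγ.le])),
        ← ENNReal.mul_rpow_of_nonneg _ _ hγ.le, ← ENNReal.ofReal_mul ht.le]
      gcongr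
    · exact zero_le

/-! ### Integration lemmas -/

theorem setLIntegral_rpow_lt_ofReal {s : ℝ} (hs : 0 < s) {x : ℝ} (hx : 0 ≤ x) :
    ∫⁻ t in Set.Ioi (0 : ℝ), (if ENNReal.ofReal t < ENNReal.ofReal x then
      ENNReal.ofReal t ^ (s - 1) else 0) = ENNReal.ofReal x ^ s / ENNReal.ofReal s := by
  have h1 : ∀ t ∈ Set.Ioi (0 : ℝ), (if ENNReal.ofReal t < ENNReal.ofReal x then
      ENNReal.ofReal t ^ (s - 1) else 0) =
      (Set.Iio x).indicator (fun t => ENNReal.ofReal (t ^ (s - 1))) t := by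
    intro t ht
    have ht' : 0 < t := ht
    by_cases htx : t < x
    · rw [if_pos ((ENNReal.ofReal_lt_ofReal_iff_of_nonneg ht'.le).2 htx),
        Set.indicator_of_mem (by exact htx), ENNReal.ofReal_rpow_of_pos ht']
    · rw [if_neg fun hc => htx ((ENNReal.ofReal_lt_ofReal_iff_of_nonneg ht'.le).1 hc),
        Set.indicator_of_notMem (by exact htx)]
  rw [setLIntegral_congr_fun measurableSet_Ioi h1, lintegral_indicator measurableSet_Iio,
    Measure.restrict_restrict measurableSet_Iio, Set.Iio_inter_Ioi,
    setLIntegral_congr Ioo_ae_eq_Ioc, ← ofReal_integral_eq_lintegral_ofReal,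
    ← intervalIntegral.integral_of_le hx, integral_rpow (Or.inl (by linarith))]
  · rw [sub_add_cancel, Real.zero_rpow hs.ne', sub_zero, ENNReal.ofReal_div_of_pos hs,
      ENNReal.ofReal_rpow_of_nonneg hx hs.le]
  · exact (intervalIntegrable_iff_integrableOn_Ioc_of_le hx).1
      (intervalIntegral.intervalIntegrable_rpow' (by linarith))
  · refine (ae_restrict_mem measurableSet_Ioc).mono fun t ht => ?_
    exact Real.rpow_nonneg ht.1.le _

theorem setLIntegral_rpow_lt {s : ℝ} (hs : 0 < s) (X : ℝ≥0∞) :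
    ∫⁻ t in Set.Ioi (0 : ℝ), (if ENNReal.ofReal t < X then
      ENNReal.ofReal t ^ (s - 1) else 0) = X ^ s / ENNReal.ofReal s := by
  rcases eq_or_ne X ∞ with rfl | hX
  · rw [ENNReal.top_rpow_of_pos hs, ENNReal.top_div_of_ne_top ENNReal.ofReal_ne_top]
    have h1 : ∀ N : ℕ, (N : ℝ≥0∞) ^ s / ENNReal.ofReal s ≤
        ∫⁻ t in Set.Ioi (0 : ℝ), (if ENNReal.ofReal t < ∞ then
          ENNReal.ofReal t ^ (s - 1) else 0) := by
      intro N
      have := setLIntegral_rpow_lt_ofReal hs (Nat.cast_nonneg N)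
      rw [ENNReal.ofReal_natCast] at this
      rw [← this]
      refine lintegral_mono fun t => ?_
      rw [if_pos ENNReal.ofReal_lt_top]
      split_ifs
      · exact le_rfl
      · exact zero_le
    have h2 : Tendsto (fun N : ℕ => (N : ℝ≥0∞) ^ s / ENNReal.ofReal s) atTop
        (𝓝 (∞ ^ s / ENNReal.ofReal s)) := by
      refine ENNReal.Tendsto.div_const ?_ (Or.inr (by simpa using hs))
      exact (ENNReal.continuous_rpow_const.tendsto ∞).comp ENNReal.tendsto_nat_nhds_top
    rw [ENNReal.top_rpow_of_pos hs, ENNReal.top_div_of_ne_top ENNReal.ofReal_ne_top] at h2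
    exact top_le_iff.1 (le_of_tendsto' h2 h1)
  · lift X to ℝ≥0 using hX
    have := setLIntegral_rpow_lt_ofReal hs X.coe_nonneg
    rwa [ENNReal.ofReal_coe_nnreal] at this

/-- Layer cake formula with a density and values in `[0, ∞]`. -/
theorem lintegral_mul_rpow_eq_lintegral_layers {E : Type*} [MeasurableSpace E] {μ : Measure E}
    [SFinite μ] {s : ℝ} (hs : 0 < s) {g X : E → ℝ≥0∞} (hg : Measurable g) (hX : Measurable X) :
    ∫⁻ x, g x * X x ^ s ∂μ = ENNReal.ofReal s * ∫⁻ t in Set.Ioi (0 : ℝ),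
      ENNReal.ofReal t ^ (s - 1) * ∫⁻ x in {x | ENNReal.ofReal t < X x}, g x ∂μ := by
  have hs0 : ENNReal.ofReal s ≠ 0 := by simpa using hs
  have h1 : ∀ x, X x ^ s = ENNReal.ofReal s * ∫⁻ t in Set.Ioi (0 : ℝ),
      (if ENNReal.ofReal t < X x then ENNReal.ofReal t ^ (s - 1) else 0) := by
    intro x
    rw [setLIntegral_rpow_lt hs, ENNReal.mul_div_cancel hs0 ENNReal.ofReal_ne_top]
  have hm : Measurable fun z : E × ℝ =>
      g z.1 * (if ENNReal.ofReal z.2 < X z.1 then ENNReal.ofReal z.2 ^ (s - 1) else (0 : ℝ≥0∞)) := by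
    refine (hg.comp measurable_fst).mul (Measurable.ite ?_ (by fun_prop) measurable_const)
    exact measurableSet_lt (by fun_prop) (hX.comp measurable_fst)
  have hm1 : ∀ x, Measurable fun t : ℝ =>
      (if ENNReal.ofReal t < X x then ENNReal.ofReal t ^ (s - 1) else 0) := fun x =>
    Measurable.ite (measurableSet_lt (by fun_prop) measurable_const) (by fun_prop) measurable_const
  calc ∫⁻ x, g x * X x ^ s ∂μ
      = ∫⁻ x, ENNReal.ofReal s * ∫⁻ t in Set.Ioi (0 : ℝ),
          g x * (if ENNReal.ofReal t < X x then ENNReal.ofReal t ^ (s - 1) else 0) ∂volume ∂μ := by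
        refine lintegral_congr fun x => ?_
        rw [h1, lintegral_const_mul _ (hm1 x)]
        ring
    _ = ENNReal.ofReal s * ∫⁻ t in Set.Ioi (0 : ℝ), ∫⁻ x,
          g x * (if ENNReal.ofReal t < X x then ENNReal.ofReal t ^ (s - 1) else 0) ∂μ := by
        rw [lintegral_const_mul' _ _ ENNReal.ofReal_ne_top,
          lintegral_lintegral_swap (f := fun x t => g x * (if ENNReal.ofReal t < X x then
            ENNReal.ofReal t ^ (s - 1) else 0)) hm.aemeasurable]
    _ = _ := by
        congr 1
        refine lintegral_congr fun t => ?_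
        have hS : MeasurableSet {x | ENNReal.ofReal t < X x} :=
          measurableSet_lt measurable_const hX
        rw [← lintegral_indicator hS, ← lintegral_const_mul _ (hg.indicator hS)]
        refine lintegral_congr fun x => ?_
        by_cases hx : ENNReal.ofReal t < X x
        · rw [if_pos hx, Set.indicator_of_mem (by exact hx), mul_comm]
        · rw [if_neg hx, Set.indicator_of_notMem (by exact hx)]
          simp

/-- Tonelli's theorem for a product of functions of separate variables. -/
theorem lintegral_fin_prod_eq_prod {E : Type*} [MeasurableSpace E] (μ : Measure E) [SigmaFinite μ]
    {m : ℕ} (f : Fin m → E → ℝ≥0∞) (hf : ∀ i, Measurable (f i)) :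
    ∫⁻ y : Fin m → E, ∏ i, f i (y i) ∂(Measure.pi fun _ => μ) = ∏ i, ∫⁻ x, f i x ∂μ := by
  induction m with
  | zero => simp
  | succ m ih =>
    have hmp := (measurePreserving_piFinSuccAbove (fun _ : Fin (m + 1) => μ) 0).symm
    rw [← hmp.lintegral_comp_emb (MeasurableEquiv.measurableEmbedding _)]
    have hsplit : ∀ a : E × (Fin m → E),
        ∏ i, f i ((MeasurableEquiv.piFinSuccAbove (fun _ => E) 0).symm a i) =
          f 0 a.1 * ∏ i : Fin m, f i.succ (a.2 i) := fun a => by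
      rw [Fin.prod_univ_succ]
      rfl
    rw [lintegral_congr hsplit, Fin.prod_univ_succ]
    rw [lintegral_prod_mul (f := f 0) (g := fun y : Fin m → E => ∏ i, f i.succ (y i))
      (hf 0).aemeasurable, ih _ fun i => hf _]
    refine Measurable.aemeasurable ?_
    exact Finset.measurable_fun_prod _ fun i _ => (hf _).comp (measurable_pi_apply i)

/-- The converse of Hölder's inequality: a bound for all pairings bounds the `L^p` norm. -/
theorem lintegral_rpow_le_of_forall_pairing {E : Type*} [MeasurableSpace E] {μ : Measure E}
    [SigmaFinite μ] {p p' : ℝ} (hpp : p.HolderConjugate p') {G : E → ℝ≥0∞} (hG : Measurable G)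
    (Z : ℝ≥0∞) (H : ∀ g : E → ℝ≥0∞, Measurable g →
      ∫⁻ x, G x * g x ∂μ ≤ Z * (∫⁻ x, g x ^ p' ∂μ) ^ (1 / p')) :
    ∫⁻ x, G x ^ p ∂μ ≤ Z ^ p := by
  have hp0 : 0 < p := hpp.pos
  have hp1 : 0 < p - 1 := hpp.sub_one_pos
  have hp'0 : 0 < p' := hpp.symm.pos
  -- Truncations in height and in space have finite norm and increase to `G`.
  let u : ℕ → E → ℝ≥0∞ := fun N => (spanningSets μ N).indicator fun x => min (G x) N
  have hum : ∀ N, Measurable (u N) := fun N =>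
    (hG.min measurable_const).indicator (measurableSet_spanningSets μ N)
  have hmono : Monotone u := by
    intro N M hNM x
    refine Set.indicator_le_indicator_of_subset (monotone_spanningSets μ hNM) (fun _ => zero_le) x
      |>.trans ?_
    refine Set.indicator_le_indicator ?_
    gcongr
  have hle : ∀ N x, u N x ≤ G x := fun N x =>
    (Set.indicator_le_self _ _ x).trans (min_le_left _ _)
  have hsup : ∀ x, G x ≤ ⨆ N, u N x := by
    intro x
    obtain ⟨N₀, hN₀⟩ := Set.mem_iUnion.1 ((iUnion_spanningSets μ).symm ▸ Set.mem_univ x)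
    have hlim : Tendsto (fun N : ℕ => min (G x) (N : ℝ≥0∞)) atTop (𝓝 (min (G x) ∞)) :=
      tendsto_const_nhds.min ENNReal.tendsto_nat_nhds_top
    rw [min_eq_left le_top] at hlim
    refine le_of_tendsto hlim (eventually_atTop.2 ⟨N₀, fun N hN => ?_⟩)
    refine le_iSup_of_le N ?_
    simp only [u]
    rw [Set.indicator_of_mem (monotone_spanningSets μ hN hN₀)]
  have hfin : ∀ N, ∫⁻ x, u N x ^ p ∂μ ≠ ∞ := by
    intro N
    refine ne_top_of_le_ne_top (b := (N : ℝ≥0∞) ^ p * μ (spanningSets μ N)) ?_ ?_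
    · exact ENNReal.mul_ne_top (by simp [hp0.le]) (measure_spanningSets_lt_top μ N).ne
    · rw [← setLIntegral_const, ← lintegral_indicator (measurableSet_spanningSets μ N)]
      refine lintegral_mono fun x => ?_
      by_cases hx : x ∈ spanningSets μ N
      · simp only [u, Set.indicator_of_mem hx]
        gcongr
        exact min_le_right _ _
      · simp [u, Set.indicator_of_notMem hx, hp0]
  have hbound : ∀ N, ∫⁻ x, u N x ^ p ∂μ ≤ Z ^ p := by
    intro N
    have h1 := H (fun x => u N x ^ (p - 1)) ((hum N).pow_const _)
    have h2 : ∀ x, (u N x ^ (p - 1)) ^ p' = u N x ^ p := fun x => by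
      rw [← ENNReal.rpow_mul, hpp.sub_one_mul_conj]
    simp_rw [h2] at h1
    have h3 : ∫⁻ x, u N x ^ p ∂μ ≤ ∫⁻ x, G x * u N x ^ (p - 1) ∂μ := by
      refine lintegral_mono fun x => ?_
      calc u N x ^ p = u N x ^ (1 + (p - 1)) := by ring_nf
        _ = u N x * u N x ^ (p - 1) := by
          rw [ENNReal.rpow_add_of_nonneg _ _ zero_le_one hp1.le, ENNReal.rpow_one]
        _ ≤ _ := by gcongr; exact hle N x
    set Y := ∫⁻ x, u N x ^ p ∂μ
    rcases eq_or_ne Y 0 with hY | hY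
    · simp [hY]
    have h4 : Y ≤ Z * Y ^ (1 / p') := h3.trans h1
    have h5 : Y = Y ^ (1 / p) * Y ^ (1 / p') := by
      rw [← ENNReal.rpow_add _ _ hY (hfin N), one_div, one_div, hpp.inv_add_inv_eq_one,
        ENNReal.rpow_one]
    have h6 : Y ^ (1 / p) ≤ Z := by
      have hne0 : Y ^ (1 / p') ≠ 0 := by simp [hY, hp'0.le]
      have hnet : Y ^ (1 / p') ≠ ∞ := ENNReal.rpow_ne_top_of_nonneg (by positivity) (hfin N)
      refine (ENNReal.mul_le_mul_iff_left hne0 hnet).1 ?_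
      rwa [← h5]
    calc Y = (Y ^ (1 / p)) ^ p := by
            rw [← ENNReal.rpow_mul, one_div_mul_cancel hp0.ne', ENNReal.rpow_one]
      _ ≤ Z ^ p := by gcongr
  calc ∫⁻ x, G x ^ p ∂μ ≤ ∫⁻ x, ⨆ N, u N x ^ p ∂μ := by
        refine lintegral_mono fun x => ?_
        calc G x ^ p ≤ (⨆ N, u N x) ^ p := by gcongr; exact hsup x
          _ = ⨆ N, u N x ^ p := by
            exact (ENNReal.orderIsoRpow p hp0).map_iSup fun N => u N x
    _ = ⨆ N, ∫⁻ x, u N x ^ p ∂μ := by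
        refine lintegral_iSup (fun N => (hum N).pow_const _) fun N M hNM x => ?_
        exact ENNReal.rpow_le_rpow (hmono hNM x) hp0.le
    _ ≤ Z ^ p := iSup_le hbound

/-! ### The dyadic maximal theorem -/

/-- The weak type `(1, 1)` bound, with constant one since the maximal cubes are disjoint. -/
theorem mul_measure_lt_gridAvg_le (a : Rn n) {h : ℝ} (hh : 0 < h) (K : ℤ) (f : Rn n → ℝ≥0∞)
    (t : ℝ≥0∞) : t * volume {x | ∃ k ≤ K, t < gridAvg a h k f x} ≤ ∫⁻ x, f x := by
  have h1 := measure_le_of_maximal_gridCubes a h K (Q := fun k x => t < gridAvg a h k f x)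
    (fun k x y hy hx => by rwa [gridAvg_congr le_rfl f hy]) (t • volume) (volume.withDensity f)
    (fun k _ x hx _ => by
      rw [withDensity_apply _ (measurableSet_gridCube a h k x), setLIntegral_gridCube a hh,
        Measure.smul_apply, smul_eq_mul, mul_comm]
      gcongr)
  rw [Measure.smul_apply, smul_eq_mul] at h1
  refine h1.trans ((measure_mono (Set.subset_univ _)).trans_eq ?_)
  rw [withDensity_apply _ MeasurableSet.univ, setLIntegral_univ]

theorem lt_gridMax_iff (a : Rn n) (h : ℝ) (K : ℤ) (f : Rn n → ℝ≥0∞) (t : ℝ≥0∞) (x : Rn n) :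
    t < gridMax a h K f x ↔ ∃ k ≤ K, t < gridAvg a h k f x := by
  simp only [gridMax, lt_iSup_iff, exists_prop]

/-- The form of the weak type bound that interpolates with the trivial `L^∞` bound. -/
theorem mul_measure_lt_gridMax_le (a : Rn n) {h : ℝ} (hh : 0 < h) (K : ℤ) {f : Rn n → ℝ≥0∞}
    (hf : Measurable f) (t : ℝ≥0∞) :
    t * volume {x | t < gridMax a h K f x} ≤ 2 * ∫⁻ x in {x | t < 2 * f x}, f x := by
  have hS : MeasurableSet {x | t < 2 * f x} := measurableSet_lt measurable_const (hf.const_mul _)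
  -- Where `2 * f ≤ t`, the function contributes at most `t / 2` to any average.
  have hpt : ∀ y, f y ≤ {x | t < 2 * f x}.indicator f y + t / 2 := by
    intro y
    by_cases hy : t < 2 * f y
    · rw [Set.indicator_of_mem (by exact hy)]
      exact le_self_add
    · rw [Set.indicator_of_notMem (by exact hy), zero_add,
        ENNReal.le_div_iff_mul_le (by simp) (by simp), mul_comm]
      exact not_lt.1 hy
  have hsub : {x | t < gridMax a h K f x} ⊆
      {x | ∃ k ≤ K, t / 2 < gridAvg a h k ({x | t < 2 * f x}.indicator f) x} := by
    intro x hx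
    obtain ⟨k, hk, hx⟩ := (lt_gridMax_iff a h K f t x).1 hx
    refine ⟨k, hk, ?_⟩
    have h1 : gridAvg a h k f x ≤ gridAvg a h k ({x | t < 2 * f x}.indicator f) x + t / 2 := by
      unfold gridAvg
      rw [ENNReal.div_le_iff (volume_gridCube_ne_zero a hh k x) (volume_gridCube_ne_top a hh k x),
        add_mul, ENNReal.div_mul_cancel (volume_gridCube_ne_zero a hh k x)
          (volume_gridCube_ne_top a hh k x), ← setLIntegral_const, ← lintegral_add_right _
          measurable_const]
      exact lintegral_mono hpt
    by_contra hc
    have h2 := hx.trans_le (h1.trans (add_le_add_left (not_lt.1 hc) _))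
    rw [ENNReal.add_halves] at h2
    exact lt_irrefl _ h2
  have h3 := mul_measure_lt_gridAvg_le a hh K ({x | t < 2 * f x}.indicator f) (t / 2)
  rw [lintegral_indicator hS] at h3
  calc t * volume {x | t < gridMax a h K f x}
      = 2 * (t / 2 * volume {x | t < gridMax a h K f x}) := by
        rw [← mul_assoc, ENNReal.mul_div_cancel (by simp) (by simp)]
    _ ≤ _ := by
        gcongr
        exact le_trans (by gcongr) h3

/-- The dyadic maximal operator is bounded on `L^s` for `1 < s`, uniformly in the grid. -/
theorem exists_lintegral_gridMax_rpow_le {s : ℝ} (hs : 1 < s) :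
    ∃ C : ℝ≥0∞, C ≠ ∞ ∧ ∀ (a : Rn n) (h : ℝ) (_ : 0 < h) (K : ℤ) (f : Rn n → ℝ≥0∞),
      Measurable f → ∫⁻ x, gridMax a h K f x ^ s ≤ C * ∫⁻ x, f x ^ s := by
  have hs1 : 0 < s - 1 := by linarith
  have hs1' : ENNReal.ofReal (s - 1) ≠ 0 := by simpa using hs
  refine ⟨ENNReal.ofReal s * (2 * ((ENNReal.ofReal (s - 1))⁻¹ * 2 ^ (s - 1))), ?_, ?_⟩
  · refine ENNReal.mul_ne_top ENNReal.ofReal_ne_top (ENNReal.mul_ne_top (by simp)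
      (ENNReal.mul_ne_top (ENNReal.inv_ne_top.2 hs1') ?_))
    exact ENNReal.rpow_ne_top_of_nonneg hs1.le (by simp)
  intro a h hh K f hf
  have h1 := lintegral_mul_rpow_eq_lintegral_layers (μ := volume) (s := s) (by linarith)
    (measurable_const (a := (1 : ℝ≥0∞))) (measurable_gridMax a h K f)
  have h2 := lintegral_mul_rpow_eq_lintegral_layers (μ := volume) hs1 hf (hf.const_mul 2)
  simp only [one_mul, setLIntegral_one] at h1
  have h3 : ∫⁻ t in Set.Ioi (0 : ℝ), ENNReal.ofReal t ^ (s - 1) *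
        volume {x | ENNReal.ofReal t < gridMax a h K f x} ≤
      2 * ∫⁻ t in Set.Ioi (0 : ℝ), ENNReal.ofReal t ^ (s - 1 - 1) *
        ∫⁻ x in {x | ENNReal.ofReal t < 2 * f x}, f x := by
    rw [← lintegral_const_mul' _ _ (by simp)]
    refine setLIntegral_mono' measurableSet_Ioi fun t ht => ?_
    have ht0 : ENNReal.ofReal t ≠ 0 := by simpa using ht
    calc ENNReal.ofReal t ^ (s - 1) * volume {x | ENNReal.ofReal t < gridMax a h K f x}
        = ENNReal.ofReal t ^ (s - 1 - 1) *
            (ENNReal.ofReal t * volume {x | ENNReal.ofReal t < gridMax a h K f x}) := by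
          rw [← mul_assoc]
          congr 1
          have := ENNReal.rpow_add (s - 1 - 1) 1 ht0 ENNReal.ofReal_ne_top
          rwa [ENNReal.rpow_one, sub_add_cancel] at this
      _ ≤ ENNReal.ofReal t ^ (s - 1 - 1) *
            (2 * ∫⁻ x in {x | ENNReal.ofReal t < 2 * f x}, f x) := by
          exact mul_le_mul' le_rfl (mul_measure_lt_gridMax_le a hh K hf _)
      _ = _ := by ring
  have h4 : ∫⁻ x, f x * (2 * f x) ^ (s - 1) = 2 ^ (s - 1) * ∫⁻ x, f x ^ s := by
    rw [← lintegral_const_mul' _ _ (ENNReal.rpow_ne_top_of_nonneg hs1.le (by simp))]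
    refine lintegral_congr fun x => ?_
    rw [ENNReal.mul_rpow_of_nonneg _ _ hs1.le, mul_left_comm]
    congr 1
    nth_rewrite 1 [← ENNReal.rpow_one (f x)]
    rw [← ENNReal.rpow_add_of_nonneg _ _ zero_le_one hs1.le]
    ring_nf
  rw [h1]
  calc _ ≤ ENNReal.ofReal s * (2 * ∫⁻ t in Set.Ioi (0 : ℝ), ENNReal.ofReal t ^ (s - 1 - 1) *
        ∫⁻ x in {x | ENNReal.ofReal t < 2 * f x}, f x) := by gcongr
    _ = ENNReal.ofReal s * (2 * ((ENNReal.ofReal (s - 1))⁻¹ *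
          ∫⁻ x, f x * (2 * f x) ^ (s - 1))) := by
        rw [h2, ← mul_assoc (ENNReal.ofReal (s - 1))⁻¹,
          ENNReal.inv_mul_cancel hs1' ENNReal.ofReal_ne_top, one_mul]
    _ = _ := by rw [h4]; ring

/-! ### The dyadic trace inequality -/

/-- Hölder's inequality with exponents `σ` and `r * p` on one cube, which is where the power bump of
the weight is spent. -/
theorem setLIntegral_mul_rpow_le (a : Rn n) {h : ℝ} (hh : 0 < h) (k : ℤ) (x : Rn n) {p r σ : ℝ}
    (hσ : (r * p).HolderConjugate σ) (hp : 0 < p) {u w : Rn n → ℝ≥0∞}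
    (hu : Measurable u) (hw : Measurable w) :
    ∫⁻ y in gridCube a h k x, u y * w y ^ (1 / p) ≤ volume (gridCube a h k x) *
      (gridAvg a h k (fun y => u y ^ σ) x ^ (1 / σ) *
        gridAvg a h k (fun y => w y ^ r) x ^ (1 / (r * p))) := by
  have hrp : 0 < r * p := hσ.pos
  have hσ0 : 0 < σ := hσ.symm.pos
  have hr : 0 < r := pos_of_mul_pos_left hrp hp.le
  have hsum : 1 / σ + 1 / (r * p) = 1 := by
    rw [one_div, one_div]; exact hσ.symm.inv_add_inv_eq_one
  have h1 : ∀ y, u y * w y ^ (1 / p) = (u y ^ σ) ^ (1 / σ) * (w y ^ r) ^ (1 / (r * p)) := by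
    intro y
    rw [← ENNReal.rpow_mul, ← ENNReal.rpow_mul, mul_one_div_cancel hσ0.ne', ENNReal.rpow_one]
    congr 2
    field_simp
  rw [lintegral_congr h1]
  refine (ENNReal.lintegral_mul_norm_pow_le (hu.pow_const _).aemeasurable
    (hw.pow_const _).aemeasurable (by positivity) (by positivity) hsum).trans_eq ?_
  rw [setLIntegral_gridCube a hh, setLIntegral_gridCube a hh,
    ENNReal.mul_rpow_of_nonneg _ _ (by positivity), ENNReal.mul_rpow_of_nonneg _ _ (by positivity)]
  calc _ = volume (gridCube a h k x) ^ (1 / σ) * volume (gridCube a h k x) ^ (1 / (r * p)) *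
        (gridAvg a h k (fun y => u y ^ σ) x ^ (1 / σ) *
        gridAvg a h k (fun y => w y ^ r) x ^ (1 / (r * p))) := by ring
    _ = _ := by
      rw [← ENNReal.rpow_add_of_nonneg _ _ (by positivity) (by positivity), hsum, ENNReal.rpow_one]

/-- Bound on one level set: on a maximal cube where `F k` exceeds `t` the sum over smaller scales
is geometric, and Hölder's inequality absorbs the weight. -/
theorem tsum_setLIntegral_level_le (a : Rn n) {h : ℝ} (hh : 0 < h) (K : ℤ) {p r σ β : ℝ}
    (hσ : (r * p).HolderConjugate σ) (hp : 0 < p) (hβ : 0 < β) {u w : Rn n → ℝ≥0∞}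
    (hu : Measurable u) (hw : Measurable w) (A : ℝ≥0∞)
    (hA : ∀ k ≤ K, ∀ x, ENNReal.ofReal (h * 2 ^ k) ^ β *
      gridAvg a h k (fun y => w y ^ r) x ^ (1 / (r * p)) ≤ A)
    (F : ℤ → Rn n → ℝ≥0∞) (hF : ∀ k x y, y ∈ gridCube a h k x → F k y = F k x) (t : ℝ≥0∞) :
    ∑' k : ℤ, (if k ≤ K then ENNReal.ofReal (h * 2 ^ k) ^ β else 0) *
        ∫⁻ x in {x | t < F k x}, u x * w x ^ (1 / p) ≤
      (1 - (2 : ℝ≥0∞) ^ (-β))⁻¹ * A * ∫⁻ x in {x | t < ⨆ (k : ℤ) (_ : k ≤ K), F k x},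
        gridMax a h K (fun y => u y ^ σ) x ^ (1 / σ) := by
  have hσ0 : 0 < σ := hσ.symm.pos
  have hC : (1 - (2 : ℝ≥0∞) ^ (-β))⁻¹ ≠ ∞ := one_sub_two_rpow_neg_inv_ne_top hβ
  set C : ℝ≥0∞ := (1 - (2 : ℝ≥0∞) ^ (-β))⁻¹
  set c : ℤ → ℝ≥0∞ := fun k => if k ≤ K then ENNReal.ofReal (h * 2 ^ k) ^ β else 0
  have hQ : ∀ k x y, y ∈ gridCube a h k x → t < F k x → t < F k y := fun k x y hy hx => by
    rwa [hF k x y hy]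
  have hFm : ∀ k, MeasurableSet {x | t < F k x} := fun k =>
    measurableSet_of_gridCube_invariant a h k (hQ k)
  have hg : Measurable fun x => u x * w x ^ (1 / p) := hu.mul (hw.pow_const _)
  let Φ : Rn n → ℝ≥0∞ := fun x => ∑' k : ℤ, c k * {x | t < F k x}.indicator 1 x
  have hΦm : Measurable Φ := by
    refine Measurable.tsum fun k => ?_
    exact (measurable_one.indicator (hFm k)).const_mul _
  have hΩ : {x | t < ⨆ (k : ℤ) (_ : k ≤ K), F k x} = {x | ∃ k ≤ K, t < F k x} := by
    ext x; simp only [lt_iSup_iff, exists_prop, Set.mem_ofPred_eq]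
  have hΩm : MeasurableSet {x | ∃ k ≤ K, t < F k x} := by
    have : {x | ∃ k ≤ K, t < F k x} = ⋃ k, ⋃ (_ : k ≤ K), {x | t < F k x} := by ext x; simp
    rw [this]
    exact MeasurableSet.iUnion fun k => MeasurableSet.iUnion fun _ => hFm k
  have hsumle : ∀ k ≤ K, ∀ x, t < F k x → (∀ j, k < j → j ≤ K → ¬ t < F j x) →
      ∀ y ∈ gridCube a h k x, Φ y ≤ C * ENNReal.ofReal (h * 2 ^ k) ^ β := by
    intro k _ x _ hmax y hy
    refine le_trans (ENNReal.tsum_le_tsum fun j => ?_)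
      (tsum_side_rpow_le hβ hh (side_pos hh k))
    by_cases hj : j ≤ K ∧ t < F j y
    · have hjk : j ≤ k := by
        by_contra hc
        refine hmax j (not_le.1 hc) hj.1 ?_
        rw [← hF j x y (gridIndex_eq_of_le a h (not_le.1 hc).le hy)]
        exact hj.2
      have h2 : h * (2 : ℝ) ^ j ≤ h * 2 ^ k := by
        gcongr
        exact one_le_two
      rw [if_pos h2, Set.indicator_of_mem (by exact hj.2)]
      simp [c, hj.1]
    · rcases not_and_or.1 hj with hj | hj
      · simp [c, hj]
      · rw [Set.indicator_of_notMem (by exact hj)]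
        simp
  have key := measure_le_of_maximal_gridCubes a h K hQ
    (volume.withDensity fun x => Φ x * (u x * w x ^ (1 / p)))
    (volume.withDensity fun x => C * A * gridMax a h K (fun y => u y ^ σ) x ^ (1 / σ)) ?_
  · rw [withDensity_apply _ hΩm, withDensity_apply _ hΩm, lintegral_const_mul _
      ((measurable_gridMax _ _ _ _).pow_const _)] at key
    rw [hΩ]
    refine le_trans (le_of_eq ?_) key
    have h1 : ∀ k, c k * ∫⁻ x in {x | t < F k x}, u x * w x ^ (1 / p) =
        ∫⁻ x in {x | ∃ k ≤ K, t < F k x},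
          c k * {x | t < F k x}.indicator 1 x * (u x * w x ^ (1 / p)) := by
      intro k
      by_cases hk : k ≤ K
      · rw [← lintegral_const_mul _ hg, ← lintegral_indicator (hFm k), ← lintegral_indicator hΩm]
        refine lintegral_congr fun x => ?_
        by_cases hx : t < F k x
        · rw [Set.indicator_of_mem (by exact hx), Set.indicator_of_mem (by exact ⟨k, hk, hx⟩),
            Set.indicator_of_mem (by exact hx)]
          simp
        · rw [Set.indicator_of_notMem (by exact hx)]
          simp only [Set.indicator]
          simp [hx]
      · simp [c, hk]
    rw [tsum_congr h1, ← lintegral_tsum]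
    · refine lintegral_congr fun x => ?_
      rw [ENNReal.tsum_mul_right]
    · intro k
      exact (((measurable_one.indicator (hFm k)).const_mul _).mul hg).aemeasurable
  · intro k hk x hx hmax
    have hD := measurableSet_gridCube a h k x
    rw [withDensity_apply _ hD, withDensity_apply _ hD]
    calc ∫⁻ y in gridCube a h k x, Φ y * (u y * w y ^ (1 / p))
        ≤ ∫⁻ y in gridCube a h k x, C * ENNReal.ofReal (h * 2 ^ k) ^ β *
            (u y * w y ^ (1 / p)) := by
          refine setLIntegral_mono' hD fun y hy => ?_
          gcongr
          exact hsumle k hk x hx hmax y hy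
      _ = C * ENNReal.ofReal (h * 2 ^ k) ^ β * ∫⁻ y in gridCube a h k x, u y * w y ^ (1 / p) :=
          lintegral_const_mul _ hg
      _ ≤ C * ENNReal.ofReal (h * 2 ^ k) ^ β * (volume (gridCube a h k x) *
            (gridAvg a h k (fun y => u y ^ σ) x ^ (1 / σ) *
              gridAvg a h k (fun y => w y ^ r) x ^ (1 / (r * p)))) := by
          gcongr
          exact setLIntegral_mul_rpow_le a hh k x hσ hp hu hw
      _ = C * (ENNReal.ofReal (h * 2 ^ k) ^ β *
              gridAvg a h k (fun y => w y ^ r) x ^ (1 / (r * p))) *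
            gridAvg a h k (fun y => u y ^ σ) x ^ (1 / σ) * volume (gridCube a h k x) := by ring
      _ ≤ C * A * gridAvg a h k (fun y => u y ^ σ) x ^ (1 / σ) * volume (gridCube a h k x) := by
          gcongr
          exact hA k hk x
      _ ≤ ∫⁻ y in gridCube a h k x, C * A * gridMax a h K (fun y => u y ^ σ) y ^ (1 / σ) := by
          rw [← setLIntegral_const]
          refine setLIntegral_mono' hD fun y hy => ?_
          rw [← gridAvg_congr le_rfl _ hy]
          gcongr
          exact gridAvg_le_gridMax a h hk _ y

/-- The dual form of the trace inequality, before the maximal theorem is applied: the estimate on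
level sets is integrated over all heights. The sum over scales becomes a supremum. -/
theorem lintegral_tsum_mul_le (a : Rn n) {h : ℝ} (hh : 0 < h) (K : ℤ) {p r σ β : ℝ}
    (hσ : (r * p).HolderConjugate σ) (hp : 0 < p) (hβ : 0 < β) {u w : Rn n → ℝ≥0∞}
    (hu : Measurable u) (hw : Measurable w) (A : ℝ≥0∞)
    (hA : ∀ k ≤ K, ∀ x, ENNReal.ofReal (h * 2 ^ k) ^ β *
      gridAvg a h k (fun y => w y ^ r) x ^ (1 / (r * p)) ≤ A)
    (F : ℤ → Rn n → ℝ≥0∞) (hF : ∀ k x y, y ∈ gridCube a h k x → F k y = F k x)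
    (hFm : ∀ k, Measurable (F k)) :
    ∫⁻ x, (∑' k : ℤ, (if k ≤ K then ENNReal.ofReal (h * 2 ^ k) ^ β else 0) * F k x) *
        (u x * w x ^ (1 / p)) ≤
      (1 - (2 : ℝ≥0∞) ^ (-β))⁻¹ * A * ∫⁻ x, (⨆ (k : ℤ) (_ : k ≤ K), F k x) *
        gridMax a h K (fun y => u y ^ σ) x ^ (1 / σ) := by
  have hg : Measurable fun x => u x * w x ^ (1 / p) := hu.mul (hw.pow_const _)
  have hFs : Measurable fun x => ⨆ (k : ℤ) (_ : k ≤ K), F k x :=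
    Measurable.iSup fun k => Measurable.iSup fun _ => hFm k
  have hN : Measurable fun x => gridMax a h K (fun y => u y ^ σ) x ^ (1 / σ) :=
    (measurable_gridMax _ _ _ _).pow_const _
  have layer : ∀ {g X : Rn n → ℝ≥0∞}, Measurable g → Measurable X → ∫⁻ x, X x * g x =
      ∫⁻ t in Set.Ioi (0 : ℝ), ∫⁻ x in {x | ENNReal.ofReal t < X x}, g x := by
    intro g X hg hX
    have := lintegral_mul_rpow_eq_lintegral_layers (μ := volume) one_pos hg hX
    simpa [mul_comm] using this
  have hmeas : ∀ {g X : Rn n → ℝ≥0∞}, Measurable fun t : ℝ =>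
      ∫⁻ x in {x | ENNReal.ofReal t < X x}, g x := by
    intro g X
    refine Antitone.measurable fun t t' htt => ?_
    refine lintegral_mono_set fun x hx => ?_
    have hx' : ENNReal.ofReal t' < X x := hx
    exact (ENNReal.ofReal_le_ofReal htt).trans_lt hx'
  calc _ = ∑' k : ℤ, (if k ≤ K then ENNReal.ofReal (h * 2 ^ k) ^ β else 0) *
        ∫⁻ x, F k x * (u x * w x ^ (1 / p)) := by
        simp_rw [← ENNReal.tsum_mul_right]
        rw [lintegral_tsum]
        · refine tsum_congr fun k => ?_
          simp_rw [mul_assoc]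
          exact lintegral_const_mul _ ((hFm k).mul hg)
        · exact fun k => (((hFm k).const_mul _).mul hg).aemeasurable
    _ = ∫⁻ t in Set.Ioi (0 : ℝ), ∑' k : ℤ,
          (if k ≤ K then ENNReal.ofReal (h * 2 ^ k) ^ β else 0) *
            ∫⁻ x in {x | ENNReal.ofReal t < F k x}, u x * w x ^ (1 / p) := by
        rw [lintegral_tsum]
        · refine tsum_congr fun k => ?_
          rw [layer hg (hFm k), lintegral_const_mul _ hmeas]
        · exact fun k => (hmeas.const_mul _).aemeasurable
    _ ≤ ∫⁻ t in Set.Ioi (0 : ℝ), (1 - (2 : ℝ≥0∞) ^ (-β))⁻¹ * A *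
          ∫⁻ x in {x | ENNReal.ofReal t < ⨆ (k : ℤ) (_ : k ≤ K), F k x},
            gridMax a h K (fun y => u y ^ σ) x ^ (1 / σ) :=
        lintegral_mono fun t =>
          tsum_setLIntegral_level_le a hh K hσ hp hβ hu hw A hA F hF (ENNReal.ofReal t)
    _ = _ := by rw [lintegral_const_mul _ hmeas, layer hN hFs]

theorem iSup_prod_gridAvg_le {m : ℕ} (a : Rn n) (h : ℝ) (K : ℤ) (f : Fin m → Rn n → ℝ≥0∞)
    (x : Rn n) : ⨆ (k : ℤ) (_ : k ≤ K), ∏ i, gridAvg a h k (f i) x ≤ ∏ i, gridMax a h K (f i) x :=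
  iSup₂_le fun _ hk => Finset.prod_le_prod' fun i _ => gridAvg_le_gridMax a h hk (f i) x

/-- The multilinear maximal theorem, by Hölder's inequality from the linear one. -/
theorem exists_lintegral_prod_gridMax_rpow_le {m : ℕ} {P : Fin m → ℝ} (hP : ∀ i, 1 < P i) {p : ℝ}
    (hp0 : 0 < p) (hp : 1 / p = ∑ i, 1 / P i) :
    ∃ C : ℝ≥0∞, C ≠ ∞ ∧ ∀ (a : Rn n) (h : ℝ) (_ : 0 < h) (K : ℤ) (f : Fin m → Rn n → ℝ≥0∞),
      (∀ i, Measurable (f i)) → ∫⁻ x, (∏ i, gridMax a h K (f i) x) ^ p ≤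
        C * ∏ i, (∫⁻ x, f i x ^ P i) ^ (p / P i) := by
  have hP0 : ∀ i, 0 < P i := fun i => one_pos.trans (hP i)
  choose C hCtop hC using fun i => exists_lintegral_gridMax_rpow_le (n := n) (hP i)
  refine ⟨∏ i, C i ^ (p / P i), ENNReal.prod_ne_top fun i _ =>
    ENNReal.rpow_ne_top_of_nonneg (div_nonneg hp0.le (hP0 i).le) (hCtop i), ?_⟩
  intro a h hh K f hf
  have hsum : ∑ i, p / P i = 1 := by
    have : ∑ i, p / P i = p * ∑ i, 1 / P i := by
      rw [Finset.mul_sum]; exact Finset.sum_congr rfl fun i _ => by ring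
    rw [this, ← hp, mul_one_div_cancel hp0.ne']
  calc ∫⁻ x, (∏ i, gridMax a h K (f i) x) ^ p
      = ∫⁻ x, ∏ i, (gridMax a h K (f i) x ^ P i) ^ (p / P i) := by
        refine lintegral_congr fun x => ?_
        rw [← ENNReal.prod_rpow_of_nonneg hp0.le]
        refine Finset.prod_congr rfl fun i _ => ?_
        rw [← ENNReal.rpow_mul, mul_div_cancel₀ _ (hP0 i).ne']
    _ ≤ ∏ i, (∫⁻ x, gridMax a h K (f i) x ^ P i) ^ (p / P i) :=
        ENNReal.lintegral_prod_norm_pow_le _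
          (fun i _ => ((measurable_gridMax _ _ _ _).pow_const _).aemeasurable) hsum
          fun i _ => div_nonneg hp0.le (hP0 i).le
    _ ≤ ∏ i, (C i * ∫⁻ x, f i x ^ P i) ^ (p / P i) := by
        refine Finset.prod_le_prod' fun i _ => ?_
        exact ENNReal.rpow_le_rpow (hC i a h hh K (f i) (hf i)) (div_nonneg hp0.le (hP0 i).le)
    _ = _ := by
        rw [← Finset.prod_mul_distrib]
        refine Finset.prod_congr rfl fun i _ => ?_
        rw [ENNReal.mul_rpow_of_nonneg _ _ (div_nonneg hp0.le (hP0 i).le)]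

/-- The trace inequality for the dyadic multilinear fractional integral, under a power-bumped
Olsen condition on the weight. -/
theorem exists_lintegral_dyadic_rpow_le {m : ℕ} {P : Fin m → ℝ} (hP : ∀ i, 1 < P i) {p r β : ℝ}
    (hp1 : 1 < p) (hp : 1 / p = ∑ i, 1 / P i) (hr : 1 < r) (hβ : 0 < β) :
    ∃ C : ℝ≥0∞, C ≠ ∞ ∧ ∀ (a : Rn n) (h : ℝ) (_ : 0 < h) (K : ℤ) (w : Rn n → ℝ≥0∞)
      (_ : Measurable w) (A : ℝ≥0∞)
      (_ : ∀ k ≤ K, ∀ x, ENNReal.ofReal (h * 2 ^ k) ^ β *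
        gridAvg a h k (fun y => w y ^ r) x ^ (1 / (r * p)) ≤ A)
      (f : Fin m → Rn n → ℝ≥0∞), (∀ i, Measurable (f i)) →
      ∫⁻ x, (∑' k : ℤ, (if k ≤ K then ENNReal.ofReal (h * 2 ^ k) ^ β else 0) *
          ∏ i, gridAvg a h k (f i) x) ^ p * w x ≤
        C * A ^ p * ∏ i, (∫⁻ x, f i x ^ P i) ^ (p / P i) := by
  have hp0 : 0 < p := by linarith
  have hrp : p < r * p := by nlinarith
  set p' := Real.conjExponent p
  set σ := Real.conjExponent (r * p)
  have hpp : p.HolderConjugate p' := Real.HolderConjugate.conjExponent hp1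
  have hσ : (r * p).HolderConjugate σ := Real.HolderConjugate.conjExponent (hp1.trans hrp)
  have hp'0 : 0 < p' := hpp.symm.pos
  have hσ0 : 0 < σ := hσ.symm.pos
  -- The bump makes `σ` smaller than `p'`, so the maximal theorem applies with exponent `p' / σ`.
  have hσp' : 1 < p' / σ := by
    rw [one_lt_div hσ0]
    have h1 := hpp.inv_add_inv_eq_one
    have h2 := hσ.inv_add_inv_eq_one
    have h3 : (r * p)⁻¹ < p⁻¹ := inv_strictAnti₀ hp0 hrp
    exact (inv_lt_inv₀ hp'0 hσ0).1 (by linarith)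
  obtain ⟨C₁, hC₁, H₁⟩ := exists_lintegral_prod_gridMax_rpow_le (n := n) hP hp0 hp
  obtain ⟨C₂, hC₂, H₂⟩ := exists_lintegral_gridMax_rpow_le (n := n) hσp'
  set C₀ : ℝ≥0∞ := (1 - (2 : ℝ≥0∞) ^ (-β))⁻¹
  have hC₀ : C₀ ≠ ∞ := one_sub_two_rpow_neg_inv_ne_top hβ
  refine ⟨C₀ ^ p * C₁ * (C₂ ^ (1 / p')) ^ p, ?_, ?_⟩
  · refine ENNReal.mul_ne_top (ENNReal.mul_ne_top ?_ hC₁) ?_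
    · exact ENNReal.rpow_ne_top_of_nonneg hp0.le hC₀
    · exact ENNReal.rpow_ne_top_of_nonneg hp0.le
        (ENNReal.rpow_ne_top_of_nonneg (by positivity) hC₂)
  intro a h hh K w hw A hA f hf
  set F : ℤ → Rn n → ℝ≥0∞ := fun k x => ∏ i, gridAvg a h k (f i) x
  have hFm : ∀ k, Measurable (F k) := fun k =>
    Finset.measurable_fun_prod _ fun i _ => measurable_gridAvg a h k (f i)
  set T : Rn n → ℝ≥0∞ := fun x =>
    ∑' k : ℤ, (if k ≤ K then ENNReal.ofReal (h * 2 ^ k) ^ β else 0) * F k x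
  have hTm : Measurable T := Measurable.tsum fun k => (hFm k).const_mul _
  set I : ℝ≥0∞ := ∏ i, (∫⁻ x, f i x ^ P i) ^ (p / P i)
  have hpair := lintegral_rpow_le_of_forall_pairing (μ := volume) hpp
    (G := fun x => T x * w x ^ (1 / p)) (hTm.mul (hw.pow_const _))
    (C₀ * A * (C₁ * I) ^ (1 / p) * C₂ ^ (1 / p')) ?_
  · calc ∫⁻ x, T x ^ p * w x = ∫⁻ x, (T x * w x ^ (1 / p)) ^ p := by
          refine lintegral_congr fun x => ?_
          rw [ENNReal.mul_rpow_of_nonneg _ _ hp0.le, ← ENNReal.rpow_mul,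
            one_div_mul_cancel hp0.ne', ENNReal.rpow_one]
      _ ≤ _ := hpair
      _ = _ := by
          rw [ENNReal.mul_rpow_of_nonneg _ _ hp0.le, ENNReal.mul_rpow_of_nonneg _ _ hp0.le,
            ENNReal.mul_rpow_of_nonneg _ _ hp0.le, ← ENNReal.rpow_mul (C₁ * I),
            one_div_mul_cancel hp0.ne', ENNReal.rpow_one]
          ring
  · intro g hg
    have hgσ : Measurable fun y => g y ^ σ := hg.pow_const _
    calc ∫⁻ x, T x * w x ^ (1 / p) * g x = ∫⁻ x, T x * (g x * w x ^ (1 / p)) := by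
          refine lintegral_congr fun x => by ring
      _ ≤ C₀ * A * ∫⁻ x, (⨆ (k : ℤ) (_ : k ≤ K), F k x) *
            gridMax a h K (fun y => g y ^ σ) x ^ (1 / σ) :=
          lintegral_tsum_mul_le a hh K hσ hp0 hβ hg hw A hA F
            (fun k x y hy => Finset.prod_congr rfl fun i _ => gridAvg_congr le_rfl _ hy) hFm
      _ ≤ C₀ * A * ∫⁻ x, (∏ i, gridMax a h K (f i) x) *
            gridMax a h K (fun y => g y ^ σ) x ^ (1 / σ) := by
          gcongr with x
          exact iSup_prod_gridAvg_le a h K f x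
      _ ≤ C₀ * A * ((∫⁻ x, (∏ i, gridMax a h K (f i) x) ^ p) ^ (1 / p) *
            (∫⁻ x, (gridMax a h K (fun y => g y ^ σ) x ^ (1 / σ)) ^ p') ^ (1 / p')) := by
          gcongr
          exact ENNReal.lintegral_mul_le_Lp_mul_Lq _ hpp
            (Finset.measurable_fun_prod _ fun i _ => measurable_gridMax _ _ _ _).aemeasurable
            ((measurable_gridMax _ _ _ _).pow_const _).aemeasurable
      _ ≤ C₀ * A * ((C₁ * I) ^ (1 / p) * (C₂ * ∫⁻ x, g x ^ p') ^ (1 / p')) := by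
          gcongr
          · exact H₁ a h hh K f hf
          · have h1 := H₂ a h hh K _ hgσ
            simp_rw [← ENNReal.rpow_mul] at h1 ⊢
            rw [mul_div_cancel₀ _ hσ0.ne'] at h1
            rwa [one_div_mul_eq_div]
      _ = _ := by
          rw [ENNReal.mul_rpow_of_nonneg _ _ (by positivity : 0 ≤ 1 / p')]
          ring

/-! ### Shifted grids -/

theorem exists_int_near_of_floor_ne {u v : ℝ} (h : |v - u| ≤ 1 / 8) (hne : ⌊v⌋ ≠ ⌊u⌋) :
    ∃ z : ℤ, |u - z| ≤ 1 / 8 := by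
  rw [abs_le] at h
  rcases lt_or_gt_of_ne hne with hlt | hlt
  · refine ⟨⌊u⌋, ?_⟩
    have := Int.floor_lt.1 hlt
    have := Int.floor_le u
    rw [abs_le]; constructor <;> linarith
  · refine ⟨⌊v⌋, ?_⟩
    have := Int.floor_lt.1 hlt
    have := Int.floor_le v
    rw [abs_le]; constructor <;> linarith

/-- Since `2 ^ N / 3` stays away from the integers, a short interval avoids the integer points or
their translates by `2 ^ N / 3`. -/
theorem floor_const_or_floor_sub_const (N : ℕ) (u : ℝ) :
    (∀ v, |v - u| ≤ 1 / 8 → ⌊v⌋ = ⌊u⌋) ∨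
      (∀ v, |v - u| ≤ 1 / 8 → ⌊v - 2 ^ N / 3⌋ = ⌊u - 2 ^ N / 3⌋) := by
  by_contra hc
  push Not at hc
  obtain ⟨⟨v, hv, hvu⟩, ⟨v', hv', hvu'⟩⟩ := hc
  obtain ⟨z, hz⟩ := exists_int_near_of_floor_ne hv hvu
  obtain ⟨z', hz'⟩ := exists_int_near_of_floor_ne (u := u - 2 ^ N / 3) (v := v' - 2 ^ N / 3)
    (by rwa [sub_sub_sub_cancel_right]) hvu'
  rw [abs_le] at hz hz'
  have h1 : ((2 ^ N - 3 * (z - z') : ℤ) : ℝ) < 1 := by push_cast; linarith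
  have h2 : (-1 : ℝ) < ((2 ^ N - 3 * (z - z') : ℤ) : ℝ) := by push_cast; linarith
  have h3 : (2 ^ N - 3 * (z - z') : ℤ) < 1 := by exact_mod_cast h1
  have h4 : (-1 : ℤ) < (2 ^ N - 3 * (z - z') : ℤ) := by exact_mod_cast h2
  have h5 : (3 : ℤ) ∣ 2 ^ N := ⟨z - z', by omega⟩
  have h6 : (3 : ℤ) ∣ 2 := Int.prime_three.dvd_of_dvd_pow h5
  omega

/-- The origin `a`, translated by `d` in the coordinates selected by `b`. -/
def shiftOrigin (a : Rn n) (d : ℝ) (b : Fin n → Bool) : Rn n :=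
  WithLp.toLp 2 fun i => a i + if b i then d else 0

theorem abs_coord_sub_le_of_mem_closedBall {x y : Rn n} {s : ℝ} (hy : y ∈ Metric.closedBall x s)
    (i : Fin n) : |y i - x i| ≤ s := by
  have h1 : ‖(y - x) i‖ ≤ ‖y - x‖ := PiLp.norm_apply_le _ i
  rw [Metric.mem_closedBall, dist_eq_norm] at hy
  simpa using h1.trans hy

/-- The one-third trick: every ball is contained in a comparable cube of one of `2 ^ n` grids. The
shift is a third of the largest mesh `h * 2 ^ K`, which serves all smaller scales at once. -/
theorem exists_closedBall_subset_gridCube (a : Rn n) {h : ℝ} (hh : 0 < h) {k K : ℤ}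
    (hk : k + 3 ≤ K) (x : Rn n) : ∃ b : Fin n → Bool, Metric.closedBall x (h * 2 ^ k) ⊆
      gridCube (shiftOrigin a (h * 2 ^ K / 3) b) h (k + 3) x := by
  obtain ⟨N, rfl⟩ := Int.le.dest hk
  have hs := side_pos hh k
  have hs3 := side_pos hh (k + 3)
  have e3 : h * (2 : ℝ) ^ (k + 3) = 8 * (h * 2 ^ k) := by
    rw [zpow_add₀ two_ne_zero]; norm_num; ring
  have hN : h * (2 : ℝ) ^ (k + 3 + (N : ℤ)) / 3 / (h * 2 ^ (k + 3)) = 2 ^ N / 3 := by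
    rw [zpow_add₀ two_ne_zero (k + 3), zpow_natCast]
    field_simp
  have key : ∀ i, ∃ c : Bool, ∀ y ∈ Metric.closedBall x (h * 2 ^ k),
      ⌊(y i - (a i + if c then h * 2 ^ (k + 3 + (N : ℤ)) / 3 else 0)) / (h * 2 ^ (k + 3))⌋ =
      ⌊(x i - (a i + if c then h * 2 ^ (k + 3 + (N : ℤ)) / 3 else 0)) / (h * 2 ^ (k + 3))⌋ := by
    intro i
    have hnear : ∀ y ∈ Metric.closedBall x (h * 2 ^ k),
        |(y i - a i) / (h * 2 ^ (k + 3)) - (x i - a i) / (h * 2 ^ (k + 3))| ≤ 1 / 8 := by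
      intro y hy
      have := abs_coord_sub_le_of_mem_closedBall hy i
      rw [← sub_div, sub_sub_sub_cancel_right, abs_div, abs_of_pos hs3, div_le_iff₀ hs3, e3]
      linarith
    rcases floor_const_or_floor_sub_const N ((x i - a i) / (h * 2 ^ (k + 3))) with H | H
    · exact ⟨false, fun y hy => by simpa using H _ (hnear y hy)⟩
    · refine ⟨true, fun y hy => ?_⟩
      have := H _ (hnear y hy)
      simp only [if_true, ← sub_sub]
      rwa [sub_div _ (h * 2 ^ (k + 3 + (N : ℤ)) / 3), sub_div _ (h * 2 ^ (k + 3 + (N : ℤ)) / 3), hN]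
  choose b hb using key
  exact ⟨b, fun y hy => funext fun i => hb i y hy⟩

/-! ### Normalized integrals over balls -/

/-- The integral of `f` over the ball with centre `x` and radius `h * 2 ^ k`, divided by the
`n`-th power of the radius. -/
def ballMean (h : ℝ) (k : ℤ) (f : Rn n → ℝ≥0∞) (x : Rn n) : ℝ≥0∞ :=
  (∫⁻ y in Metric.closedBall x (h * 2 ^ k), f y) / ENNReal.ofReal (h * 2 ^ k) ^ n

theorem div_le_mul_div_of_scale {c s : ℝ} (hc : 0 < c) (X : ℝ≥0∞) :
    X / ENNReal.ofReal s ^ n ≤ ENNReal.ofReal c ^ n * (X / ENNReal.ofReal (c * s) ^ n) := by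
  have h0 : ENNReal.ofReal c ^ n ≠ 0 := by simp [hc]
  have ht : ENNReal.ofReal c ^ n ≠ ∞ := by simp
  rw [ENNReal.ofReal_mul hc.le, mul_pow, div_eq_mul_inv, div_eq_mul_inv,
    ENNReal.mul_inv (Or.inl h0) (Or.inl ht)]
  refine le_of_eq ?_
  calc _ = ENNReal.ofReal c ^ n * (ENNReal.ofReal c ^ n)⁻¹ *
        (X * (ENNReal.ofReal s ^ n)⁻¹) := by rw [ENNReal.mul_inv_cancel h0 ht, one_mul]
    _ = _ := by ring

theorem ballMean_le_gridAvg (a : Rn n) {h : ℝ} (hh : 0 < h) {k : ℤ} {x : Rn n}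
    (hsub : Metric.closedBall x (h * 2 ^ k) ⊆ gridCube a h (k + 3) x) (f : Rn n → ℝ≥0∞) :
    ballMean h k f x ≤ ENNReal.ofReal 8 ^ n * gridAvg a h (k + 3) f x := by
  have e3 : 8 * (h * (2 : ℝ) ^ k) = h * 2 ^ (k + 3) := by
    rw [zpow_add₀ two_ne_zero]; norm_num; ring
  unfold ballMean gridAvg
  refine (div_le_mul_div_of_scale (by norm_num : (0 : ℝ) < 8) _).trans ?_
  rw [e3, volume_gridCube a hh]
  gcongr

theorem closedBall_subset_cube {x : Rn n} {s : ℝ} (hs : 0 < s) : Metric.closedBall x s ⊆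
    cube (WithLp.toLp 2 fun i => x i - s) (3 * s) := by
  intro y hy i
  have := abs_le.1 (abs_coord_sub_le_of_mem_closedBall hy i)
  simp only
  constructor <;> linarith

theorem setLIntegral_div_le_rpow {R : Set (Rn n)} (hR0 : volume R ≠ 0) (hRt : volume R ≠ ∞) {P : ℝ}
    (hP : 1 < P) {f : Rn n → ℝ≥0∞} (hf : Measurable f) :
    (∫⁻ y in R, f y) / volume R ≤ ((∫⁻ y in R, f y ^ P) / volume R) ^ (1 / P) := by
  have hP0 : 0 < P := by linarith
  calc (∫⁻ y in R, f y) / volume R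
      ≤ ((∫⁻ y in R, f y ^ P) ^ (1 / P) * volume R ^ (1 - 1 / P)) / volume R := by
        gcongr
        have hsum : 1 / P + (1 - 1 / P) = 1 := by ring
        have h1 : 0 ≤ 1 - 1 / P := by
          rw [sub_nonneg, div_le_one hP0]; exact hP.le
        have := ENNReal.lintegral_mul_norm_pow_le (μ := volume.restrict R) (f := fun y => f y ^ P)
          (g := fun _ => 1) (hf.pow_const _).aemeasurable aemeasurable_const
          (by positivity : 0 ≤ 1 / P) h1 hsum
        simpa [← ENNReal.rpow_mul, hP0.ne'] using this
    _ = _ := by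
        rw [ENNReal.div_rpow_of_nonneg _ _ (by positivity), div_eq_mul_inv, div_eq_mul_inv,
          mul_assoc, ENNReal.rpow_sub _ _ hR0 hRt, ENNReal.rpow_one, div_eq_mul_inv,
          mul_comm (volume R), mul_assoc, ENNReal.mul_inv_cancel hR0 hRt, mul_one, ← div_eq_mul_inv]

theorem ballMean_le_cube {h : ℝ} (hh : 0 < h) (k : ℤ) {P : ℝ} (hP : 1 < P) {f : Rn n → ℝ≥0∞}
    (hf : Measurable f) (x : Rn n) :
    ballMean h k f x ≤ ENNReal.ofReal 3 ^ n *
      ((∫⁻ y in cube (WithLp.toLp 2 fun i => x i - h * 2 ^ k) (3 * (h * 2 ^ k)), f y ^ P) /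
        volume (cube (WithLp.toLp 2 fun i => x i - h * 2 ^ k) (3 * (h * 2 ^ k)))) ^ (1 / P) := by
  have hs := side_pos hh k
  unfold ballMean
  refine (div_le_mul_div_of_scale (by norm_num : (0 : ℝ) < 3) _).trans ?_
  rw [← volume_cube (WithLp.toLp 2 fun i => x i - h * 2 ^ k) (3 * (h * 2 ^ k))]
  gcongr
  refine le_trans ?_ (setLIntegral_div_le_rpow (volume_cube_ne_zero _ (by positivity))
    (volume_cube_ne_top _ _) hP hf)
  gcongr
  exact closedBall_subset_cube hs

/-- Decay of the averages at scale `k` given by the Morrey bound `M`. -/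
theorem prod_ballMean_le {m : ℕ} {P : Fin m → ℝ} (hP : ∀ i, 1 < P i) {p₀ : ℝ} (hp₀ : 0 < p₀)
    {f : Fin m → Rn n → ℝ≥0∞} (hf : ∀ i, Measurable (f i)) {M : ℝ≥0∞}
    (hM : ∀ (a : Rn n) (ℓ : ℝ), 0 < ℓ → volume (cube a ℓ) ^ (1 / p₀) *
      ∏ i, ((∫⁻ y in cube a ℓ, f i y ^ P i) / volume (cube a ℓ)) ^ (1 / P i) ≤ M)
    {h : ℝ} (hh : 0 < h) (k : ℤ) (x : Rn n) :
    ∏ i, ballMean h k (f i) x ≤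
      ENNReal.ofReal 3 ^ (n * m) * M * ENNReal.ofReal (h * 2 ^ k) ^ (-(n / p₀)) := by
  have hs := side_pos hh k
  set R := cube (WithLp.toLp 2 fun i => x i - h * 2 ^ k) (3 * (h * 2 ^ k))
  have hR : volume R = ENNReal.ofReal (3 * (h * 2 ^ k)) ^ n := volume_cube _ _
  have hR0 : volume R ≠ 0 := volume_cube_ne_zero _ (by positivity)
  have hRt : volume R ≠ ∞ := volume_cube_ne_top _ _
  have h0 : volume R ^ (1 / p₀) ≠ 0 := by simp [hR0, hRt]
  have ht : volume R ^ (1 / p₀) ≠ ∞ := ENNReal.rpow_ne_top_of_nonneg (by positivity) hRt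
  set Y := ∏ i, ((∫⁻ y in R, f i y ^ P i) / volume R) ^ (1 / P i)
  have hY : Y ≤ M * (volume R ^ (1 / p₀))⁻¹ := by
    rw [← div_eq_mul_inv, ENNReal.le_div_iff_mul_le (Or.inl h0) (Or.inl ht), mul_comm]
    exact hM _ _ (by positivity)
  calc ∏ i, ballMean h k (f i) x
      ≤ ∏ i : Fin m, (ENNReal.ofReal 3 ^ n *
          ((∫⁻ y in R, f i y ^ P i) / volume R) ^ (1 / P i)) :=
        Finset.prod_le_prod' fun i _ => ballMean_le_cube hh k (hP i) (hf i) x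
    _ = ENNReal.ofReal 3 ^ (n * m) * Y := by
        rw [Finset.prod_mul_distrib, Finset.prod_const, ← pow_mul]
        simp [Y]
    _ ≤ ENNReal.ofReal 3 ^ (n * m) * (M * ENNReal.ofReal (h * 2 ^ k) ^ (-(n / p₀))) := by
        gcongr
        refine hY.trans ?_
        gcongr
        rw [ENNReal.rpow_neg, hR, ← ENNReal.rpow_natCast, ← ENNReal.rpow_mul, mul_one_div]
        exact ENNReal.inv_le_inv.2 (ENNReal.rpow_le_rpow (ENNReal.ofReal_le_ofReal (by linarith))
          (by positivity))
    _ = _ := by ring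

/-! ### Hedberg's inequality -/

/-- Hedberg's interpolation: a sum with the larger exponent `α` is controlled by the sum with the
smaller exponent `β` and by the decay of the terms. -/
theorem exists_tsum_le_hedberg {α β ν : ℝ} (hβα : β ≤ α) (hαν : α < ν) :
    ∃ C : ℝ≥0∞, C ≠ ∞ ∧ ∀ (h : ℝ) (_ : 0 < h) (M : ℝ≥0∞) (_ : M ≠ ∞) (G : ℤ → ℝ≥0∞)
      (_ : ∀ k, G k ≤ M * ENNReal.ofReal (h * 2 ^ k) ^ (-ν)),
      ∑' k : ℤ, ENNReal.ofReal (h * 2 ^ k) ^ α * G k ≤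
        C * ((∑' k : ℤ, ENNReal.ofReal (h * 2 ^ k) ^ β * G k) ^ ((ν - α) / (ν - β)) *
          M ^ (1 - (ν - α) / (ν - β))) := by
  have hνβ : 0 < ν - β := by linarith
  have hνα : 0 < ν - α := by linarith
  rcases hβα.eq_or_lt with rfl | hlt
  · refine ⟨1, ENNReal.one_ne_top, fun h _ M _ G _ => ?_⟩
    simp [div_self hνα.ne']
  have hαβ : 0 < α - β := by linarith
  refine ⟨(1 - (2 : ℝ≥0∞) ^ (-(α - β)))⁻¹ + (1 - (2 : ℝ≥0∞) ^ (-(ν - α)))⁻¹,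
    ENNReal.add_ne_top.2 ⟨one_sub_two_rpow_neg_inv_ne_top hαβ,
      one_sub_two_rpow_neg_inv_ne_top hνα⟩, ?_⟩
  intro h hh M hM G hG
  set S := ∑' k : ℤ, ENNReal.ofReal (h * 2 ^ k) ^ β * G k
  have hofReal0 : ∀ k : ℤ, ENNReal.ofReal (h * 2 ^ k) ≠ 0 := fun k => by
    simpa using side_pos hh k
  have hle : ∀ k, ENNReal.ofReal (h * 2 ^ k) ^ β * G k ≤ S := fun k => ENNReal.le_tsum k
  rcases eq_or_ne S 0 with hS0 | hS0
  · have hz : ∀ k, G k = 0 := by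
      intro k
      have h1 := hle k
      rw [hS0, nonpos_iff_eq_zero, mul_eq_zero] at h1
      refine h1.resolve_left ?_
      simp [ENNReal.rpow_eq_zero_iff, hofReal0 k]
    simp [hz]
  have hM0 : M ≠ 0 := by
    rintro rfl
    refine hS0 (ENNReal.tsum_eq_zero.2 fun k => ?_)
    have := hG k
    rw [zero_mul, nonpos_iff_eq_zero] at this
    rw [this, mul_zero]
  have hexp0 : 0 < (ν - α) / (ν - β) := by positivity
  rcases eq_or_ne S ∞ with hSt | hSt
  · rw [hSt, ENNReal.top_rpow_of_pos hexp0, ENNReal.top_mul, ENNReal.mul_top]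
    · exact le_top
    · simp
    · simp [ENNReal.rpow_eq_zero_iff, hM0, hM]
  -- The two competing bounds balance at the scale `t` with `t ^ (ν - β) = M / S`.
  set t : ℝ := (M / S).toReal ^ (1 / (ν - β))
  have hMS0 : M / S ≠ 0 := by simp [hM0, hSt]
  have hMSt : M / S ≠ ∞ := ENNReal.div_ne_top hM hS0
  have ht0 : 0 < t := Real.rpow_pos_of_pos (ENNReal.toReal_pos hMS0 hMSt) _
  have ht : ENNReal.ofReal t = (M / S) ^ (1 / (ν - β)) := by
    rw [← ENNReal.ofReal_rpow_of_pos (ENNReal.toReal_pos hMS0 hMSt), ENNReal.ofReal_toReal hMSt]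
  have hterm : ∀ k : ℤ, ENNReal.ofReal (h * 2 ^ k) ^ α * G k ≤
      S * (if h * 2 ^ k ≤ t then ENNReal.ofReal (h * 2 ^ k) ^ (α - β) else 0) +
      M * (if t ≤ h * 2 ^ k then ENNReal.ofReal (h * 2 ^ k) ^ (-(ν - α)) else 0) := by
    intro k
    rcases le_total (h * 2 ^ k) t with hk | hk
    · rw [if_pos hk]
      refine le_add_right ?_
      calc ENNReal.ofReal (h * 2 ^ k) ^ α * G k
          = ENNReal.ofReal (h * 2 ^ k) ^ β * G k * ENNReal.ofReal (h * 2 ^ k) ^ (α - β) := by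
            rw [mul_right_comm, ← ENNReal.rpow_add _ _ (hofReal0 k) ENNReal.ofReal_ne_top]
            congr 2; ring
        _ ≤ _ := by gcongr; exact hle k
    · rw [if_pos hk]
      refine le_add_left ?_
      calc ENNReal.ofReal (h * 2 ^ k) ^ α * G k
          ≤ ENNReal.ofReal (h * 2 ^ k) ^ α * (M * ENNReal.ofReal (h * 2 ^ k) ^ (-ν)) := by
            gcongr; exact hG k
        _ = _ := by
            rw [mul_left_comm, ← ENNReal.rpow_add _ _ (hofReal0 k) ENNReal.ofReal_ne_top]
            congr 2; ring
  have hb1 : S * ENNReal.ofReal t ^ (α - β) =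
      S ^ ((ν - α) / (ν - β)) * M ^ (1 - (ν - α) / (ν - β)) := by
    rw [ht, ← ENNReal.rpow_mul, div_eq_mul_inv M, ENNReal.mul_rpow_of_ne_top hM
      (ENNReal.inv_ne_top.2 hS0), ENNReal.inv_rpow, ← ENNReal.rpow_neg, mul_left_comm]
    nth_rewrite 1 [← ENNReal.rpow_one S]
    rw [← ENNReal.rpow_add _ _ hS0 hSt, mul_comm]
    congr 2 <;> field_simp <;> ring
  have hb2 : M * ENNReal.ofReal t ^ (-(ν - α)) =
      S ^ ((ν - α) / (ν - β)) * M ^ (1 - (ν - α) / (ν - β)) := by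
    rw [ht, ← ENNReal.rpow_mul, div_eq_mul_inv M, ENNReal.mul_rpow_of_ne_top hM
      (ENNReal.inv_ne_top.2 hS0), ENNReal.inv_rpow, ← ENNReal.rpow_neg, ← mul_assoc]
    nth_rewrite 1 [← ENNReal.rpow_one M]
    rw [← ENNReal.rpow_add _ _ hM0 hM, mul_comm]
    congr 2
    · field_simp
    · field_simp
      ring
  calc _ ≤ ∑' k : ℤ, (S * (if h * 2 ^ k ≤ t then ENNReal.ofReal (h * 2 ^ k) ^ (α - β) else 0) +
      M * (if t ≤ h * 2 ^ k then ENNReal.ofReal (h * 2 ^ k) ^ (-(ν - α)) else 0)) :=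
        ENNReal.tsum_le_tsum hterm
    _ ≤ S * ((1 - (2 : ℝ≥0∞) ^ (-(α - β)))⁻¹ * ENNReal.ofReal t ^ (α - β)) +
        M * ((1 - (2 : ℝ≥0∞) ^ (-(ν - α)))⁻¹ * ENNReal.ofReal t ^ (-(ν - α))) := by
        rw [ENNReal.tsum_add, ENNReal.tsum_mul_left, ENNReal.tsum_mul_left]
        gcongr
        · exact tsum_side_rpow_le hαβ hh ht0
        · exact tsum_side_rpow_neg_le hνα hh ht0
    _ = (1 - (2 : ℝ≥0∞) ^ (-(α - β)))⁻¹ * (S * ENNReal.ofReal t ^ (α - β)) +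
        (1 - (2 : ℝ≥0∞) ^ (-(ν - α)))⁻¹ * (M * ENNReal.ofReal t ^ (-(ν - α))) := by ring
    _ = _ := by rw [hb1, hb2, add_mul]

/-! ### The Morrey estimate on one cube -/

/-- The bump condition bounds the mass of the weight on a cube, by Jensen's inequality. -/
theorem setLIntegral_weight_cube_le {p r β : ℝ} (hp0 : 0 < p) (hr : 1 < r) {w : Rn n → ℝ≥0∞}
    (hw : Measurable w) {A : ℝ≥0∞} {a : Rn n} {h : ℝ} (hh : 0 < h)
    (hA : ENNReal.ofReal h ^ β *
      ((∫⁻ x in cube a h, w x ^ r) / volume (cube a h)) ^ (1 / (r * p)) ≤ A) :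
    ∫⁻ x in cube a h, w x ≤ volume (cube a h) * (A ^ p * ENNReal.ofReal h ^ (-(β * p))) := by
  have hr0 : 0 < r := by linarith
  have hV0 := volume_cube_ne_zero a hh
  have hVt := volume_cube_ne_top a h
  have hh0 : ENNReal.ofReal h ≠ 0 := by simpa using hh
  have h0 : ENNReal.ofReal h ^ β ≠ 0 := by simp [ENNReal.rpow_eq_zero_iff, hh]
  have ht : ENNReal.ofReal h ^ β ≠ ∞ := by simp [ENNReal.rpow_eq_top_iff, hh]
  have h1 := setLIntegral_div_le_rpow hV0 hVt hr hw
  have h2 : ((∫⁻ x in cube a h, w x ^ r) / volume (cube a h)) ^ (1 / (r * p)) ≤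
      A * ENNReal.ofReal h ^ (-β) := by
    rw [ENNReal.rpow_neg, ← div_eq_mul_inv, ENNReal.le_div_iff_mul_le (Or.inl h0) (Or.inl ht),
      mul_comm]
    exact hA
  rw [ENNReal.div_le_iff hV0 hVt, mul_comm] at h1
  refine h1.trans ?_
  gcongr
  calc ((∫⁻ x in cube a h, w x ^ r) / volume (cube a h)) ^ (1 / r)
      = (((∫⁻ x in cube a h, w x ^ r) / volume (cube a h)) ^ (1 / (r * p))) ^ p := by
        rw [← ENNReal.rpow_mul]; congr 1; field_simp
    _ ≤ (A * ENNReal.ofReal h ^ (-β)) ^ p := by gcongr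
    _ = _ := by rw [ENNReal.mul_rpow_of_nonneg _ _ hp0.le, ← ENNReal.rpow_mul, neg_mul]

/-- The concentric cube of three times the side length. -/
def tripleCube (a : Rn n) (h : ℝ) : Set (Rn n) := cube (WithLp.toLp 2 fun i => a i - h) (3 * h)

theorem closedBall_subset_tripleCube {a x : Rn n} {h : ℝ} (hx : x ∈ cube a h) {s : ℝ}
    (hs : s ≤ h) : Metric.closedBall x s ⊆ tripleCube a h := by
  intro y hy i
  have h1 := abs_le.1 (abs_coord_sub_le_of_mem_closedBall hy i)
  have h2 := hx i
  simp only
  constructor <;> linarith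

/-- On a cube of side `h`, the scales up to `h` are controlled by `2 ^ n` dyadic operators applied
to functions supported in the triple cube. -/
theorem tsum_ballMean_small_le {m : ℕ} {β : ℝ} (hβ : 0 < β) (f : Fin m → Rn n → ℝ≥0∞)
    (a : Rn n) {h : ℝ} (hh : 0 < h) {x : Rn n} (hx : x ∈ cube a h) :
    ∑' k : ℤ, (if k ≤ 0 then ENNReal.ofReal (h * 2 ^ k) ^ β * ∏ i, ballMean h k (f i) x else 0) ≤
      ENNReal.ofReal 8 ^ (n * m) * ∑ b : Fin n → Bool, ∑' k : ℤ,
        (if k ≤ 3 then ENNReal.ofReal (h * 2 ^ k) ^ β else 0) *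
          ∏ i, gridAvg (shiftOrigin a (h * 2 ^ (3 : ℤ) / 3) b) h k
            ((tripleCube a h).indicator (f i)) x := by
  set g : Fin m → Rn n → ℝ≥0∞ := fun i => (tripleCube a h).indicator (f i)
  set T : (Fin n → Bool) → ℤ → ℝ≥0∞ := fun b k =>
    (if k ≤ 3 then ENNReal.ofReal (h * 2 ^ k) ^ β else 0) *
      ∏ i, gridAvg (shiftOrigin a (h * 2 ^ (3 : ℤ) / 3) b) h k (g i) x
  have hterm : ∀ k : ℤ,
      (if k ≤ 0 then ENNReal.ofReal (h * 2 ^ k) ^ β * ∏ i, ballMean h k (f i) x else 0) ≤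
        ENNReal.ofReal 8 ^ (n * m) * ∑ b, T b (k + 3) := by
    intro k
    split_ifs with hk
    · obtain ⟨b, hb⟩ := exists_closedBall_subset_gridCube a hh (by omega : k + 3 ≤ 3) x
      have hkh : h * (2 : ℝ) ^ k ≤ h := by
        have : (2 : ℝ) ^ k ≤ 1 := zpow_le_one_of_nonpos₀ one_le_two hk
        nlinarith
      have h1 : ∀ i, ballMean h k (f i) x = ballMean h k (g i) x := by
        intro i
        unfold ballMean
        congr 1
        refine setLIntegral_congr_fun Metric.isClosed_closedBall.measurableSet fun y hy => ?_
        simp only [g]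
        rw [Set.indicator_of_mem (closedBall_subset_tripleCube hx hkh hy)]
      calc ENNReal.ofReal (h * 2 ^ k) ^ β * ∏ i, ballMean h k (f i) x
          ≤ ENNReal.ofReal (h * 2 ^ (k + 3)) ^ β * ∏ i : Fin m, (ENNReal.ofReal 8 ^ n *
              gridAvg (shiftOrigin a (h * 2 ^ (3 : ℤ) / 3) b) h (k + 3) (g i) x) := by
            gcongr with i
            · exact one_le_two
            · omega
            · rw [h1]
              exact ballMean_le_gridAvg _ hh hb _
        _ = ENNReal.ofReal 8 ^ (n * m) * T b (k + 3) := by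
            simp only [T]
            rw [if_pos (by omega), Finset.prod_mul_distrib, Finset.prod_const, ← pow_mul,
              Finset.card_univ, Fintype.card_fin]
            ring
        _ ≤ _ := by
            gcongr
            exact Finset.single_le_sum (f := fun b => T b (k + 3)) (fun _ _ => zero_le)
              (Finset.mem_univ b)
    · exact zero_le
  refine (ENNReal.tsum_le_tsum hterm).trans_eq ?_
  rw [ENNReal.tsum_mul_left]
  congr 1
  rw [Summable.tsum_finsetSum fun b _ => ENNReal.summable]
  exact Finset.sum_congr rfl fun b _ => (Equiv.addRight (3 : ℤ)).tsum_eq (T b)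

/-- The scales above `h` form a geometric series, by the Morrey decay of the averages. -/
theorem tsum_ballMean_large_le {m : ℕ} {β ν : ℝ} (hβν : β < ν) (f : Fin m → Rn n → ℝ≥0∞)
    {h : ℝ} (hh : 0 < h) (x : Rn n) {D : ℝ≥0∞}
    (hD : ∀ k, ∏ i, ballMean h k (f i) x ≤ D * ENNReal.ofReal (h * 2 ^ k) ^ (-ν)) :
    ∑' k : ℤ, (if k ≤ 0 then 0 else ENNReal.ofReal (h * 2 ^ k) ^ β * ∏ i, ballMean h k (f i) x) ≤
      D * ((1 - (2 : ℝ≥0∞) ^ (-(ν - β)))⁻¹ * ENNReal.ofReal h ^ (-(ν - β))) := by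
  refine le_trans ?_ (mul_le_mul' le_rfl (tsum_side_rpow_neg_le (sub_pos.2 hβν) hh hh))
  rw [← ENNReal.tsum_mul_left]
  refine ENNReal.tsum_le_tsum fun k => ?_
  split_ifs with hk hk' hk'
  · exact zero_le
  · exact zero_le
  · calc _ ≤ ENNReal.ofReal (h * 2 ^ k) ^ β * (D * ENNReal.ofReal (h * 2 ^ k) ^ (-ν)) := by
          gcongr; exact hD k
      _ = _ := by
        have h0 : ENNReal.ofReal (h * 2 ^ k) ≠ 0 := by simpa using side_pos hh k
        rw [mul_left_comm, ← ENNReal.rpow_add _ _ h0 ENNReal.ofReal_ne_top]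
        congr 2; ring
  · have : (1 : ℝ) ≤ 2 ^ k := one_le_zpow₀ one_le_two (by omega)
    exact absurd (by nlinarith) hk'

/-- The `L^P` norms of the localized functions, in terms of the Morrey bound `M`. -/
theorem prod_tripleCube_le {m : ℕ} {P : Fin m → ℝ} (hP : ∀ i, 1 < P i) {p p₀ : ℝ} (hp0 : 0 < p)
    (hp : 1 / p = ∑ i, 1 / P i) (hpp₀ : p ≤ p₀) {f : Fin m → Rn n → ℝ≥0∞} {M : ℝ≥0∞} {a : Rn n}
    {h : ℝ} (hh : 0 < h)
    (hM : volume (tripleCube a h) ^ (1 / p₀) * ∏ i, ((∫⁻ y in tripleCube a h, f i y ^ P i) /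
      volume (tripleCube a h)) ^ (1 / P i) ≤ M) :
    ∏ i, (∫⁻ y, (tripleCube a h).indicator (f i) y ^ P i) ^ (p / P i) ≤
      (ENNReal.ofReal 3 ^ n) ^ (1 - p / p₀) * (M ^ p * volume (cube a h) ^ (1 - p / p₀)) := by
  have hp₀ : 0 < p₀ := hp0.trans_le hpp₀
  have hP0 : ∀ i, 0 < P i := fun i => one_pos.trans (hP i)
  have hexp : 0 ≤ 1 - p / p₀ := by rw [sub_nonneg, div_le_one hp₀]; exact hpp₀
  have hRm : MeasurableSet (tripleCube a h) := measurableSet_cube _ _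
  set R := tripleCube a h
  have hR0 : volume R ≠ 0 := volume_cube_ne_zero _ (by positivity)
  have hRt : volume R ≠ ∞ := volume_cube_ne_top _ _
  have hRV : volume R = ENNReal.ofReal 3 ^ n * volume (cube a h) := by
    simp only [R, tripleCube]
    rw [volume_cube, volume_cube, ENNReal.ofReal_mul (by norm_num), mul_pow]
  have hI : ∀ i, ∫⁻ y, R.indicator (f i) y ^ P i = ∫⁻ y in R, f i y ^ P i := by
    intro i
    rw [← lintegral_indicator hRm]
    refine lintegral_congr fun y => ?_
    by_cases hy : y ∈ R
    · simp [hy]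
    · simp [hy, hP0 i]
  have hsum : ∏ i, volume R ^ (1 / P i) = volume R ^ (1 / p) := by
    rw [hp]
    generalize (Finset.univ : Finset (Fin m)) = s
    induction s using Finset.induction_on with
    | empty => simp
    | insert i s hi ih =>
      rw [Finset.prod_insert hi, Finset.sum_insert hi, ENNReal.rpow_add _ _ hR0 hRt, ih]
  have h1 : ∏ i, (∫⁻ y in R, f i y ^ P i) ^ (1 / P i) ≤ M * volume R ^ (1 / p - 1 / p₀) := by
    calc _ = ∏ i, (((∫⁻ y in R, f i y ^ P i) / volume R) ^ (1 / P i) * volume R ^ (1 / P i)) := by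
          refine Finset.prod_congr rfl fun i _ => ?_
          rw [← ENNReal.mul_rpow_of_nonneg _ _ (one_div_pos.2 (hP0 i)).le,
            ENNReal.div_mul_cancel hR0 hRt]
      _ = (volume R ^ (1 / p₀) * ∏ i, ((∫⁻ y in R, f i y ^ P i) / volume R) ^ (1 / P i)) *
            volume R ^ (1 / p - 1 / p₀) := by
          rw [Finset.prod_mul_distrib, hsum, mul_comm, mul_right_comm,
            ← ENNReal.rpow_add _ _ hR0 hRt]
          congr 2; ring
      _ ≤ _ := by gcongr
  calc _ = (∏ i, (∫⁻ y in R, f i y ^ P i) ^ (1 / P i)) ^ p := by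
        rw [← ENNReal.prod_rpow_of_nonneg hp0.le]
        refine Finset.prod_congr rfl fun i _ => ?_
        rw [hI, ← ENNReal.rpow_mul]
        congr 1; ring
    _ ≤ (M * volume R ^ (1 / p - 1 / p₀)) ^ p := by gcongr
    _ = M ^ p * volume R ^ (1 - p / p₀) := by
        rw [ENNReal.mul_rpow_of_nonneg _ _ hp0.le, ← ENNReal.rpow_mul]
        congr 2; field_simp
    _ = _ := by
        rw [hRV, ENNReal.mul_rpow_of_nonneg _ _ hexp]
        ring

/-- The trace estimate on a cube for the multilinear potential of order `β`. -/
theorem exists_setLIntegral_tsum_ballMean_rpow_le {m : ℕ} {P : Fin m → ℝ} (hP : ∀ i, 1 < P i)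
    {p p₀ r β : ℝ} (hp1 : 1 < p) (hp : 1 / p = ∑ i, 1 / P i) (hpp₀ : p ≤ p₀) (hr : 1 < r)
    (hβ : 0 < β) (hβν : β < n / p₀) :
    ∃ C : ℝ≥0∞, C ≠ ∞ ∧ ∀ (w : Rn n → ℝ≥0∞) (_ : Measurable w) (A : ℝ≥0∞)
      (_ : ∀ (a : Rn n) (ℓ : ℝ), 0 < ℓ → ENNReal.ofReal ℓ ^ β *
        ((∫⁻ x in cube a ℓ, w x ^ r) / volume (cube a ℓ)) ^ (1 / (r * p)) ≤ A)
      (f : Fin m → Rn n → ℝ≥0∞) (_ : ∀ i, Measurable (f i)) (M : ℝ≥0∞)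
      (_ : ∀ (a : Rn n) (ℓ : ℝ), 0 < ℓ → volume (cube a ℓ) ^ (1 / p₀) *
        ∏ i, ((∫⁻ y in cube a ℓ, f i y ^ P i) / volume (cube a ℓ)) ^ (1 / P i) ≤ M)
      (a : Rn n) (h : ℝ), 0 < h →
      ∫⁻ x in cube a h, (∑' k : ℤ, ENNReal.ofReal (h * 2 ^ k) ^ β *
          ∏ i, ballMean h k (f i) x) ^ p * w x ≤
        C * (A ^ p * M ^ p * volume (cube a h) ^ (1 - p / p₀)) := by
  have hp0 : 0 < p := by linarith
  have hp₀ : 0 < p₀ := hp0.trans_le hpp₀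
  have hexp : 0 ≤ 1 - p / p₀ := by rw [sub_nonneg, div_le_one hp₀]; exact hpp₀
  obtain ⟨C₁, hC₁, H₁⟩ := exists_lintegral_dyadic_rpow_le (n := n) hP hp1 hp hr hβ
  set E : ℝ≥0∞ := (1 - (2 : ℝ≥0∞) ^ (-(n / p₀ - β)))⁻¹
  have hE : E ≠ ∞ := one_sub_two_rpow_neg_inv_ne_top (sub_pos.2 hβν)
  set D : ℝ≥0∞ := ENNReal.ofReal 3 ^ (n * m)
  have hD : D ≠ ∞ := by simp [D]
  set B : ℝ≥0∞ := ENNReal.ofReal 8 ^ (n * m)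
  have hB : B ≠ ∞ := by simp [B]
  set N : ℝ≥0∞ := (Fintype.card (Fin n → Bool) : ℝ≥0∞)
  have hN : N ≠ ∞ := by simp [N]
  set T3 : ℝ≥0∞ := (ENNReal.ofReal 3 ^ n) ^ (1 - p / p₀)
  have hT3 : T3 ≠ ∞ := ENNReal.rpow_ne_top_of_nonneg hexp (by simp)
  have hp1' : 0 ≤ p - 1 := by linarith
  refine ⟨2 ^ (p - 1) * ((D * E) ^ p + B ^ p * (N ^ (p - 1) * (N * (C₁ * T3)))), ?_, ?_⟩
  · have h1 := ENNReal.rpow_ne_top_of_nonneg hp0.le (ENNReal.mul_ne_top hD hE)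
    have h2 := ENNReal.rpow_ne_top_of_nonneg hp0.le hB
    have h3 := ENNReal.rpow_ne_top_of_nonneg hp1' hN
    have h4 := ENNReal.rpow_ne_top_of_nonneg hp1' (by simp : (2 : ℝ≥0∞) ≠ ∞)
    exact ENNReal.mul_ne_top h4 (ENNReal.add_ne_top.2 ⟨h1, ENNReal.mul_ne_top h2
      (ENNReal.mul_ne_top h3 (ENNReal.mul_ne_top hN (ENNReal.mul_ne_top hC₁ hT3)))⟩)
  intro w hw A hA f hf M hM a h hh
  have hQm : MeasurableSet (cube a h) := measurableSet_cube a h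
  set V := volume (cube a h)
  have hV : V = ENNReal.ofReal h ^ n := volume_cube a h
  have hV0 : V ≠ 0 := volume_cube_ne_zero a hh
  have hVt : V ≠ ∞ := volume_cube_ne_top a h
  have hh0 : ENNReal.ofReal h ≠ 0 := by simpa using hh
  set g : Fin m → Rn n → ℝ≥0∞ := fun i => (tripleCube a h).indicator (f i)
  have hg : ∀ i, Measurable (g i) := fun i => (hf i).indicator (measurableSet_cube _ _)
  set L : ℝ≥0∞ := D * M * (E * ENNReal.ofReal h ^ (-(n / p₀ - β)))
  set T : (Fin n → Bool) → Rn n → ℝ≥0∞ := fun b x => ∑' k : ℤ,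
    (if k ≤ 3 then ENNReal.ofReal (h * 2 ^ k) ^ β else 0) *
      ∏ i, gridAvg (shiftOrigin a (h * 2 ^ (3 : ℤ) / 3) b) h k (g i) x
  have hTm : ∀ b, Measurable (T b) := fun b => Measurable.tsum fun k =>
    (Finset.measurable_fun_prod _ fun i _ => measurable_gridAvg _ _ _ _).const_mul _
  have hpt : ∀ x ∈ cube a h, (∑' k : ℤ, ENNReal.ofReal (h * 2 ^ k) ^ β *
      ∏ i, ballMean h k (f i) x) ^ p * w x ≤
      2 ^ (p - 1) * (L ^ p * w x + B ^ p * (N ^ (p - 1) * ∑ b, T b x ^ p * w x)) := by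
    intro x hx
    have hS : ∑' k : ℤ, ENNReal.ofReal (h * 2 ^ k) ^ β * ∏ i, ballMean h k (f i) x ≤
        L + B * ∑ b, T b x := by
      refine le_trans (le_of_eq ?_) (add_le_add
        (tsum_ballMean_large_le hβν f hh x fun k => prod_ballMean_le hP hp₀ hf hM hh k x)
        (tsum_ballMean_small_le hβ f a hh hx))
      rw [← ENNReal.tsum_add]
      refine tsum_congr fun k => ?_
      split_ifs <;> simp
    calc _ ≤ (L + B * ∑ b, T b x) ^ p * w x := by gcongr
      _ ≤ 2 ^ (p - 1) * (L ^ p + (B * ∑ b, T b x) ^ p) * w x := by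
          gcongr
          exact ENNReal.rpow_add_le_mul_rpow_add_rpow _ _ hp1.le
      _ ≤ 2 ^ (p - 1) * (L ^ p + B ^ p * (N ^ (p - 1) * ∑ b, T b x ^ p)) * w x := by
          have h1 : (B * ∑ b, T b x) ^ p ≤ B ^ p * (N ^ (p - 1) * ∑ b, T b x ^ p) := by
            rw [ENNReal.mul_rpow_of_nonneg _ _ hp0.le]
            exact mul_le_mul' le_rfl (ENNReal.rpow_sum_le_const_mul_sum_rpow _ _ hp1.le)
          gcongr
      _ = _ := by rw [← Finset.sum_mul]; ring
  have hTb : ∀ b, ∫⁻ x in cube a h, T b x ^ p * w x ≤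
      C₁ * T3 * (A ^ p * M ^ p * V ^ (1 - p / p₀)) := by
    intro b
    calc ∫⁻ x in cube a h, T b x ^ p * w x ≤ ∫⁻ x, T b x ^ p * w x := setLIntegral_le_lintegral _ _
      _ ≤ C₁ * A ^ p * ∏ i, (∫⁻ x, g i x ^ P i) ^ (p / P i) := by
          refine H₁ _ h hh 3 w hw A (fun k _ x => ?_) g hg
          unfold gridAvg
          rw [gridCube_eq_cube _ hh]
          exact hA _ _ (side_pos hh k)
      _ ≤ C₁ * A ^ p * (T3 * (M ^ p * V ^ (1 - p / p₀))) := by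
          gcongr
          exact prod_tripleCube_le hP hp0 hp hpp₀ hh (hM _ _ (by positivity))
      _ = _ := by ring
  have hL : L ^ p * ∫⁻ x in cube a h, w x ≤ (D * E) ^ p * (A ^ p * M ^ p * V ^ (1 - p / p₀)) := by
    calc L ^ p * ∫⁻ x in cube a h, w x
        ≤ L ^ p * (V * (A ^ p * ENNReal.ofReal h ^ (-(β * p)))) := by
          gcongr
          exact setLIntegral_weight_cube_le hp0 hr hw hh (hA a h hh)
      _ = (D * E) ^ p * (A ^ p * M ^ p * (V *
            (ENNReal.ofReal h ^ (-(n / p₀ - β) * p) * ENNReal.ofReal h ^ (-(β * p))))) := by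
          simp only [L]
          rw [ENNReal.rpow_mul _ (-(n / p₀ - β)) p]
          simp only [ENNReal.mul_rpow_of_nonneg _ _ hp0.le]
          ring
      _ = _ := by
          have h1 : V ^ (-(p / p₀)) = ENNReal.ofReal h ^ (-(n / p₀ * p)) := by
            rw [hV, ← ENNReal.rpow_natCast, ← ENNReal.rpow_mul]
            congr 1
            ring
          rw [← ENNReal.rpow_add _ _ hh0 ENNReal.ofReal_ne_top, sub_eq_add_neg 1,
            ENNReal.rpow_add _ _ hV0 hVt, ENNReal.rpow_one, h1]
          congr 4
          ring
  calc _ ≤ ∫⁻ x in cube a h,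
        2 ^ (p - 1) * (L ^ p * w x + B ^ p * (N ^ (p - 1) * ∑ b, T b x ^ p * w x)) :=
        setLIntegral_mono' hQm hpt
    _ = 2 ^ (p - 1) * (L ^ p * (∫⁻ x in cube a h, w x) +
          B ^ p * (N ^ (p - 1) * ∑ b, ∫⁻ x in cube a h, T b x ^ p * w x)) := by
        have hm1 : ∀ b, Measurable fun x => T b x ^ p * w x := fun b =>
          ((hTm b).pow_const _).mul hw
        have hm2 : Measurable fun x => ∑ b, T b x ^ p * w x :=
          Finset.measurable_fun_sum _ fun b _ => hm1 b
        have hm3 : Measurable fun x => N ^ (p - 1) * ∑ b, T b x ^ p * w x := hm2.const_mul _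
        have hm4 : Measurable fun x =>
            L ^ p * w x + B ^ p * (N ^ (p - 1) * ∑ b, T b x ^ p * w x) :=
          (hw.const_mul _).add (hm3.const_mul _)
        rw [lintegral_const_mul _ hm4, lintegral_add_left (hw.const_mul _),
          lintegral_const_mul _ hw, lintegral_const_mul _ hm3, lintegral_const_mul _ hm2,
          lintegral_finsetSum _ fun b _ => hm1 b]
    _ ≤ 2 ^ (p - 1) * ((D * E) ^ p * (A ^ p * M ^ p * V ^ (1 - p / p₀)) +
          B ^ p * (N ^ (p - 1) * ∑ _b : Fin n → Bool,
            C₁ * T3 * (A ^ p * M ^ p * V ^ (1 - p / p₀)))) := by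
        refine mul_le_mul' le_rfl (add_le_add hL (mul_le_mul' le_rfl (mul_le_mul' le_rfl ?_)))
        exact Finset.sum_le_sum fun b _ => hTb b
    _ = _ := by
        rw [Finset.sum_const, Finset.card_univ, nsmul_eq_mul]
        ring

/-! ### Discretization of the fractional integral -/

theorem enorm_fracIntegrand {𝕜 : Type*} [RCLike 𝕜] {m : ℕ} (α : ℝ) (f : Fin m → Rn n → 𝕜)
    (x : Rn n) {y : Fin m → Rn n} (hy : 0 < ∑ i, ‖x - y i‖) :
    ‖fracIntegrand α f x y‖ₑ =
      ENNReal.ofReal (∑ i, ‖x - y i‖) ^ (-((m : ℝ) * n - α)) * ∏ i, ‖f i (y i)‖ₑ := by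
  have h1 : ‖(((∑ i, ‖x - y i‖) ^ ((m : ℝ) * n - α) : ℝ) : 𝕜)‖ₑ =
      ENNReal.ofReal (∑ i, ‖x - y i‖) ^ ((m : ℝ) * n - α) := by
    rw [← ofReal_norm, RCLike.norm_ofReal, abs_of_pos (Real.rpow_pos_of_pos hy _),
      ENNReal.ofReal_rpow_of_pos hy]
  have h2 : (((∑ i, ‖x - y i‖) ^ ((m : ℝ) * n - α) : ℝ) : 𝕜) ≠ 0 := by
    rw [Ne, RCLike.ofReal_eq_zero]
    exact (Real.rpow_pos_of_pos hy _).ne'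
  unfold fracIntegrand
  rw [div_eq_mul_inv, enorm_mul, enorm_inv h2, h1, ENNReal.rpow_neg, mul_comm]
  congr 1
  simp only [enorm_eq_nnnorm, nnnorm_prod, ENNReal.ofNNReal_finsetProd]

/-- Slicing into dyadic shells dominates the fractional integral by a sum of products of
averages. -/
theorem lintegral_enorm_fracIntegrand_le {𝕜 : Type*} [RCLike 𝕜] {m : ℕ} {α : ℝ}
    (hα : α < m * n) {f : Fin m → Rn n → 𝕜} (hf : ∀ i, Measurable fun y => ‖f i y‖ₑ)
    {h : ℝ} (hh : 0 < h) (x : Rn n) :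
    ∫⁻ y : Fin m → Rn n, ‖fracIntegrand α f x y‖ₑ ≤ 2 ^ ((m : ℝ) * n - α) *
      ∑' k : ℤ, ENNReal.ofReal (h * 2 ^ k) ^ α * ∏ i, ballMean h k (fun y => ‖f i y‖ₑ) x := by
  have hγ : 0 < (m : ℝ) * n - α := by linarith
  set γ := (m : ℝ) * n - α
  set g : ℤ → Fin m → Rn n → ℝ≥0∞ := fun k i =>
    (Metric.closedBall x (h * 2 ^ k)).indicator fun y => ‖f i y‖ₑ
  have hg : ∀ k i, Measurable (g k i) := fun k i =>
    (hf i).indicator Metric.isClosed_closedBall.measurableSet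
  have hpt : ∀ y : Fin m → Rn n, ‖fracIntegrand α f x y‖ₑ ≤ ∑' k : ℤ,
      2 ^ γ * ENNReal.ofReal (h * 2 ^ k) ^ (-γ) * ∏ i, g k i (y i) := by
    intro y
    have hs0 : 0 ≤ ∑ i, ‖x - y i‖ := Finset.sum_nonneg fun i _ => norm_nonneg _
    rcases hs0.eq_or_lt with hs | hs
    · -- On the diagonal the integrand is a quotient by zero, hence zero.
      have : fracIntegrand α f x y = 0 := by
        unfold fracIntegrand
        rw [← hs, Real.zero_rpow hγ.ne']
        simp
      rw [this]
      simp
    · obtain ⟨k, hk1, hk2⟩ := exists_mem_Ioc_zpow (div_pos hs hh) (one_lt_two (α := ℝ))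
      rw [lt_div_iff₀ hh, mul_comm] at hk1
      rw [div_le_iff₀ hh, mul_comm] at hk2
      refine le_trans ?_ (ENNReal.le_tsum (k + 1))
      rw [enorm_fracIntegrand α f x hs]
      have hball : ∀ i, g (k + 1) i (y i) = ‖f i (y i)‖ₑ := by
        intro i
        refine Set.indicator_of_mem ?_ _
        rw [Metric.mem_closedBall, dist_comm, dist_eq_norm]
        exact (Finset.single_le_sum (f := fun i => ‖x - y i‖) (fun i _ => norm_nonneg _)
          (Finset.mem_univ i)).trans hk2
      simp_rw [hball]
      gcongr
      have h2 : (0 : ℝ) < 2 := two_pos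
      have hsplit : (2 : ℝ≥0∞) ^ γ * ENNReal.ofReal (h * 2 ^ (k + 1)) ^ (-γ) =
          ENNReal.ofReal (h * 2 ^ k) ^ (-γ) := by
        rw [show h * (2 : ℝ) ^ (k + 1) = 2 * (h * 2 ^ k) by rw [zpow_add₀ two_ne_zero]; ring,
          ENNReal.ofReal_mul h2.le, ENNReal.ofReal_ofNat, ENNReal.rpow_neg, ENNReal.rpow_neg,
          ENNReal.mul_rpow_of_nonneg _ _ hγ.le, ENNReal.mul_inv
          (Or.inl (by simp [ENNReal.rpow_eq_zero_iff])) (Or.inl (by simp [ENNReal.rpow_eq_top_iff])),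
          ← mul_assoc, ENNReal.mul_inv_cancel (by simp [ENNReal.rpow_eq_zero_iff])
          (by simp [ENNReal.rpow_eq_top_iff]), one_mul]
      rw [hsplit, ENNReal.rpow_neg, ENNReal.rpow_neg]
      gcongr
  calc ∫⁻ y : Fin m → Rn n, ‖fracIntegrand α f x y‖ₑ
      ≤ ∫⁻ y : Fin m → Rn n, ∑' k : ℤ,
          2 ^ γ * ENNReal.ofReal (h * 2 ^ k) ^ (-γ) * ∏ i, g k i (y i) := lintegral_mono hpt
    _ = ∑' k : ℤ, 2 ^ γ * ENNReal.ofReal (h * 2 ^ k) ^ (-γ) * ∏ i, ∫⁻ y, g k i y := by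
        have hm : ∀ k, Measurable fun y : Fin m → Rn n => ∏ i, g k i (y i) := fun k =>
          Finset.measurable_fun_prod _ fun i _ => (hg k i).comp (measurable_pi_apply i)
        rw [lintegral_tsum fun k => ((hm k).const_mul _).aemeasurable]
        refine tsum_congr fun k => ?_
        rw [lintegral_const_mul _ (hm k)]
        congr 1
        exact lintegral_fin_prod_eq_prod volume (g k) (hg k)
    _ = ∑' k : ℤ, 2 ^ γ * (ENNReal.ofReal (h * 2 ^ k) ^ α *
          ∏ i, ballMean h k (fun y => ‖f i y‖ₑ) x) := by
        refine tsum_congr fun k => ?_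
        have h0 : ENNReal.ofReal (h * 2 ^ k) ≠ 0 := by simpa using side_pos hh k
        have hI : ∀ i, ∫⁻ y, g k i y = ∫⁻ y in Metric.closedBall x (h * 2 ^ k), ‖f i y‖ₑ := fun i =>
          lintegral_indicator Metric.isClosed_closedBall.measurableSet _
        have hγ' : -γ = α + -((n : ℝ) * m) := by simp only [γ]; ring
        simp only [hI, ballMean, div_eq_mul_inv]
        rw [Finset.prod_mul_distrib, Finset.prod_const, Finset.card_univ, Fintype.card_fin,
          ← ENNReal.inv_pow, ← pow_mul, hγ', ENNReal.rpow_add _ _ h0 ENNReal.ofReal_ne_top,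
          ENNReal.rpow_neg, ← Nat.cast_mul, ENNReal.rpow_natCast]
        ring
    _ = _ := by rw [ENNReal.tsum_mul_left]

/-- The Morrey estimate for the integral of the absolute value of the integrand. -/
theorem exists_morrey_lintegral_enorm_le {𝕜 : Type*} [RCLike 𝕜] {m : ℕ} {P : Fin m → ℝ}
    {p p₀ α β θ q q₀ r : ℝ} (hP : ∀ i, 1 < P i) (hp : 1 / p = ∑ i, 1 / P i) (hp1 : 1 < p)
    (hpp₀ : p ≤ p₀) (hp₀ : p₀ < n / α) (hβ : 0 < β) (hβα : β ≤ α) (hα : α < m * n)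
    (hθ : θ = (n - β * p₀) / (n - α * p₀)) (hq : q = θ * p) (hq₀ : q₀ = θ * p₀) (hr : 1 < r) :
    ∃ C : ℝ≥0∞, C ≠ ∞ ∧ ∀ (w : Rn n → ℝ≥0∞) (_ : Measurable w) (A : ℝ≥0∞)
      (_ : ∀ (a : Rn n) (ℓ : ℝ), 0 < ℓ → ENNReal.ofReal ℓ ^ β *
        ((∫⁻ x in cube a ℓ, w x ^ r) / volume (cube a ℓ)) ^ (1 / (r * p)) ≤ A)
      (f : Fin m → Rn n → 𝕜) (_ : ∀ i, Measurable fun y => ‖f i y‖ₑ) (M : ℝ≥0∞) (_ : M ≠ ∞)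
      (_ : ∀ (a : Rn n) (ℓ : ℝ), 0 < ℓ → volume (cube a ℓ) ^ (1 / p₀) *
        ∏ i, ((∫⁻ y in cube a ℓ, ‖f i y‖ₑ ^ P i) / volume (cube a ℓ)) ^ (1 / P i) ≤ M)
      (a : Rn n) (h : ℝ), 0 < h →
      volume (cube a h) ^ (1 / q₀ - 1 / q) *
        (∫⁻ x in cube a h, (∫⁻ y : Fin m → Rn n, ‖fracIntegrand α f x y‖ₑ) ^ q * w x) ^ (1 / q) ≤
        C * (A ^ (1 / θ) * M) := by
  have hp0 : 0 < p := by linarith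
  have hp₀0 : 0 < p₀ := by linarith
  have hα0 : 0 < α := by linarith
  have hαp₀ : α * p₀ < n := by rw [lt_div_iff₀ hα0] at hp₀; linarith
  have hαν : α < n / p₀ := by rwa [lt_div_iff₀ hp₀0]
  have hβν : β < n / p₀ := hβα.trans_lt hαν
  have hβp₀ : β * p₀ < n := lt_of_le_of_lt (by gcongr) hαp₀
  have hθ0 : 0 < θ := by rw [hθ]; exact div_pos (by linarith) (by linarith)
  have hθ1 : 1 ≤ θ := by
    rw [hθ, one_le_div (by linarith)]
    have := mul_le_mul_of_nonneg_right hβα hp₀0.le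
    linarith
  have hθi : (n / p₀ - α) / (n / p₀ - β) = 1 / θ := by
    have h1 : (n : ℝ) - β * p₀ ≠ 0 := by linarith
    have h2 : (n : ℝ) - α * p₀ ≠ 0 := by linarith
    have h3 : (n : ℝ) / p₀ - β ≠ 0 := by linarith
    rw [hθ, one_div_div, div_eq_div_iff h3 h1]
    field_simp
  have hq0 : 0 < q := by rw [hq]; positivity
  obtain ⟨C₁, hC₁, H₁⟩ := exists_tsum_le_hedberg hβα hαν
  obtain ⟨C₂, hC₂, H₂⟩ :=
    exists_setLIntegral_tsum_ballMean_rpow_le (n := n) hP hp1 hp hpp₀ hr hβ hβν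
  rw [hθi] at H₁
  set D : ℝ≥0∞ := ENNReal.ofReal 3 ^ (n * m)
  have hD : D ≠ ∞ := by simp [D]
  set E : ℝ≥0∞ := 2 ^ ((m : ℝ) * n - α)
  have hE : E ≠ ∞ := ENNReal.rpow_ne_top_of_nonneg (by linarith) (by simp)
  have hθ' : 0 ≤ 1 - 1 / θ := by rw [sub_nonneg, div_le_one hθ0]; exact hθ1
  have hpq : 1 / θ * q = p := by rw [hq]; field_simp
  refine ⟨E * C₁ * D ^ (1 - 1 / θ) * C₂ ^ (1 / q), ?_, ?_⟩
  · exact ENNReal.mul_ne_top (ENNReal.mul_ne_top (ENNReal.mul_ne_top hE hC₁)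
      (ENNReal.rpow_ne_top_of_nonneg hθ' hD)) (ENNReal.rpow_ne_top_of_nonneg (by positivity) hC₂)
  intro w hw A hA f hf M hMt hM a h hh
  have hQm : MeasurableSet (cube a h) := measurableSet_cube a h
  have hV0 : volume (cube a h) ≠ 0 := volume_cube_ne_zero a hh
  have hVt : volume (cube a h) ≠ ∞ := volume_cube_ne_top a h
  set V := volume (cube a h)
  set S : Rn n → ℝ≥0∞ := fun x =>
    ∑' k : ℤ, ENNReal.ofReal (h * 2 ^ k) ^ β * ∏ i, ballMean h k (fun y => ‖f i y‖ₑ) x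
  set B : ℝ≥0∞ := E * C₁ * D ^ (1 - 1 / θ) * M ^ (1 - 1 / θ)
  have hB : B ≠ ∞ := ENNReal.mul_ne_top (ENNReal.mul_ne_top (ENNReal.mul_ne_top hE hC₁)
      (ENNReal.rpow_ne_top_of_nonneg hθ' hD)) (ENNReal.rpow_ne_top_of_nonneg hθ' hMt)
  have hpt : ∀ x, (∫⁻ y : Fin m → Rn n, ‖fracIntegrand α f x y‖ₑ) ^ q * w x ≤
      B ^ q * (S x ^ p * w x) := by
    intro x
    have h1 : ∫⁻ y : Fin m → Rn n, ‖fracIntegrand α f x y‖ₑ ≤ B * S x ^ (1 / θ) := by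
      refine (lintegral_enorm_fracIntegrand_le hα hf hh x).trans ?_
      refine (mul_le_mul' le_rfl (H₁ h hh (D * M) (ENNReal.mul_ne_top hD hMt) _
        fun k => prod_ballMean_le hP hp₀0 hf hM hh k x)).trans_eq ?_
      rw [ENNReal.mul_rpow_of_nonneg _ _ hθ']
      simp only [B, S]
      ring
    calc _ ≤ (B * S x ^ (1 / θ)) ^ q * w x := by gcongr
      _ = _ := by
        rw [ENNReal.mul_rpow_of_nonneg _ _ hq0.le, ← ENNReal.rpow_mul, hpq, mul_assoc]
  have hint : (∫⁻ x in cube a h, (∫⁻ y : Fin m → Rn n, ‖fracIntegrand α f x y‖ₑ) ^ q * w x) ^ (1 / q)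
      ≤ B * (C₂ ^ (1 / q) * (A ^ (1 / θ) * M ^ (1 / θ) * V ^ (1 / q - 1 / q₀))) := by
    calc _ ≤ (B ^ q * (C₂ * (A ^ p * M ^ p * V ^ (1 - p / p₀)))) ^ (1 / q) := by
          gcongr
          refine (lintegral_mono hpt).trans ?_
          rw [lintegral_const_mul' _ _ (ENNReal.rpow_ne_top_of_nonneg hq0.le hB)]
          exact mul_le_mul' le_rfl (H₂ w hw A hA _ hf M hM a h hh)
      _ = _ := by
          have e1 : p * (1 / q) = 1 / θ := by rw [hq]; field_simp
          have e2 : (1 - p / p₀) * (1 / q) = 1 / q - 1 / q₀ := by rw [hq, hq₀]; field_simp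
          simp only [ENNReal.mul_rpow_of_nonneg _ _ (by positivity : 0 ≤ 1 / q),
            ← ENNReal.rpow_mul, e1, e2, mul_one_div_cancel hq0.ne', ENNReal.rpow_one]
  have hVV : V ^ (1 / q₀ - 1 / q) * V ^ (1 / q - 1 / q₀) = 1 := by
    rw [← ENNReal.rpow_add _ _ hV0 hVt]
    simp
  have hMM : M ^ (1 - 1 / θ) * M ^ (1 / θ) = M := by
    rw [← ENNReal.rpow_add_of_nonneg _ _ hθ' (by positivity)]
    simp
  calc _ ≤ V ^ (1 / q₀ - 1 / q) *
        (B * (C₂ ^ (1 / q) * (A ^ (1 / θ) * M ^ (1 / θ) * V ^ (1 / q - 1 / q₀)))) := by gcongr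
    _ = E * C₁ * D ^ (1 - 1 / θ) * C₂ ^ (1 / q) * (A ^ (1 / θ) * (M ^ (1 - 1 / θ) * M ^ (1 / θ))) *
          (V ^ (1 / q₀ - 1 / q) * V ^ (1 / q - 1 / q₀)) := by simp only [B]; ring
    _ = _ := by rw [hVV, hMM, mul_one]

/-! ### The bound under a power bump -/

theorem measurable_fracIntegrand {𝕜 : Type*} [RCLike 𝕜] {m : ℕ} (α : ℝ) {f : Fin m → Rn n → 𝕜}
    (hf : ∀ i, Measurable (f i)) :
    Measurable fun z : Rn n × (Fin m → Rn n) => fracIntegrand α f z.1 z.2 := by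
  unfold fracIntegrand
  refine Measurable.div ?_ ?_
  · exact Finset.measurable_fun_prod _ fun i _ => (hf i).comp (by fun_prop)
  · refine RCLike.measurable_ofReal.comp ?_
    fun_prop

theorem fracIntegrand_ae_eq {𝕜 : Type*} [RCLike 𝕜] {m : ℕ} (α : ℝ) {f g : Fin m → Rn n → 𝕜}
    (hfg : ∀ i, f i =ᵐ[volume] g i) (x : Rn n) :
    fracIntegrand α f x =ᵐ[volume] fracIntegrand α g x := by
  have h1 : ∀ i, ∀ᵐ y : Fin m → Rn n, f i (y i) = g i (y i) := fun i =>
    (Measure.quasiMeasurePreserving_eval (μ := fun _ : Fin m => (volume : Measure (Rn n))) i).ae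
      (hfg i)
  filter_upwards [ae_all_iff.2 h1] with y hy
  simp only [fracIntegrand, hy]

theorem ae_of_forall_cube {μ : Measure (Rn n)} {Q : Rn n → Prop}
    (H : ∀ (a : Rn n) (ℓ : ℝ), 0 < ℓ → ∀ᵐ x ∂(μ.restrict (cube a ℓ)), Q x) : ∀ᵐ x ∂μ, Q x := by
  let s : ℕ → Set (Rn n) := fun N => cube (WithLp.toLp 2 fun _ => -((N : ℝ) + 1)) (2 * ((N : ℝ) + 1))
  have hs : ⋃ N, s N = Set.univ := by
    refine Set.eq_univ_of_forall fun x => ?_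
    obtain ⟨N, hN⟩ := exists_nat_gt ‖x‖
    refine Set.mem_iUnion.2 ⟨N, fun i => ?_⟩
    have h1 : |x i| ≤ ‖x‖ := by simpa using PiLp.norm_apply_le x i
    have := abs_le.1 h1
    simp only
    constructor <;> linarith
  rw [← Measure.restrict_univ (μ := μ), ← hs, ae_restrict_iUnion_iff]
  exact fun N => H _ _ (by positivity)

/-- The conclusions for weights satisfying the power-bumped condition, with a constant that
depends only on the parameters. -/
theorem exists_fracIntegral_bound_of_bump {𝕜 : Type*} [RCLike 𝕜] {m : ℕ} {P : Fin m → ℝ}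
    {p p₀ α β θ q q₀ r : ℝ} (hP : ∀ i, 1 < P i) (hp : 1 / p = ∑ i, 1 / P i) (hp1 : 1 < p)
    (hpp₀ : p ≤ p₀) (hp₀ : p₀ < n / α) (hβ : 0 < β) (hβα : β ≤ α) (hα : α < m * n)
    (hθ : θ = (n - β * p₀) / (n - α * p₀)) (hq : q = θ * p) (hq₀ : q₀ = θ * p₀) (hr : 1 < r) :
    ∃ C : ℝ≥0, ∀ w : Rn n → ℝ, IsWeight w → olsenPowerConst r β p w < ∞ →
      ∀ f : Fin m → Rn n → 𝕜, (∀ i, LocallyIntegrable (f i) volume) →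
        productMorreyNorm P p₀ f < ∞ →
        (∀ᵐ x ∂(weightMeasure w), Integrable (fracIntegrand α f x)) ∧
        AEStronglyMeasurable (fracIntegral α f) (weightMeasure w) ∧
        radonMorreyNorm (weightMeasure w) q q₀ (fracIntegral α f) ≤
          C * olsenPowerConst r β p w ^ (1 / θ) * productMorreyNorm P p₀ f := by
  obtain ⟨C, hC, H⟩ := exists_morrey_lintegral_enorm_le (𝕜 := 𝕜) hP hp hp1 hpp₀ hp₀ hβ hβα hα hθ hq
    hq₀ hr
  have hθ0 : 0 < θ := by
    have hα0 : 0 < α := by linarith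
    rw [lt_div_iff₀ hα0] at hp₀
    have := mul_le_mul_of_nonneg_right hβα (by linarith : 0 ≤ p₀)
    rw [hθ]; exact div_pos (by linarith) (by linarith)
  have hq0 : 0 < q := by rw [hq]; positivity
  lift C to ℝ≥0 using hC
  refine ⟨C, fun w hw hA f hf hM => ?_⟩
  set A := olsenPowerConst r β p w
  set M := productMorreyNorm P p₀ f
  have hwm : AEMeasurable (fun x => ENNReal.ofReal (w x)) volume :=
    hw.locallyIntegrable.aestronglyMeasurable.aemeasurable.ennreal_ofReal
  set w' := hwm.mk
  have hw'm : Measurable w' := hwm.measurable_mk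
  have hww' : (fun x => ENNReal.ofReal (w x)) =ᵐ[volume] w' := hwm.ae_eq_mk
  have hμ : weightMeasure w = volume.withDensity w' := withDensity_congr_ae hww'
  have hfm : ∀ i, AEStronglyMeasurable (f i) volume := fun i => (hf i).aestronglyMeasurable
  set f' : Fin m → Rn n → 𝕜 := fun i => (hfm i).mk
  have hf'm : ∀ i, Measurable (f' i) := fun i => (hfm i).stronglyMeasurable_mk.measurable
  have hff' : ∀ i, f i =ᵐ[volume] f' i := fun i => (hfm i).ae_eq_mk
  have hF : ∀ x, fracIntegrand α f x =ᵐ[volume] fracIntegrand α f' x := fracIntegrand_ae_eq α hff'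
  have hI : fracIntegral α f = fracIntegral α f' := funext fun x => integral_congr_ae (hF x)
  have hjoint := measurable_fracIntegrand α hf'm
  set X : Rn n → ℝ≥0∞ := fun x => ∫⁻ y : Fin m → Rn n, ‖fracIntegrand α f' x y‖ₑ
  have hXm : Measurable X := hjoint.enorm.lintegral_prod_right'
  have hbound := H w' hw'm A (fun a ℓ hℓ => by
      have : ∫⁻ x in cube a ℓ, w' x ^ r = ∫⁻ x in cube a ℓ, ENNReal.ofReal (w x) ^ r :=
        lintegral_congr_ae (ae_restrict_of_ae (hww'.mono fun x hx => by
          simp only at hx ⊢; rw [hx]))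
      rw [this]
      exact le_iSup_of_le a (le_iSup_of_le ℓ (le_iSup_of_le hℓ le_rfl)))
    f' (fun i => (hf'm i).enorm) M hM.ne (fun a ℓ hℓ => by
      have : ∀ i, ∫⁻ y in cube a ℓ, ‖f' i y‖ₑ ^ P i = ∫⁻ y in cube a ℓ, ‖f i y‖ₑ ^ P i := fun i =>
        lintegral_congr_ae (ae_restrict_of_ae ((hff' i).mono fun x hx => by simp only [hx]))
      simp_rw [this]
      exact le_iSup_of_le a (le_iSup_of_le ℓ (le_iSup_of_le hℓ le_rfl)))
  have hwd : ∀ (a : Rn n) (ℓ : ℝ), ∫⁻ x in cube a ℓ, X x ^ q ∂(weightMeasure w) =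
      ∫⁻ x in cube a ℓ, X x ^ q * w' x := by
    intro a ℓ
    rw [hμ, setLIntegral_withDensity_eq_setLIntegral_mul _ hw'm (hXm.pow_const _)
      (measurableSet_cube a ℓ)]
    refine lintegral_congr fun x => ?_
    rw [Pi.mul_apply, mul_comm]
  have hfin : (C : ℝ≥0∞) * (A ^ (1 / θ) * M) ≠ ∞ :=
    ENNReal.mul_ne_top ENNReal.coe_ne_top (ENNReal.mul_ne_top
      (ENNReal.rpow_ne_top_of_nonneg (by positivity) hA.ne) hM.ne)
  have hXfin : ∀ᵐ x ∂(weightMeasure w), X x < ∞ := by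
    refine ae_of_forall_cube fun a ℓ hℓ => ?_
    have h1 : ∫⁻ x in cube a ℓ, X x ^ q ∂(weightMeasure w) ≠ ∞ := by
      intro hc
      have h2 := hbound a ℓ hℓ
      rw [← hwd, hc, ENNReal.top_rpow_of_pos (by positivity), ENNReal.mul_top] at h2
      · exact hfin (top_le_iff.1 h2)
      · simp [ENNReal.rpow_eq_zero_iff, volume_cube_ne_zero a hℓ, volume_cube_ne_top a ℓ]
    filter_upwards [ae_lt_top (hXm.pow_const q) h1] with x hx
    rw [lt_top_iff_ne_top] at hx ⊢
    exact fun hc => hx (by rw [hc, ENNReal.top_rpow_of_pos hq0])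
  refine ⟨?_, ?_, ?_⟩
  · filter_upwards [hXfin] with x hx
    refine Integrable.congr ⟨?_, hx⟩ (hF x).symm
    exact (hjoint.comp measurable_prodMk_left).aestronglyMeasurable
  · rw [hI]
    exact hjoint.stronglyMeasurable.integral_prod_right'.aestronglyMeasurable
  · refine iSup_le fun a => iSup_le fun ℓ => iSup_le fun hℓ => ?_
    rw [mul_assoc, hI]
    refine le_trans ?_ (hbound a ℓ hℓ)
    rw [← hwd]
    gcongr with x
    exact enorm_integral_le_lintegral_enorm _

/-! ### The reverse Hölder inequality for `A_∞` weights -/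

/-- The `A_∞` condition is a reverse Hölder inequality between the exponents `1 / 2` and `1`. By
Hölder's inequality the negative power in `[w]_{A_s}` dominates `(avg w ^ (1 / 2)) ^ (-2)`
for every `s`, which makes the constant independent of `s`. -/
theorem average_le_of_aInftyConst_le {w : Rn n → ℝ} (hw : Measurable w) {K : ℝ≥0}
    (hK : aInftyConst w ≤ K) (a : Rn n) {ℓ : ℝ} (hℓ : 0 < ℓ) :
    (∫⁻ x in cube a ℓ, ENNReal.ofReal (w x)) / volume (cube a ℓ) ≤ (K + 1) *
      ((∫⁻ x in cube a ℓ, ENNReal.ofReal (w x) ^ (1 / 2 : ℝ)) / volume (cube a ℓ)) ^ (2 : ℝ) := by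
  set Q := cube a ℓ
  have hQm : MeasurableSet Q := measurableSet_cube a ℓ
  have hV0 : volume Q ≠ 0 := volume_cube_ne_zero a hℓ
  have hVt : volume Q ≠ ∞ := volume_cube_ne_top a ℓ
  have hWm : Measurable fun x => ENNReal.ofReal (w x) := hw.ennreal_ofReal
  have hlt : aInftyConst w < K + 1 :=
    hK.trans_lt (ENNReal.lt_add_right ENNReal.coe_ne_top one_ne_zero)
  obtain ⟨s, hs, hs1⟩ := ((eventually_lt_of_limsup_lt hlt).and (eventually_gt_atTop (1 : ℝ))).exists
  have hs0 : 0 < s - 1 := by linarith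
  set U := (∫⁻ x in Q, ENNReal.ofReal (w x)) / volume Q
  set B := (∫⁻ x in Q, ENNReal.ofReal (w x) ^ (-(1 / (s - 1)))) / volume Q
  set G := (∫⁻ x in Q, ENNReal.ofReal (w x) ^ (1 / 2 : ℝ)) / volume Q
  have hUB : U * B ^ (s - 1) ≤ K + 1 :=
    (le_iSup_of_le a (le_iSup_of_le ℓ (le_iSup_of_le hℓ
      (le_refl (U * B ^ (s - 1)))))).trans hs.le
  rcases eq_or_ne U 0 with hU | hU
  · rw [hU]; exact zero_le
  have hBt : B ≠ ∞ := by
    intro hB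
    rw [hB, ENNReal.top_rpow_of_pos hs0, ENNReal.mul_top hU] at hUB
    exact absurd (top_le_iff.1 hUB) (by simp)
  have hpos : ∀ᵐ x ∂(volume.restrict Q), ENNReal.ofReal (w x) ≠ 0 := by
    have h1 : ∫⁻ x in Q, ENNReal.ofReal (w x) ^ (-(1 / (s - 1))) ≠ ∞ := by
      intro hc
      refine hBt ?_
      simp only [B]
      rw [hc, ENNReal.top_div_of_ne_top hVt]
    filter_upwards [ae_lt_top (hWm.pow_const _) h1] with x hx hx0
    rw [hx0, ENNReal.zero_rpow_of_neg (by simpa using hs0)] at hx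
    exact lt_irrefl _ hx
  have hone : 1 ≤ B ^ ((s - 1) / (s + 1)) * G ^ (2 / (s + 1)) := by
    have h2 : ∫⁻ x in Q, (ENNReal.ofReal (w x) ^ (-(1 / (s - 1)))) ^ ((s - 1) / (s + 1)) *
        (ENNReal.ofReal (w x) ^ (1 / 2 : ℝ)) ^ (2 / (s + 1)) = volume Q := by
      rw [← setLIntegral_one]
      refine lintegral_congr_ae (hpos.mono fun x hx => ?_)
      simp only
      rw [← ENNReal.rpow_mul, ← ENNReal.rpow_mul, ← ENNReal.rpow_add _ _ hx ENNReal.ofReal_ne_top]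
      have : -(1 / (s - 1)) * ((s - 1) / (s + 1)) + 1 / 2 * (2 / (s + 1)) = 0 := by
        field_simp
        ring
      rw [this, ENNReal.rpow_zero]
    have h3 := ENNReal.lintegral_mul_norm_pow_le (μ := volume.restrict Q)
      (hWm.pow_const (-(1 / (s - 1)))).aemeasurable (hWm.pow_const (1 / 2 : ℝ)).aemeasurable
      (p := (s - 1) / (s + 1)) (q := 2 / (s + 1)) (by positivity) (by positivity)
      (by field_simp; ring)
    rw [h2] at h3
    simp only [B, G]
    generalize (∫⁻ x in Q, ENNReal.ofReal (w x) ^ (-(1 / (s - 1)))) = X₁ at h3 ⊢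
    generalize (∫⁻ x in Q, ENNReal.ofReal (w x) ^ (1 / 2 : ℝ)) = X₂ at h3 ⊢
    rw [ENNReal.div_rpow_of_nonneg _ _ (by positivity), ENNReal.div_rpow_of_nonneg _ _ (by positivity),
      div_eq_mul_inv (X₁ ^ _), div_eq_mul_inv (X₂ ^ _), mul_mul_mul_comm, ← ENNReal.mul_inv
      (Or.inr (ENNReal.rpow_ne_top_of_nonneg (by positivity) hVt))
      (Or.inl (ENNReal.rpow_ne_top_of_nonneg (by positivity) hVt)),
      ← ENNReal.rpow_add _ _ hV0 hVt, show (s - 1) / (s + 1) + 2 / (s + 1) = 1 by field_simp; ring,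
      ENNReal.rpow_one, ← div_eq_mul_inv, ENNReal.le_div_iff_mul_le (Or.inl hV0) (Or.inl hVt),
      one_mul]
    exact h3
  have hone' : 1 ≤ B ^ (s - 1) * G ^ (2 : ℝ) := by
    have h4 := ENNReal.rpow_le_rpow hone (by linarith : 0 ≤ s + 1)
    rw [ENNReal.one_rpow, ENNReal.mul_rpow_of_nonneg _ _ (by linarith), ← ENNReal.rpow_mul,
      ← ENNReal.rpow_mul, div_mul_cancel₀ _ (by linarith), div_mul_cancel₀ _ (by linarith)] at h4
    exact h4
  calc U = U * 1 := (mul_one U).symm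
    _ ≤ U * (B ^ (s - 1) * G ^ (2 : ℝ)) := by gcongr
    _ = U * B ^ (s - 1) * G ^ (2 : ℝ) := by ring
    _ ≤ _ := by gcongr

/-- A Paley–Zygmund argument: an `A_∞` weight is comparable to its mean on a fixed proportion of
every cube. -/
theorem volume_le_of_average_le {W : Rn n → ℝ≥0∞} (hW : Measurable W) {Q : Set (Rn n)}
    (hQm : MeasurableSet Q) (hV0 : volume Q ≠ 0) (hVt : volume Q ≠ ∞)
    (hfin : ∫⁻ x in Q, W x ≠ ∞) {B : ℝ≥0∞}
    (hB : (∫⁻ x in Q, W x) / volume Q ≤ B *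
      ((∫⁻ x in Q, W x ^ (1 / 2 : ℝ)) / volume Q) ^ (2 : ℝ))
    {t : ℝ≥0∞} (ht : t < (∫⁻ x in Q, W x) / volume Q) :
    volume Q ≤ 4 * B * volume (Q ∩ {x | t < 4 * B * W x}) := by
  set V := volume Q
  set I := ∫⁻ x in Q, W x ^ (1 / 2 : ℝ)
  set J := ∫⁻ x in Q, W x
  have hsq : ∀ x, (W x ^ (1 / 2 : ℝ)) ^ (2 : ℝ) = W x := fun x => by
    rw [← ENNReal.rpow_mul]; norm_num
  have hI0 : I ≠ 0 := by
    intro h0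
    rw [h0, ENNReal.zero_div, ENNReal.zero_rpow_of_pos two_pos, mul_zero] at hB
    exact absurd (ht.trans_le hB) (by simp)
  have hIt : I ≠ ∞ := by
    have h1 := ENNReal.lintegral_mul_norm_pow_le (μ := volume.restrict Q) hW.aemeasurable
      (aemeasurable_const (b := (1 : ℝ≥0∞))) (p := 1 / 2) (q := 1 / 2) (by norm_num) (by norm_num)
      (by norm_num)
    simp only [ENNReal.one_rpow, mul_one, setLIntegral_one] at h1
    exact ne_top_of_le_ne_top (ENNReal.mul_ne_top
      (ENNReal.rpow_ne_top_of_nonneg (by norm_num) hfin)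
      (ENNReal.rpow_ne_top_of_nonneg (by norm_num) hVt)) h1
  set S : Set (Rn n) := {x | I / V / 2 < W x ^ (1 / 2 : ℝ)}
  have hSm : MeasurableSet S := measurableSet_lt measurable_const (hW.pow_const _)
  have hS : S ⊆ {x | t < 4 * B * W x} := by
    intro x hx
    have hx' : I / V / 2 < W x ^ (1 / 2 : ℝ) := hx
    refine ht.trans_le (hB.trans ?_)
    have h2 : I / V ≤ 2 * W x ^ (1 / 2 : ℝ) := by
      rw [mul_comm, ← ENNReal.div_le_iff two_ne_zero (by simp)]
      exact hx'.le
    calc B * (I / V) ^ (2 : ℝ) ≤ B * (2 * W x ^ (1 / 2 : ℝ)) ^ (2 : ℝ) := by gcongr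
      _ = 4 * B * W x := by
        rw [ENNReal.mul_rpow_of_nonneg _ _ two_pos.le, hsq,
          show (2 : ℝ≥0∞) ^ (2 : ℝ) = 4 by rw [ENNReal.rpow_two]; norm_num]
        ring
  have hhalf : I / 2 ≤ ∫⁻ x in Q ∩ S, W x ^ (1 / 2 : ℝ) := by
    have h1 : I ≤ (∫⁻ x in Q ∩ S, W x ^ (1 / 2 : ℝ)) + I / 2 := by
      calc I = (∫⁻ x in Q ∩ S, W x ^ (1 / 2 : ℝ)) + ∫⁻ x in Q \ S, W x ^ (1 / 2 : ℝ) :=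
            (lintegral_inter_add_sdiff _ Q hSm).symm
        _ ≤ (∫⁻ x in Q ∩ S, W x ^ (1 / 2 : ℝ)) + ∫⁻ x in Q \ S, I / V / 2 := by
            refine add_le_add le_rfl ?_
            exact setLIntegral_mono' (hQm.diff hSm) fun x hx => not_lt.1 hx.2
        _ ≤ (∫⁻ x in Q ∩ S, W x ^ (1 / 2 : ℝ)) + I / V / 2 * V := by
            rw [setLIntegral_const]
            gcongr
            exact measure_mono Set.sdiff_subset
        _ = _ := by
            congr 1
            rw [div_eq_mul_inv (I / V), mul_right_comm, ENNReal.div_mul_cancel hV0 hVt,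
              ← div_eq_mul_inv]
    nth_rewrite 1 [← ENNReal.add_halves I] at h1
    exact (ENNReal.add_le_add_iff_right (ENNReal.div_ne_top hIt two_ne_zero)).1 h1
  have hcs : ∫⁻ x in Q ∩ S, W x ^ (1 / 2 : ℝ) ≤
      J ^ (1 / 2 : ℝ) * volume (Q ∩ S) ^ (1 / 2 : ℝ) := by
    have h1 := ENNReal.lintegral_mul_norm_pow_le (μ := volume.restrict (Q ∩ S)) hW.aemeasurable
      (aemeasurable_const (b := (1 : ℝ≥0∞))) (p := 1 / 2) (q := 1 / 2) (by norm_num) (by norm_num)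
      (by norm_num)
    simp only [ENNReal.one_rpow, mul_one, setLIntegral_one] at h1
    refine h1.trans ?_
    gcongr
    exact lintegral_mono_set Set.inter_subset_left
  have hfinal : I ^ (2 : ℝ) ≤ I ^ (2 : ℝ) * (4 * B * volume (Q ∩ S) / V) := by
    have h1 : I ≤ 2 * (J ^ (1 / 2 : ℝ) * volume (Q ∩ S) ^ (1 / 2 : ℝ)) := by
      rw [mul_comm, ← ENNReal.div_le_iff two_ne_zero (by simp)]
      exact hhalf.trans hcs
    have hJ : J ≤ B * (I / V) ^ (2 : ℝ) * V := by
      rwa [← ENNReal.div_le_iff hV0 hVt]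
    calc I ^ (2 : ℝ) ≤ (2 * (J ^ (1 / 2 : ℝ) * volume (Q ∩ S) ^ (1 / 2 : ℝ))) ^ (2 : ℝ) := by gcongr
      _ = 4 * (J * volume (Q ∩ S)) := by
        rw [ENNReal.mul_rpow_of_nonneg _ _ two_pos.le, ENNReal.mul_rpow_of_nonneg _ _ two_pos.le,
          ← ENNReal.rpow_mul, ← ENNReal.rpow_mul,
          show (2 : ℝ≥0∞) ^ (2 : ℝ) = 4 by rw [ENNReal.rpow_two]; norm_num]
        norm_num
      _ ≤ 4 * (B * (I / V) ^ (2 : ℝ) * V * volume (Q ∩ S)) := by gcongr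
      _ = I ^ (2 : ℝ) * (4 * B * volume (Q ∩ S) * ((V⁻¹ * V) * V⁻¹)) := by
        rw [ENNReal.rpow_two, ENNReal.rpow_two, div_eq_mul_inv]
        ring
      _ = _ := by
        rw [ENNReal.inv_mul_cancel hV0 hVt, one_mul, ← div_eq_mul_inv]
  have hI20 : I ^ (2 : ℝ) ≠ 0 := by simp [hI0]
  have hI2t : I ^ (2 : ℝ) ≠ ∞ := ENNReal.rpow_ne_top_of_nonneg two_pos.le hIt
  have hge : 1 ≤ 4 * B * volume (Q ∩ S) / V := by
    nth_rewrite 1 [← mul_one (I ^ (2 : ℝ))] at hfinal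
    exact (ENNReal.mul_le_mul_iff_right hI20 hI2t).1 hfinal
  rw [ENNReal.le_div_iff_mul_le (Or.inl hV0) (Or.inl hVt), one_mul] at hge
  refine hge.trans ?_
  gcongr

theorem norm_le_mul_of_forall_coord {v : Rn n} {s : ℝ} (hs : 0 ≤ s) (hv : ∀ i, |v i| ≤ s) :
    ‖v‖ ≤ n * s := by
  have h1 : ‖v‖ ^ 2 ≤ n * s ^ 2 := by
    rw [EuclideanSpace.norm_sq_eq]
    calc ∑ i, ‖v i‖ ^ 2 ≤ ∑ _i : Fin n, s ^ 2 := by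
          refine Finset.sum_le_sum fun i _ => ?_
          have := hv i
          rw [Real.norm_eq_abs]
          gcongr
      _ = n * s ^ 2 := by simp
  have h2 : (n : ℝ) ≤ (n : ℝ) ^ 2 := by
    rcases Nat.eq_zero_or_pos n with rfl | hn
    · simp
    · have : (1 : ℝ) ≤ n := by exact_mod_cast hn
      nlinarith
  refine le_of_sq_le_sq ?_ (by positivity)
  nlinarith [sq_nonneg s]

theorem exists_gridCube_subset (a : Rn n) {h : ℝ} (hh : 0 < h) {U : Set (Rn n)} (hU : IsOpen U)
    {x : Rn n} (hx : x ∈ U) : ∃ k ≤ (0 : ℤ), gridCube a h k x ⊆ U := by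
  obtain ⟨ε, hε, hball⟩ := Metric.isOpen_iff.1 hU x hx
  obtain ⟨N, hN⟩ := exists_pow_lt_of_lt_one (show 0 < ε / ((n + 1) * h) by positivity)
    (show (1 / 2 : ℝ) < 1 by norm_num)
  rw [lt_div_iff₀ (by positivity)] at hN
  refine ⟨-(N : ℤ), by omega, fun y hy => hball ?_⟩
  have hs := side_pos hh (-(N : ℤ))
  have e : h * (2 : ℝ) ^ (-(N : ℤ)) = (1 / 2) ^ N * h := by
    rw [zpow_neg, zpow_natCast, one_div, inv_pow, mul_comm]
  rw [Metric.mem_ball, dist_eq_norm]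
  have hcoord : ∀ i, |(y - x) i| ≤ h * 2 ^ (-(N : ℤ)) := by
    intro i
    have h1 := Int.abs_sub_lt_one_of_floor_eq_floor (congrFun hy i)
    rw [← sub_div, sub_sub_sub_cancel_right, abs_div, abs_of_pos hs, div_lt_one hs] at h1
    simpa using h1.le
  calc ‖y - x‖ ≤ n * (h * 2 ^ (-(N : ℤ))) := norm_le_mul_of_forall_coord hs.le hcoord
    _ < ε := by
      rw [e]
      nlinarith [show 0 < (1 / 2 : ℝ) ^ N * h by positivity]

/-- The dyadic form of Lebesgue's differentiation theorem that is needed here: where all averages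
over small cubes are at most `t`, so is the function. -/
theorem ae_le_of_forall_gridAvg_le (a : Rn n) {h : ℝ} (hh : 0 < h) {F : Rn n → ℝ≥0∞}
    (hF : Measurable F) {s : Set (Rn n)} (hsm : MeasurableSet s)
    (hs : volume s ≠ ∞) {t : ℝ≥0∞} (ht : t ≠ ∞) :
    volume {x | x ∈ s ∧ t < F x ∧ ∀ k ≤ (0 : ℤ), gridAvg a h k F x ≤ t} = 0 := by
  set Z := {x | x ∈ s ∧ t < F x ∧ ∀ k ≤ (0 : ℤ), gridAvg a h k F x ≤ t}
  have hZm : MeasurableSet Z := by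
    have : Z = s ∩ ({x | t < F x} ∩ ⋂ k : ℤ, ⋂ _ : k ≤ 0, {x | gridAvg a h k F x ≤ t}) := by
      ext x
      simp only [Z, Set.mem_inter_iff, Set.mem_iInter, Set.mem_ofPred_eq]
    rw [this]
    exact hsm.inter ((measurableSet_lt measurable_const hF).inter (MeasurableSet.iInter fun k =>
      MeasurableSet.iInter fun _ =>
        measurableSet_le (measurable_gridAvg a h k F) measurable_const))
  have hZfin : volume Z ≠ ∞ := ne_top_of_le_ne_top hs (measure_mono fun x hx => hx.1)
  have hle : ∫⁻ x in Z, F x ≤ t * volume Z := by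
    refine ENNReal.le_of_forall_pos_le_add fun ε hε _ => ?_
    have hε' : (ε : ℝ≥0∞) / (t + 1) ≠ 0 := by
      simp [hε.ne', ht]
    obtain ⟨U, hZU, hU, hUlt⟩ := Z.exists_isOpen_lt_add hZfin hε'
    have key := measure_le_of_maximal_gridCubes a h 0
      (Q := fun k x => gridCube a h k x ⊆ U ∧ ∃ z ∈ gridCube a h k x, z ∈ Z)
      (fun k x y hy hx => by rwa [gridCube_congr le_rfl hy])
      (volume.withDensity F) (t • volume) (fun k hk x hx _ => by
        obtain ⟨-, z, hz, hzZ⟩ := hx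
        rw [withDensity_apply _ (measurableSet_gridCube a h k x), setLIntegral_gridCube a hh,
          Measure.smul_apply, smul_eq_mul, mul_comm, ← gridAvg_congr le_rfl F hz]
        gcongr
        exact hzZ.2.2 k hk)
    calc ∫⁻ x in Z, F x ≤ ∫⁻ x in {x | ∃ k ≤ (0 : ℤ), gridCube a h k x ⊆ U ∧
          ∃ z ∈ gridCube a h k x, z ∈ Z}, F x := by
          refine lintegral_mono_set fun x hx => ?_
          obtain ⟨k, hk, hkU⟩ := exists_gridCube_subset a hh hU (hZU hx)
          exact ⟨k, hk, hkU, x, mem_gridCube_self a h k x, hx⟩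
      _ ≤ volume.withDensity F {x | ∃ k ≤ (0 : ℤ), gridCube a h k x ⊆ U ∧
          ∃ z ∈ gridCube a h k x, z ∈ Z} := withDensity_apply_le _ _
      _ ≤ t * volume U := by
          refine key.trans ?_
          rw [Measure.smul_apply, smul_eq_mul]
          gcongr
          rintro x ⟨k, -, hkU, -⟩
          exact hkU (mem_gridCube_self a h k x)
      _ ≤ t * (volume Z + ε / (t + 1)) := by gcongr
      _ ≤ t * volume Z + (t + 1) * (ε / (t + 1)) := by
          rw [mul_add]
          gcongr
          exact le_self_add
      _ = t * volume Z + ε := by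
          rw [ENNReal.mul_div_cancel (by simp) (by simp [ht])]
  by_contra hne
  have hlt : ∫⁻ _x in Z, t < ∫⁻ x in Z, F x := by
    refine setLIntegral_strict_mono hZm hne hF ?_ (ae_of_all _ fun x hx => hx.2.1)
    rw [setLIntegral_const]
    exact ENNReal.mul_ne_top ht hZfin
  rw [setLIntegral_const] at hlt
  exact absurd hle (not_le.2 hlt)

theorem gridCube_self_zero (a : Rn n) {h : ℝ} (hh : 0 < h) : gridCube a h 0 a = cube a h := by
  rw [gridCube_eq_cube a hh]
  simp [gridIndex]

/-- Calderón–Zygmund decomposition at height `t`: the mass of `W` above `t` is controlled by the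
measure of a lower level set. -/
theorem setLIntegral_level_le {W : Rn n → ℝ≥0∞} (hW : Measurable W) {B : ℝ≥0∞}
    (hB : ∀ (a : Rn n) (ℓ : ℝ), 0 < ℓ → ∀ t, t < (∫⁻ x in cube a ℓ, W x) / volume (cube a ℓ) →
      volume (cube a ℓ) ≤ B * volume (cube a ℓ ∩ {x | t < B * W x}))
    (a : Rn n) {h : ℝ} (hh : 0 < h) {t : ℝ≥0∞} (ht : t ≠ ∞)
    (havg : (∫⁻ x in cube a h, W x) / volume (cube a h) ≤ t) :
    ∫⁻ x in cube a h ∩ {x | t < W x}, W x ≤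
      2 ^ n * B * t * volume (cube a h ∩ {x | t < B * W x}) := by
  set Q := cube a h
  have hQm : MeasurableSet Q := measurableSet_cube a h
  have hQ : gridCube a h 0 a = Q := gridCube_self_zero a hh
  set F : Rn n → ℝ≥0∞ := Q.indicator W
  have hF : Measurable F := hW.indicator hQm
  set S := {x | t < B * W x}
  have hSm : MeasurableSet S := measurableSet_lt measurable_const (hW.const_mul _)
  have htm : MeasurableSet {x | t < W x} := measurableSet_lt measurable_const hW
  -- A selected cube meets `Q`, hence is contained in it.
  have hsub : ∀ k ≤ (0 : ℤ), ∀ x, t < gridAvg a h k F x → gridCube a h k x ⊆ Q := by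
    intro k hk x hx
    have hmeet : ∃ z ∈ gridCube a h k x, z ∈ Q := by
      by_contra hc
      push Not at hc
      have h0 : ∫⁻ y in gridCube a h k x, F y = 0 := by
        rw [setLIntegral_congr_fun (measurableSet_gridCube a h k x) (g := fun _ => 0)
          fun y hy => Set.indicator_of_notMem (hc y hy) _]
        simp
      rw [gridAvg, h0, ENNReal.zero_div] at hx
      exact absurd hx (by simp)
    obtain ⟨z, hz, hzQ⟩ := hmeet
    rw [← hQ] at hzQ ⊢
    refine (gridCube_subset_of_le a h hk x).trans (subset_of_eq ?_)
    rw [← gridCube_congr hk hz, gridCube_congr le_rfl hzQ]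
  have havgW : ∀ k x, gridCube a h k x ⊆ Q → gridAvg a h k F x =
      (∫⁻ y in gridCube a h k x, W y) / volume (gridCube a h k x) := by
    intro k x hx
    unfold gridAvg
    rw [setLIntegral_congr_fun (measurableSet_gridCube a h k x) (g := W)
          fun y hy => Set.indicator_of_mem (hx hy) _]
  have key := measure_le_of_maximal_gridCubes a h 0 (Q := fun k x => t < gridAvg a h k F x)
    (fun k x y hy hx => by rwa [gridAvg_congr le_rfl F hy])
    (volume.withDensity F) ((2 ^ n * B * t) • volume.restrict (Q ∩ S)) ?_
  · have hΩm : MeasurableSet {x | ∃ k ≤ (0 : ℤ), t < gridAvg a h k F x} := by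
      have : {x | ∃ k ≤ (0 : ℤ), t < gridAvg a h k F x} =
          ⋃ k : ℤ, ⋃ _ : k ≤ 0, {x | t < gridAvg a h k F x} := by ext x; simp
      rw [this]
      exact MeasurableSet.iUnion fun k => MeasurableSet.iUnion fun _ =>
        measurableSet_lt measurable_const (measurable_gridAvg a h k F)
    have hnull := ae_le_of_forall_gridAvg_le a hh hF hQm (volume_cube_ne_top a h) ht
    calc ∫⁻ x in Q ∩ {x | t < W x}, W x
        = ∫⁻ x in Q ∩ {x | t < W x}, F x :=
          setLIntegral_congr_fun (hQm.inter htm) fun x hx => (Set.indicator_of_mem hx.1 _).symm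
      _ ≤ ∫⁻ x in {x | ∃ k ≤ (0 : ℤ), t < gridAvg a h k F x}, F x := by
          refine lintegral_mono_set' ?_
          have h1 : ∀ᵐ x, ¬ (x ∈ Q ∧ t < F x ∧ ∀ k ≤ (0 : ℤ), gridAvg a h k F x ≤ t) :=
            measure_eq_zero_iff_ae_notMem.1 hnull
          filter_upwards [h1] with x hx hxQ
          by_contra hc
          refine hx ⟨hxQ.1, ?_, fun k hk => not_lt.1 fun hlt => hc ⟨k, hk, hlt⟩⟩
          simp only [F]
          rw [Set.indicator_of_mem hxQ.1]
          exact hxQ.2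
      _ ≤ _ := by
          rw [← withDensity_apply _ hΩm]
          refine key.trans ?_
          rw [Measure.smul_apply, smul_eq_mul]
          exact mul_le_mul' le_rfl
            ((measure_mono (Set.subset_univ _)).trans_eq (Measure.restrict_apply_univ _))
  · intro k hk x hx hmax
    have hkQ := hsub k hk x hx
    have hk0 : k ≠ 0 := by
      rintro rfl
      have hxQ : x ∈ gridCube a h 0 a := by
        rw [hQ]; exact hkQ (mem_gridCube_self a h 0 x)
      rw [gridAvg_congr le_rfl F hxQ, havgW 0 a hQ.subset, hQ] at hx
      exact absurd havg (not_le.2 hx)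
    have hpar : gridAvg a h (k + 1) F x ≤ t := not_lt.1 (hmax (k + 1) (by omega) (by omega))
    have hDm := measurableSet_gridCube a h k x
    have hvol : volume (gridCube a h k x) ≤ B * volume (gridCube a h k x ∩ S) := by
      rw [havgW k x hkQ] at hx
      rw [gridCube_eq_cube a hh] at hx ⊢
      exact hB _ _ (side_pos hh k) t hx
    rw [withDensity_apply _ hDm, Measure.smul_apply, smul_eq_mul, Measure.restrict_apply hDm]
    calc ∫⁻ y in gridCube a h k x, F y ≤ ∫⁻ y in gridCube a h (k + 1) x, F y :=
          lintegral_mono_set (gridCube_subset_of_le a h (by omega) x)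
      _ ≤ volume (gridCube a h (k + 1) x) * t := by
          rw [setLIntegral_gridCube a hh]
          gcongr
      _ = 2 ^ n * volume (gridCube a h k x) * t := by
          rw [volume_gridCube a hh, volume_gridCube a hh, zpow_add_one₀ two_ne_zero, ← mul_assoc,
            mul_comm _ (2 : ℝ), ENNReal.ofReal_mul two_pos.le, mul_pow]
          simp
      _ ≤ 2 ^ n * (B * volume (gridCube a h k x ∩ S)) * t := by gcongr
      _ ≤ 2 ^ n * (B * volume (gridCube a h k x ∩ (Q ∩ S))) * t := by
          rw [← Set.inter_assoc, Set.inter_eq_left.2 hkQ]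
      _ = _ := by ring

/-- Gehring's self-improvement: the level set estimate, integrated against `t ^ (ε - 1)`, gives a
reverse Hölder inequality once `ε` is small enough to absorb the last term. -/
theorem setLIntegral_mul_min_rpow_le {W : Rn n → ℝ≥0∞} (hW : Measurable W) {Q : Set (Rn n)}
    (hfin : ∫⁻ x in Q, W x ≠ ∞) {b ε : ℝ} (hb : 1 ≤ b)
    (hε : ε = 1 / (2 ^ (n + 1) * b ^ 3)) {U : ℝ≥0∞}
    (H : ∀ t : ℝ≥0∞, t ≠ ∞ → U ≤ t → ∫⁻ x in Q ∩ {x | t < W x}, W x ≤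
      2 ^ n * ENNReal.ofReal b * t * volume (Q ∩ {x | t < ENNReal.ofReal b * W x})) (N : ℕ) :
    ∫⁻ x in Q, W x * min (W x) N ^ ε ≤ 2 * (U ^ ε * ∫⁻ x in Q, W x) := by
  have hb0 : 0 < b := by linarith
  have hε0 : 0 < ε := by rw [hε]; positivity
  have hε1 : ε ≤ 1 := by
    rw [hε, div_le_one (by positivity)]
    exact one_le_mul_of_one_le_of_one_le (one_le_pow₀ one_le_two) (one_le_pow₀ hb)
  set B := ENNReal.ofReal b
  have hB1 : 1 ≤ B := by simpa [B] using hb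
  set J := ∫⁻ x in Q, W x
  set Y := ∫⁻ x in Q, W x * min (W x) N ^ ε
  have hYt : Y ≠ ∞ := by
    refine ne_top_of_le_ne_top (b := J * (N : ℝ≥0∞) ^ ε) ?_ ?_
    · exact ENNReal.mul_ne_top hfin (ENNReal.rpow_ne_top_of_nonneg hε0.le (by simp))
    · rw [← lintegral_mul_const _ hW]
      exact lintegral_mono fun x =>
        mul_le_mul' le_rfl (ENNReal.rpow_le_rpow (min_le_right _ _) hε0.le)
  have hXm : Measurable fun x => min (W x) (N : ℝ≥0∞) := hW.min measurable_const
  have hX'm : Measurable fun x => min (B * W x) (N : ℝ≥0∞) :=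
    (hW.const_mul _).min measurable_const
  have hL := lintegral_mul_rpow_eq_lintegral_layers (μ := volume.restrict Q) hε0 hW hXm
  have hR := lintegral_mul_rpow_eq_lintegral_layers (μ := volume.restrict Q)
    (by linarith : 0 < 1 + ε) (measurable_const (a := (1 : ℝ≥0∞))) hX'm
  simp only [one_mul, setLIntegral_one] at hR
  have hlev : ∀ t ∈ Set.Ioi (0 : ℝ), ENNReal.ofReal t ^ (ε - 1) *
      ∫⁻ x in {x | ENNReal.ofReal t < min (W x) N}, W x ∂(volume.restrict Q) ≤
      (if ENNReal.ofReal t < U then ENNReal.ofReal t ^ (ε - 1) else 0) * J +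
      2 ^ n * B * (ENNReal.ofReal t ^ (1 + ε - 1) *
        (volume.restrict Q) {x | ENNReal.ofReal t < min (B * W x) N}) := by
    intro t ht
    have ht0 : ENNReal.ofReal t ≠ 0 := by simpa using ht
    have hm : MeasurableSet {x | ENNReal.ofReal t < min (W x) N} :=
      measurableSet_lt measurable_const hXm
    have hm' : MeasurableSet {x | ENNReal.ofReal t < min (B * W x) N} :=
      measurableSet_lt measurable_const hX'm
    rw [Measure.restrict_restrict hm, Measure.restrict_apply hm']
    by_cases htU : ENNReal.ofReal t < U
    · rw [if_pos htU]
      refine le_add_right ?_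
      gcongr
      exact lintegral_mono_set Set.inter_subset_right
    · rw [if_neg htU, zero_mul, zero_add]
      by_cases htN : ENNReal.ofReal t < N
      · have e1 : {x | ENNReal.ofReal t < min (W x) N} ∩ Q = Q ∩ {x | ENNReal.ofReal t < W x} := by
          ext x; simp [htN, and_comm]
        have e2 : {x | ENNReal.ofReal t < min (B * W x) N} ∩ Q =
            Q ∩ {x | ENNReal.ofReal t < B * W x} := by
          ext x; simp [htN, and_comm]
        rw [e1, e2]
        calc _ ≤ ENNReal.ofReal t ^ (ε - 1) * (2 ^ n * B * ENNReal.ofReal t *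
              volume (Q ∩ {x | ENNReal.ofReal t < B * W x})) := by
              gcongr
              exact H _ ENNReal.ofReal_ne_top (not_lt.1 htU)
          _ = 2 ^ n * B * ((ENNReal.ofReal t ^ (ε - 1) * ENNReal.ofReal t) *
              volume (Q ∩ {x | ENNReal.ofReal t < B * W x})) := by ring
          _ = _ := by
              have := ENNReal.rpow_add (ε - 1) 1 ht0 ENNReal.ofReal_ne_top
              rw [ENNReal.rpow_one] at this
              rw [← this]
              ring_nf
      · have e1 : {x | ENNReal.ofReal t < min (W x) N} = ∅ := by
          ext x; simp [htN]
        rw [e1]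
        simp
  have hUε : ENNReal.ofReal ε * ∫⁻ t in Set.Ioi (0 : ℝ),
      (if ENNReal.ofReal t < U then ENNReal.ofReal t ^ (ε - 1) else 0) = U ^ ε := by
    rw [setLIntegral_rpow_lt hε0, ENNReal.mul_div_cancel (by simpa using hε0) ENNReal.ofReal_ne_top]
  have hmU : Measurable fun t : ℝ =>
      (if ENNReal.ofReal t < U then ENNReal.ofReal t ^ (ε - 1) else 0) :=
    Measurable.ite (measurableSet_lt (by fun_prop) measurable_const) (by fun_prop) measurable_const
  have hX' : ∫⁻ x in Q, min (B * W x) (N : ℝ≥0∞) ^ (1 + ε) ≤ B ^ 2 * Y := by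
    have hm : Measurable fun x => W x * min (W x) (N : ℝ≥0∞) ^ ε := hW.mul (hXm.pow_const _)
    simp only [Y]
    rw [← lintegral_const_mul _ hm]
    refine lintegral_mono fun x => ?_
    have h1 : min (B * W x) (N : ℝ≥0∞) ≤ B * min (W x) N := by
      rcases le_total (W x) (N : ℝ≥0∞) with h | h
      · rw [min_eq_left h]; exact min_le_left _ _
      · rw [min_eq_right h]
        exact (min_le_right _ _).trans (le_mul_of_one_le_left zero_le hB1)
    have h2 : B ^ ε ≤ B := by
      calc B ^ ε ≤ B ^ (1 : ℝ) := ENNReal.rpow_le_rpow_of_exponent_le hB1 hε1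
        _ = B := ENNReal.rpow_one B
    calc min (B * W x) (N : ℝ≥0∞) ^ (1 + ε)
        = min (B * W x) (N : ℝ≥0∞) * min (B * W x) (N : ℝ≥0∞) ^ ε := by
          rw [ENNReal.rpow_add_of_nonneg _ _ zero_le_one hε0.le, ENNReal.rpow_one]
      _ ≤ (B * W x) * (B * min (W x) N) ^ ε := by
          gcongr
          exact min_le_left _ _
      _ = B ^ ε * (B * (W x * min (W x) N ^ ε)) := by
          rw [ENNReal.mul_rpow_of_nonneg _ _ hε0.le]; ring
      _ ≤ B * (B * (W x * min (W x) N ^ ε)) := by gcongr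
      _ = _ := by ring
  have hcoef : ENNReal.ofReal ε * (2 ^ n * B * B ^ 2) = 2⁻¹ := by
    simp only [B]
    rw [← ENNReal.ofReal_pow hb0.le, ← ENNReal.ofReal_ofNat 2, ← ENNReal.ofReal_pow two_pos.le,
      ← ENNReal.ofReal_mul (by positivity), ← ENNReal.ofReal_mul (by positivity),
      ← ENNReal.ofReal_mul (by positivity), ← ENNReal.ofReal_inv_of_pos two_pos, hε]
    congr 1
    field_simp
    ring
  have hR' : ∫⁻ t in Set.Ioi (0 : ℝ), ENNReal.ofReal t ^ (1 + ε - 1) *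
        (volume.restrict Q) {x | ENNReal.ofReal t < min (B * W x) N} ≤ B ^ 2 * Y := by
    refine le_trans ?_ (hR.symm.le.trans hX')
    refine le_mul_of_one_le_left zero_le ?_
    rw [ENNReal.one_le_ofReal]
    linarith
  have hmain : Y ≤ U ^ ε * J + Y / 2 := by
    calc Y = ENNReal.ofReal ε * ∫⁻ t in Set.Ioi (0 : ℝ), ENNReal.ofReal t ^ (ε - 1) *
            ∫⁻ x in {x | ENNReal.ofReal t < min (W x) N}, W x ∂(volume.restrict Q) := hL
      _ ≤ ENNReal.ofReal ε * ∫⁻ t in Set.Ioi (0 : ℝ),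
            ((if ENNReal.ofReal t < U then ENNReal.ofReal t ^ (ε - 1) else 0) * J +
            2 ^ n * B * (ENNReal.ofReal t ^ (1 + ε - 1) *
              (volume.restrict Q) {x | ENNReal.ofReal t < min (B * W x) N})) := by
          exact mul_le_mul' le_rfl (setLIntegral_mono' measurableSet_Ioi hlev)
      _ = ENNReal.ofReal ε * (∫⁻ t in Set.Ioi (0 : ℝ),
            (if ENNReal.ofReal t < U then ENNReal.ofReal t ^ (ε - 1) else 0)) * J +
            ENNReal.ofReal ε * (2 ^ n * B) * ∫⁻ t in Set.Ioi (0 : ℝ),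
              ENNReal.ofReal t ^ (1 + ε - 1) *
              (volume.restrict Q) {x | ENNReal.ofReal t < min (B * W x) N} := by
          rw [lintegral_add_left (hmU.mul_const _), lintegral_mul_const _ hmU,
            lintegral_const_mul' _ _ (ENNReal.mul_ne_top (by simp) ENNReal.ofReal_ne_top)]
          ring
      _ ≤ U ^ ε * J + ENNReal.ofReal ε * (2 ^ n * B) * (B ^ 2 * Y) := by
          rw [hUε]
          gcongr
      _ = U ^ ε * J + ENNReal.ofReal ε * (2 ^ n * B * B ^ 2) * Y := by ring
      _ = _ := by rw [hcoef, mul_comm 2⁻¹, ← div_eq_mul_inv]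
  nth_rewrite 1 [← ENNReal.add_halves Y] at hmain
  have h1 : Y / 2 ≤ U ^ ε * J :=
    (ENNReal.add_le_add_iff_right (ENNReal.div_ne_top hYt two_ne_zero)).1 hmain
  rwa [ENNReal.div_le_iff two_ne_zero (by simp), mul_comm] at h1

/-- `A_∞` weights satisfy a reverse Hölder inequality with exponent and constant depending only on
the dimension and on a bound for the `A_∞` characteristic. -/
theorem exists_reverse_holder (n : ℕ) (K : ℝ≥0) : ∃ r : ℝ, 1 < r ∧ ∀ w : Rn n → ℝ, IsWeight w →
    aInftyConst w ≤ K → ∀ (a : Rn n) (ℓ : ℝ), 0 < ℓ →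
      (∫⁻ x in cube a ℓ, ENNReal.ofReal (w x) ^ r) / volume (cube a ℓ) ≤
        2 * ((∫⁻ x in cube a ℓ, ENNReal.ofReal (w x)) / volume (cube a ℓ)) ^ r := by
  set b : ℝ := 4 * (K + 1)
  have hb : 1 ≤ b := by
    have := K.coe_nonneg
    simp only [b]; linarith
  set ε : ℝ := 1 / (2 ^ (n + 1) * b ^ 3) with hε
  have hε0 : 0 < ε := by positivity
  refine ⟨1 + ε, by linarith, fun w hw hK a ℓ hℓ => ?_⟩
  have hwm : AEStronglyMeasurable w volume := hw.locallyIntegrable.aestronglyMeasurable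
  set v := hwm.mk
  have hv : Measurable v := hwm.stronglyMeasurable_mk.measurable
  have hwv : w =ᵐ[volume] v := hwm.ae_eq_mk
  have hint : ∀ (φ : ℝ≥0∞ → ℝ≥0∞) (a : Rn n) (ℓ : ℝ),
      ∫⁻ x in cube a ℓ, φ (ENNReal.ofReal (w x)) = ∫⁻ x in cube a ℓ, φ (ENNReal.ofReal (v x)) :=
    fun φ a ℓ => lintegral_congr_ae (ae_restrict_of_ae (hwv.mono fun x hx => by simp only [hx]))
  have hKv : aInftyConst v ≤ K := by
    refine le_trans (le_of_eq ?_) hK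
    unfold aInftyConst apConst
    refine congrArg (fun g => limsup g atTop) (funext fun s => ?_)
    simp_rw [hint fun z => z, hint fun z => z ^ (-(1 / (s - 1)))]
  have hW : Measurable fun x => ENNReal.ofReal (v x) := hv.ennreal_ofReal
  have hfin : ∀ (a : Rn n) (ℓ : ℝ), 0 < ℓ → ∫⁻ x in cube a ℓ, ENNReal.ofReal (v x) ≠ ∞ := by
    intro a ℓ hℓ
    rw [← hint fun z => z]
    have hsub : cube a ℓ ⊆ Metric.closedBall a (n * ℓ) := by
      intro x hx
      rw [Metric.mem_closedBall, dist_eq_norm]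
      refine norm_le_mul_of_forall_coord hℓ.le fun i => ?_
      have := hx i
      rw [PiLp.sub_apply, abs_le]
      constructor <;> linarith
    have hloc : IntegrableOn w (cube a ℓ) volume :=
      (hw.locallyIntegrable.integrableOn_isCompact (isCompact_closedBall a (n * ℓ))).mono_set hsub
    refine ne_top_of_le_ne_top hloc.2.ne (lintegral_mono fun x => ?_)
    exact Real.ofReal_le_enorm (w x)
  have hPZ : ∀ (a : Rn n) (ℓ : ℝ), 0 < ℓ → ∀ t,
      t < (∫⁻ x in cube a ℓ, ENNReal.ofReal (v x)) / volume (cube a ℓ) →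
      volume (cube a ℓ) ≤ ENNReal.ofReal b *
        volume (cube a ℓ ∩ {x | t < ENNReal.ofReal b * ENNReal.ofReal (v x)}) := by
    intro a ℓ hℓ t ht
    have hbK : ENNReal.ofReal b = 4 * (K + 1) := by
      simp only [b]
      rw [ENNReal.ofReal_mul (by norm_num), ENNReal.ofReal_add K.coe_nonneg zero_le_one]
      simp
    rw [hbK]
    exact volume_le_of_average_le hW (measurableSet_cube a ℓ) (volume_cube_ne_zero a hℓ)
      (volume_cube_ne_top a ℓ) (hfin a ℓ hℓ) (average_le_of_aInftyConst_le hv hKv a hℓ) ht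
  set Q := cube a ℓ
  have hV0 : volume Q ≠ 0 := volume_cube_ne_zero a hℓ
  have hVt : volume Q ≠ ∞ := volume_cube_ne_top a ℓ
  rw [hint (fun z => z ^ (1 + ε)), hint fun z => z]
  set J := ∫⁻ x in Q, ENNReal.ofReal (v x)
  have hN := setLIntegral_mul_min_rpow_le hW (hfin a ℓ hℓ) hb hε (U := J / volume Q)
    fun t ht hUt => setLIntegral_level_le hW hPZ a hℓ ht hUt
  have hlim : Tendsto (fun N : ℕ => ∫⁻ x in Q,
      ENNReal.ofReal (v x) * min (ENNReal.ofReal (v x)) N ^ ε) atTop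
      (𝓝 (∫⁻ x in Q, ENNReal.ofReal (v x) ^ (1 + ε))) := by
    refine lintegral_tendsto_of_tendsto_of_monotone
      (fun N => (hW.mul ((hW.min measurable_const).pow_const _)).aemeasurable)
      (ae_of_all _ fun x N M hNM => ?_) (ae_of_all _ fun x => ?_)
    · simp only
      gcongr
    · rw [ENNReal.rpow_add_of_nonneg _ _ zero_le_one hε0.le, ENNReal.rpow_one]
      refine ENNReal.Tendsto.const_mul ?_ (Or.inr ENNReal.ofReal_ne_top)
      refine (ENNReal.continuous_rpow_const.tendsto _).comp ?_
      have : Tendsto (fun N : ℕ => min (ENNReal.ofReal (v x)) (N : ℝ≥0∞)) atTop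
          (𝓝 (min (ENNReal.ofReal (v x)) ∞)) := tendsto_const_nhds.min ENNReal.tendsto_nat_nhds_top
      rwa [min_eq_left le_top] at this
  calc _ ≤ 2 * ((J / volume Q) ^ ε * J) / volume Q := by
        gcongr
        exact le_of_tendsto' hlim hN
    _ = 2 * (J / volume Q * (J / volume Q) ^ ε) := by
        simp only [div_eq_mul_inv]
        ring
    _ = _ := by rw [ENNReal.rpow_add_of_nonneg _ _ zero_le_one hε0.le, ENNReal.rpow_one]

/-- For an `A_∞` weight the power-bumped constant is comparable to the plain one. -/
theorem olsenPowerConst_le {r β p : ℝ} (hr : 0 < r) (hp : 0 < p) {w : Rn n → ℝ}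
    (H : ∀ (a : Rn n) (ℓ : ℝ), 0 < ℓ →
      (∫⁻ x in cube a ℓ, ENNReal.ofReal (w x) ^ r) / volume (cube a ℓ) ≤
        2 * ((∫⁻ x in cube a ℓ, ENNReal.ofReal (w x)) / volume (cube a ℓ)) ^ r) :
    olsenPowerConst r β p w ≤ 2 ^ (1 / (r * p)) * olsenConst β p w := by
  refine iSup_le fun a => iSup_le fun ℓ => iSup_le fun hℓ => ?_
  have hle : ENNReal.ofReal ℓ ^ β * (weightMeasure w (cube a ℓ) / volume (cube a ℓ)) ^ (1 / p) ≤
      olsenConst β p w := le_iSup_of_le a (le_iSup_of_le ℓ (le_iSup_of_le hℓ le_rfl))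
  refine le_trans ?_ (mul_le_mul' le_rfl hle)
  have hwq : weightMeasure w (cube a ℓ) = ∫⁻ x in cube a ℓ, ENNReal.ofReal (w x) :=
    withDensity_apply _ (measurableSet_cube a ℓ)
  rw [hwq, mul_left_comm]
  gcongr
  refine (ENNReal.rpow_le_rpow (H a ℓ hℓ) (by positivity)).trans_eq ?_
  rw [ENNReal.mul_rpow_of_nonneg _ _ (by positivity), ← ENNReal.rpow_mul]
  congr 2
  field_simp

end MorreyTrace

end

theorem theorem1p1 {𝕜 : Type*} [RCLike 𝕜] (n m : ℕ) (P : Fin m → ℝ) (p p₀ α β θ q q₀ : ℝ)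
    (hP : ∀ i, 1 < P i) (hp : 1 / p = ∑ i, 1 / P i)
    (hp_one : 1 < p) (hpp₀ : p ≤ p₀) (hp₀ : p₀ < n / α)
    (hβ : 0 < β) (hβα : β ≤ α) (hα : α < m * n)
    (hθ : θ = (n - β * p₀) / (n - α * p₀)) (hq : q = θ * p) (hq₀ : q₀ = θ * p₀) :
    -- (a) weights in `A_∞`; the constant depends on the weight only through a bound on `[w]_{A_∞}`
    (∀ K : ℝ≥0, ∃ C : ℝ≥0, ∀ w : MorreyTrace.Rn n → ℝ, MorreyTrace.IsWeight w →
      MorreyTrace.aInftyConst w ≤ K → MorreyTrace.olsenConst β p w < ∞ →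
      ∀ f : Fin m → MorreyTrace.Rn n → 𝕜, (∀ i, LocallyIntegrable (f i) volume) →
        MorreyTrace.productMorreyNorm P p₀ f < ∞ →
        (∀ᵐ x ∂(MorreyTrace.weightMeasure w), Integrable (MorreyTrace.fracIntegrand α f x)) ∧
        AEStronglyMeasurable (MorreyTrace.fracIntegral α f) (MorreyTrace.weightMeasure w) ∧
        MorreyTrace.radonMorreyNorm (MorreyTrace.weightMeasure w) q q₀
            (MorreyTrace.fracIntegral α f) ≤
          C * MorreyTrace.olsenConst β p w ^ (1 / θ) * MorreyTrace.productMorreyNorm P p₀ f) ∧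
    -- (b) general weights, with a power bump `r > 1`
    (∀ r : ℝ, 1 < r → ∃ C : ℝ≥0, ∀ w : MorreyTrace.Rn n → ℝ, MorreyTrace.IsWeight w →
      MorreyTrace.olsenPowerConst r β p w < ∞ →
      ∀ f : Fin m → MorreyTrace.Rn n → 𝕜, (∀ i, LocallyIntegrable (f i) volume) →
        MorreyTrace.productMorreyNorm P p₀ f < ∞ →
        (∀ᵐ x ∂(MorreyTrace.weightMeasure w), Integrable (MorreyTrace.fracIntegrand α f x)) ∧
        AEStronglyMeasurable (MorreyTrace.fracIntegral α f) (MorreyTrace.weightMeasure w) ∧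
        MorreyTrace.radonMorreyNorm (MorreyTrace.weightMeasure w) q q₀
            (MorreyTrace.fracIntegral α f) ≤
          C * MorreyTrace.olsenPowerConst r β p w ^ (1 / θ) *
            MorreyTrace.productMorreyNorm P p₀ f) := by
  have hbump := fun {r : ℝ} (hr : 1 < r) =>
    MorreyTrace.exists_fracIntegral_bound_of_bump (n := n) (𝕜 := 𝕜) hP hp hp_one hpp₀ hp₀ hβ hβα hα
      hθ hq hq₀ hr
  refine ⟨fun K => ?_, fun r hr => hbump hr⟩
  obtain ⟨r, hr, hRH⟩ := MorreyTrace.exists_reverse_holder n K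
  obtain ⟨C, hC⟩ := hbump hr
  have hθ0 : 0 ≤ 1 / θ := by
    have hα0 : 0 < α := by linarith
    rw [lt_div_iff₀ hα0] at hp₀
    have := mul_le_mul_of_nonneg_right hβα (by linarith : 0 ≤ p₀)
    rw [hθ]
    exact one_div_nonneg.2 (div_nonneg (by linarith) (by linarith))
  have hD : ((2 : ℝ≥0∞) ^ (1 / (r * p))) ^ (1 / θ) ≠ ∞ :=
    ENNReal.rpow_ne_top_of_nonneg hθ0 (ENNReal.rpow_ne_top_of_nonneg (by positivity) (by simp))
  obtain ⟨D, hD⟩ : ∃ D : ℝ≥0, (D : ℝ≥0∞) = (2 ^ (1 / (r * p))) ^ (1 / θ) :=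
    ⟨_, ENNReal.coe_toNNReal hD⟩
  refine ⟨C * D, fun w hw hK hA f hf hM => ?_⟩
  have hle := MorreyTrace.olsenPowerConst_le (β := β) (by linarith : 0 < r)
    (by linarith : 0 < p) (hRH w hw hK)
  have hA' : MorreyTrace.olsenPowerConst r β p w < ∞ :=
    hle.trans_lt (ENNReal.mul_lt_top
      (ENNReal.rpow_lt_top_of_nonneg (by positivity) (by simp)) hA)
  obtain ⟨h1, h2, h3⟩ := hC w hw hA' f hf hM
  refine ⟨h1, h2, h3.trans ?_⟩
  refine mul_le_mul' ?_ le_rfl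
  calc (C : ℝ≥0∞) * MorreyTrace.olsenPowerConst r β p w ^ (1 / θ)
      ≤ C * (2 ^ (1 / (r * p)) * MorreyTrace.olsenConst β p w) ^ (1 / θ) := by gcongr
    _ = ((C * D : ℝ≥0) : ℝ≥0∞) * MorreyTrace.olsenConst β p w ^ (1 / θ) := by
      rw [ENNReal.mul_rpow_of_nonneg _ _ hθ0, ← hD, ENNReal.coe_mul, mul_assoc]
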